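/- **Setting.** Let $I$ be a finite set and $C=(c_{ij})_{i,j\in I}$ a symmetrizable generalized Cartan matrix: $c_{ii}=2$, $c_{ij}\in\mathbb Z_{\le 0}$ for $i\ne j$, $c_{ij}=0\iff c_{ji}=0$, and there are positive integers $d_i$ with $d_jc_{ij}=d_ic_{ji}$. Let $\mathbb K$ be any field. For $i\neq j$ let $Q_{ij}(u,v)\in\mathbb K[u,v]$ be nonzero, homogeneous of degree $-2d_ic_{ji}$ when $\deg u=2d_i$, $\deg v=2d_j$, of degree exactly $-c_{ji}$ in $u$, with $Q_{ij}(u,v)=Q_{ji}(v,u)$. Let $\alpha_i$ ($i\in I$) be the simple roots, $Q^+=\bigoplus_i\mathbb Z_{\ge0}\alpha_i$, and for a word $\mathbf i=i_1\cdots i_n$ in $I$ put $\alpha_{\mathbf i}=\alpha_{i_1}+\cdots+\alpha_{i_n}$. For $\nu\in Q^+$ of height $n$, the KLR algebra $R(\nu)$ is the $\mathbb K$-algebra generated by $e_{\mathbf i}$ ($\mathbf i$ a word with $\alpha_{\mathbf i}=\nu$), $y_1,\dots,y_n$, $\psi_1,\dots,\psi_{n-1}$ with the relations: $e_{\mathbf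 i}e_{\mathbf j}=\delta_{\mathbf i\mathbf j}e_{\mathbf i}$, $\sum_{\mathbf i} e_{\mathbf i}=1$, $y_ke_{\mathbf i}=e_{\mathbf i}y_k$, $\psi_ke_{\mathbf i}=e_{s_k\mathbf i}\psi_k$, $y_ky_l=y_ly_k$, $\psi_ky_l=y_l\psi_k$ for $l\ne k,k+1$, $\psi_k\psi_l=\psi_l\psi_k$ for $|k-l|>1$, $$(y_k\psi_k-\psi_ky_{k+1})e_{\mathbf i}=(\psi_ky_k-y_{k+1}\psi_k)e_{\mathbf i}=\delta_{i_k,i_{k+1}}e_{\mathbf i},$$ $$\psi_k^2e_{\mathbf i}=\begin{cases}0& i_k=i_{k+1}\\ Q_{i_ki_{k+1}}(y_k,y_{k+1})e_{\mathbf i}&i_k\neq i_{k+1},\end{cases}$$ $$(\psi_k\psi_{k+1}\psi_k-\psi_{k+1}\psi_k\psi_{k+1})e_{\mathbf i}=\begin{cases}\dfrac{Q_{i_ki_{k+1}}(y_{k+2},y_{k+1})-Q_{i_ki_{k+1}}(y_k,y_{k+1})}{y_{k+2}-y_k}e_{\mathbf i}& i_k=i_{k+2}\ne i_{k+1}\\0&\text{otherwise.}\end{cases}$$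 For an $R(\mu)$-module $L$ and an $R(\nu)$-module $M$, put $L\circ M=R(\mu+\nu)\otimes_{R(\mu)\otimes R(\nu)}(L\boxtimes M)$, where $R(\mu)\otimes R(\nu)\to R(\mu+\nu)$ is juxtaposition of diagrams (the diagrams of $R(\mu)$ to the left); the empty product is the trivial module of $R(0)=\mathbb K$. Let $\mathcal{KLR}$ be the set of isomorphism classes of simple finite-dimensional modules over some $R(\nu)$, $\nu\in Q^+$, on which all $y_k e_{\mathbf i}$ act nilpotently (these are the gradable simple modules); $\nu$ is called the weight $\mathrm{wt}(L)$ of such a module $L$. A *charge* is a linear map $c$ from the real span of the simple roots to $\mathbb C$ that sends $Q^+\setminus\{0\}$ to an open half-plane bounded by a line through $0$. For $\mu,\nu\in Q^+\setminus\{0\}$ write $\mu\ge_c\nu$ if $\arg c(\mu)\ge\arg c(\nu)$, for a branch of $\arg$ that is continuous on this half-plane. A module $L\in\mathcal{KLR}$ with $\mathrm{wt}(L)\neq0$ is *$c$-semi-cuspidal* if $\alpha_{i_1}+\cdots+\alpha_{i_j}\le_c\mathrm{wt}(L)$ for every word $\mathbf i=i_1\cdots i_n$ with $e_{\mathbf i}L\ne0$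 and all $1\le j<n$. **Theorem.** Fix an arbitrary charge $c$. 1. If $h\ge0$ and $L_1,\dots,L_h\in\mathcal{KLR}$ are $c$-semi-cuspidal with $\mathrm{wt}(L_1)>_c\cdots>_c\mathrm{wt}(L_h)$, then $L_1\circ\cdots\circ L_h$ has a unique simple quotient (i.e. exactly one submodule with simple quotient), and this quotient lies in $\mathcal{KLR}$. 2. For every $L\in\mathcal{KLR}$ there is a sequence $(L_1,\dots,L_h)$, $h\geq 0$, as in (1), unique up to isomorphism of its terms, such that $L$ is the simple quotient of $L_1\circ\cdots\circ L_h$. -/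

import Mathlib

open scoped TensorProduct

universe u

namespace KLR

/-! ### Cartan data and parameters -/

/-- A symmetrizable generalized Cartan matrix `C` with rows and columns indexed by the nodes of the
Dynkin diagram, and positive integers `d i` symmetrizing it: `d j * C i j = d i * C j i`. -/
structure CartanDatum (I : Type u) where
  C : I → I → ℤ
  d : I → ℕ
  diag : ∀ i, C i i = 2
  offDiag : ∀ i j, i ≠ j → C i j ≤ 0
  zero_iff : ∀ i j, C i j = 0 ↔ C j i = 0
  d_pos : ∀ i, 0 < d i
  symm : ∀ i j, (d j : ℤ) * C i j = d i * C j i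

/-- The data defining the KLR algebras: a symmetrizable Cartan datum and polynomials
`Q i j ∈ K[u, v]` (`u = X 0`, `v = X 1`; only `i ≠ j` matters), homogeneous of degree
`-2 * d i * C j i = -2 * d j * C i j` when `u` has degree `2 * d i` and `v` has degree `2 * d j`,
of degree exactly `-C j i` in `u`, with `Q i j (u, v) = Q j i (v, u)`. -/
structure Params (I K : Type u) [Field K] extends CartanDatum I where
  Q : I → I → MvPolynomial (Fin 2) K
  Q_homogeneous : ∀ i j, i ≠ j →
    (Q i j).IsWeightedHomogeneous ![2 * d i, 2 * d j] (2 * d i * (-C j i).toNat)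
  Q_ne_zero : ∀ i j, i ≠ j → Q i j ≠ 0
  Q_degree : ∀ i j, i ≠ j → (Q i j).degreeOf 0 = (-C j i).toNat
  Q_symm : ∀ i j, i ≠ j → Q j i = MvPolynomial.rename (Equiv.swap 0 1) (Q i j)

section Words

variable {I : Type u}

/-- The word `s_k i`: the letters in positions `k` and `k + 1` (counted from `0`) exchanged. -/
def swapWord {n : ℕ} (k : ℕ) (h : k + 1 < n) (i : Fin n → I) : Fin n → I :=
  i ∘ Equiv.swap ⟨k, by omega⟩ ⟨k + 1, h⟩

theorem swapWord_swapWord {n : ℕ} (k : ℕ) (h : k + 1 < n) (i : Fin n → I) :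
    swapWord k h (swapWord k h i) = i := by
  funext l
  simp [swapWord]

theorem swapWord_append_left {m n : ℕ} (k : ℕ) (h : k + 1 < m) (i : Fin m → I) (j : Fin n → I) :
    swapWord k (by omega) (Fin.append i j) = Fin.append (swapWord k h i) j := by
  funext l
  refine Fin.addCases (fun l => ?_) (fun l => ?_) l
  · rw [Fin.append_left]
    simp only [swapWord, Function.comp_apply]
    rw [← Fin.append_left i j]
    congr 1
    simp only [Equiv.swap_apply_def, Fin.ext_iff, Fin.val_castAdd]
    split_ifs <;> simp
  · rw [Fin.append_right]
    simp only [swapWord, Function.comp_apply]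
    rw [← Fin.append_right i j, Equiv.swap_apply_of_ne_of_ne] <;>
      simp only [ne_eq, Fin.ext_iff, Fin.val_natAdd] <;> omega

theorem swapWord_append_right {m n : ℕ} (k : ℕ) (h : k + 1 < n) (i : Fin m → I)
    (j : Fin n → I) :
    swapWord (m + k) (by omega) (Fin.append i j) = Fin.append i (swapWord k h j) := by
  funext l
  refine Fin.addCases (fun l => ?_) (fun l => ?_) l
  · rw [Fin.append_left]
    simp only [swapWord, Function.comp_apply]
    rw [Equiv.swap_apply_of_ne_of_ne, Fin.append_left] <;>
      simp only [ne_eq, Fin.ext_iff, Fin.val_castAdd] <;> omega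
  · rw [Fin.append_right]
    simp only [swapWord, Function.comp_apply]
    rw [← Fin.append_right i j]
    congr 1
    simp only [Equiv.swap_apply_def, Fin.ext_iff, Fin.val_natAdd]
    split_ifs <;> simp <;> omega

theorem append_inj {m n : ℕ} {i i' : Fin m → I} {j j' : Fin n → I}
    (h : Fin.append i j = Fin.append i' j') : i = i' ∧ j = j' :=
  Prod.mk.inj ((Fin.appendEquiv m n).injective (a₁ := (i, j)) (a₂ := (i', j')) h)

theorem append_left_mk {m n : ℕ} (i : Fin m → I) (j : Fin n → I) (k : ℕ) (hk : k < m) :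
    Fin.append i j ⟨k, by omega⟩ = i ⟨k, hk⟩ :=
  Fin.append_left i j ⟨k, hk⟩

theorem append_right_mk {m n : ℕ} (i : Fin m → I) (j : Fin n → I) (k : ℕ) (hk : k < n) :
    Fin.append i j ⟨m + k, by omega⟩ = j ⟨k, hk⟩ :=
  Fin.append_right i j ⟨k, hk⟩

variable [DecidableEq I]

/-- The weight `α_{i_1} + ⋯ + α_{i_j}` of the prefix of length `j` of a word.  An element of the
positive part `Q⁺` of the root lattice is a function `I → ℕ`, its coordinates in the simple
roots. -/
def prefixWeight {n : ℕ} (i : Fin n → I) (j : ℕ) : I → ℕ :=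
  fun a => (Finset.univ.filter fun k : Fin n => (k : ℕ) < j ∧ i k = a).card

/-- The weight `α_i = α_{i_1} + ⋯ + α_{i_n}` of a word. -/
def wordWeight {n : ℕ} (i : Fin n → I) : I → ℕ :=
  fun a => (Finset.univ.filter fun k : Fin n => i k = a).card

end Words

/-! ### The KLR algebra -/

/-- Generators of the KLR algebra on `n` strands: the straight line diagrams `e i`, a dot `y k` on
the strand in position `k`, and a crossing `psi k` of the strands in positions `k`, `k + 1`
(positions are counted from `0`, from left to right).  The diagrams of the theory in which the
bottom labels are prescribed are `y k * e i` and `psi k * e i`. -/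
inductive Gen (I : Type u) (n : ℕ) : Type u
  | e (i : Fin n → I)
  | y (k : Fin n)
  | psi (k : ℕ) (h : k + 1 < n)

section Evaluation

variable {K A : Type*} [Field K] [Ring A] [Algebra K A]

/-- `P(a, b)` for a polynomial `P(u, v)`, where `a` and `b` are thought of as commuting. -/
noncomputable def evalPoly (P : MvPolynomial (Fin 2) K) (a b : A) : A :=
  ∑ s ∈ P.support, P.coeff s • (a ^ s 0 * b ^ s 1)

/-- The divided difference `(P(c, b) - P(a, b)) / (c - a)` for a polynomial `P(u, v)`, where
`a`, `b`, `c` are thought of as commuting: the monomial `u ^ p * v ^ q` contributes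
`(c ^ (p - 1) + c ^ (p - 2) * a + ⋯ + a ^ (p - 1)) * b ^ q`. -/
noncomputable def evalDivDiff (P : MvPolynomial (Fin 2) K) (a b c : A) : A :=
  ∑ s ∈ P.support, P.coeff s •
    ((∑ r ∈ Finset.range (s 0), c ^ r * a ^ (s 0 - 1 - r)) * b ^ s 1)

theorem evalPoly_eq_aeval {B : Type*} [CommRing B] [Algebra K B] (P : MvPolynomial (Fin 2) K)
    (a b : B) : evalPoly P a b = MvPolynomial.aeval ![a, b] P := by
  rw [MvPolynomial.aeval_def, MvPolynomial.eval₂_eq', evalPoly]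
  refine Finset.sum_congr rfl fun s _ => ?_
  rw [Fin.prod_univ_two, Algebra.smul_def]
  rfl

theorem evalDivDiff_mul {B : Type*} [CommRing B] [Algebra K B] (P : MvPolynomial (Fin 2) K)
    (a b c : B) : evalDivDiff P a b c * (c - a) = evalPoly P c b - evalPoly P a b := by
  simp only [evalDivDiff, evalPoly]
  rw [Finset.sum_mul, ← Finset.sum_sub_distrib]
  refine Finset.sum_congr rfl fun s _ => ?_
  rw [← smul_sub, ← sub_mul, ← geom_sum₂_mul, smul_mul_assoc]
  congr 1
  ring

theorem map_evalPoly {B : Type*} [Ring B] [Algebra K B] (f : A →ₐ[K] B)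
    (P : MvPolynomial (Fin 2) K) (a b : A) : f (evalPoly P a b) = evalPoly P (f a) (f b) := by
  simp only [evalPoly, map_sum, map_smul, map_mul, map_pow]

theorem map_evalDivDiff {B : Type*} [Ring B] [Algebra K B] (f : A →ₐ[K] B)
    (P : MvPolynomial (Fin 2) K) (a b c : A) :
    f (evalDivDiff P a b c) = evalDivDiff P (f a) (f b) (f c) := by
  simp only [evalDivDiff, map_sum, map_smul, map_mul, map_pow]

end Evaluation

variable {I K : Type u} [Fintype I] [Field K]

/-- The defining relations of the KLR algebra on `n` strands, for elements `e i`, `y k`, `psi k`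
of a `K`-algebra.  A product `a * b` is the diagram `a` on top of the diagram `b`, so that
`X * e i` is the diagram `X` with bottom labels `i`. -/
inductive Rel (D : Params I K) (n : ℕ) {A : Type*} [Ring A] [Algebra K A]
    (e : (Fin n → I) → A) (y : Fin n → A) (psi : (k : ℕ) → k + 1 < n → A) : A → A → Prop
  | e_mul_self (i) : Rel D n e y psi (e i * e i) (e i)
  | e_mul_ne (i j) (hij : i ≠ j) : Rel D n e y psi (e i * e j) 0
  | e_sum : Rel D n e y psi (∑ i, e i) 1
  | y_mul_e (k i) : Rel D n e y psi (y k * e i) (e i * y k)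
  | psi_mul_e (k h i) : Rel D n e y psi (psi k h * e i) (e (swapWord k h i) * psi k h)
  | y_mul_y (k l) : Rel D n e y psi (y k * y l) (y l * y k)
  | psi_mul_y (k h) (l : Fin n) (h1 : (l : ℕ) ≠ k) (h2 : (l : ℕ) ≠ k + 1) :
      Rel D n e y psi (psi k h * y l) (y l * psi k h)
  | psi_mul_psi (k h l h') (hkl : k + 1 < l) :
      Rel D n e y psi (psi k h * psi l h') (psi l h' * psi k h)
  | dot_left_ne (k h i) (hi : i ⟨k, by omega⟩ ≠ i ⟨k + 1, h⟩) :
      Rel D n e y psi (y ⟨k, by omega⟩ * psi k h * e i) (psi k h * y ⟨k + 1, h⟩ * e i)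
  | dot_right_ne (k h i) (hi : i ⟨k, by omega⟩ ≠ i ⟨k + 1, h⟩) :
      Rel D n e y psi (psi k h * y ⟨k, by omega⟩ * e i) (y ⟨k + 1, h⟩ * psi k h * e i)
  | dot_left_eq (k h i) (hi : i ⟨k, by omega⟩ = i ⟨k + 1, h⟩) :
      Rel D n e y psi (y ⟨k, by omega⟩ * psi k h * e i) (psi k h * y ⟨k + 1, h⟩ * e i + e i)
  | dot_right_eq (k h i) (hi : i ⟨k, by omega⟩ = i ⟨k + 1, h⟩) :
      Rel D n e y psi (psi k h * y ⟨k, by omega⟩ * e i) (y ⟨k + 1, h⟩ * psi k h * e i + e i)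
  | psi_sq_eq (k h i) (hi : i ⟨k, by omega⟩ = i ⟨k + 1, h⟩) :
      Rel D n e y psi (psi k h * psi k h * e i) 0
  | psi_sq_ne (k h i) (hi : i ⟨k, by omega⟩ ≠ i ⟨k + 1, h⟩) :
      Rel D n e y psi (psi k h * psi k h * e i)
        (evalPoly (D.Q (i ⟨k, by omega⟩) (i ⟨k + 1, h⟩)) (y ⟨k, by omega⟩) (y ⟨k + 1, h⟩) * e i)
  | braid (k) (h : k + 2 < n) (i)
      (hi : ¬ (i ⟨k, by omega⟩ = i ⟨k + 2, h⟩ ∧ i ⟨k, by omega⟩ ≠ i ⟨k + 1, by omega⟩)) :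
      Rel D n e y psi
        (psi k (by omega) * psi (k + 1) h * psi k (by omega) * e i)
        (psi (k + 1) h * psi k (by omega) * psi (k + 1) h * e i)
  | braid_ne (k) (h : k + 2 < n) (i)
      (hi : i ⟨k, by omega⟩ = i ⟨k + 2, h⟩ ∧ i ⟨k, by omega⟩ ≠ i ⟨k + 1, by omega⟩) :
      Rel D n e y psi
        (psi k (by omega) * psi (k + 1) h * psi k (by omega) * e i)
        (psi (k + 1) h * psi k (by omega) * psi (k + 1) h * e i +
          evalDivDiff (D.Q (i ⟨k, by omega⟩) (i ⟨k + 1, by omega⟩))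
            (y ⟨k, by omega⟩) (y ⟨k + 1, by omega⟩) (y ⟨k + 2, h⟩) * e i)

/-- The relations among the generators of the free algebra. -/
def FreeRel (D : Params I K) (n : ℕ) :
    FreeAlgebra K (Gen I n) → FreeAlgebra K (Gen I n) → Prop :=
  Rel D n (fun i => FreeAlgebra.ι K (Gen.e i)) (fun k => FreeAlgebra.ι K (Gen.y k))
    (fun k h => FreeAlgebra.ι K (Gen.psi k h))

/-- The KLR algebra on `n` strands.  It is the (unital) direct sum `⨁ R(ν)` over all
`ν ∈ Q⁺` of height `n`; the unit of `R(ν)` is the sum of the `e i` with `wordWeight i = ν`.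
The whole KLR algebra `R = ⨁ R(ν)` is the direct sum of these algebras over all `n`. -/
def Alg (D : Params I K) (n : ℕ) : Type u := RingQuot (FreeRel D n)

noncomputable instance (D : Params I K) (n : ℕ) : Ring (Alg D n) :=
  inferInstanceAs (Ring (RingQuot (FreeRel D n)))

noncomputable instance (D : Params I K) (n : ℕ) : Algebra K (Alg D n) :=
  inferInstanceAs (Algebra K (RingQuot (FreeRel D n)))

namespace Alg

variable (D : Params I K) {n : ℕ}

/-- The quotient map from the free algebra on the generators. -/
noncomputable def mk (n : ℕ) : FreeAlgebra K (Gen I n) →ₐ[K] Alg D n :=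
  RingQuot.mkAlgHom K (FreeRel D n)

theorem mk_surjective (n : ℕ) : Function.Surjective (mk D n) :=
  RingQuot.mkAlgHom_surjective K (FreeRel D n)

/-- The idempotent `e_i`. -/
noncomputable def e (i : Fin n → I) : Alg D n :=
  mk D n (FreeAlgebra.ι K (Gen.e i))

/-- A dot on the strand in position `k`. -/
noncomputable def y (k : Fin n) : Alg D n :=
  mk D n (FreeAlgebra.ι K (Gen.y k))

/-- A crossing of the strands in positions `k` and `k + 1`. -/
noncomputable def psi (k : ℕ) (h : k + 1 < n) : Alg D n :=
  mk D n (FreeAlgebra.ι K (Gen.psi k h))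

variable {D}

theorem rel_map {A B : Type*} [Ring A] [Algebra K A] [Ring B] [Algebra K B] (f : A →ₐ[K] B)
    {e : (Fin n → I) → A} {y : Fin n → A} {psi : (k : ℕ) → k + 1 < n → A} {a b : A}
    (h : Rel D n e y psi a b) :
    Rel D n (fun i => f (e i)) (fun k => f (y k)) (fun k h => f (psi k h)) (f a) (f b) := by
  cases h <;> simp only [map_mul, map_add, map_sum, map_one, map_zero, map_evalPoly,
    map_evalDivDiff]
  · exact .e_mul_self _
  · exact .e_mul_ne _ _ ‹_›
  · exact .e_sum
  · exact .y_mul_e _ _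
  · exact .psi_mul_e _ _ _
  · exact .y_mul_y _ _
  · exact .psi_mul_y _ _ _ ‹_› ‹_›
  · exact .psi_mul_psi _ _ _ _ ‹_›
  · exact .dot_left_ne _ _ _ ‹_›
  · exact .dot_right_ne _ _ _ ‹_›
  · exact .dot_left_eq _ _ _ ‹_›
  · exact .dot_right_eq _ _ _ ‹_›
  · exact .psi_sq_eq _ _ _ ‹_›
  · exact .psi_sq_ne _ _ _ ‹_›
  · exact .braid _ _ _ ‹_›
  · exact .braid_ne _ _ _ ‹_›

/-- The universal property: elements of a `K`-algebra satisfying the relations define an algebra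
homomorphism. -/
noncomputable def lift {A : Type*} [Ring A] [Algebra K A]
    (e : (Fin n → I) → A) (y : Fin n → A) (psi : (k : ℕ) → k + 1 < n → A)
    (H : ∀ a b, Rel D n e y psi a b → a = b) : Alg D n →ₐ[K] A :=
  RingQuot.liftAlgHom K ⟨FreeAlgebra.lift K fun
    | Gen.e i => e i
    | Gen.y k => y k
    | Gen.psi k h => psi k h, fun a b hab => H _ _ (by
      simpa only [FreeAlgebra.lift_ι_apply] using rel_map (FreeAlgebra.lift K fun
        | Gen.e i => e i
        | Gen.y k => y k
        | Gen.psi k h => psi k h) hab)⟩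

section

variable {A : Type*} [Ring A] [Algebra K A] {e' : (Fin n → I) → A} {y' : Fin n → A}
  {psi' : (k : ℕ) → k + 1 < n → A} (H : ∀ a b, Rel D n e' y' psi' a b → a = b)

theorem lift_e (i) : lift e' y' psi' H (e D i) = e' i :=
  (RingQuot.liftAlgHom_mkAlgHom_apply K _ _ _).trans (FreeAlgebra.lift_ι_apply _ _)

theorem lift_y (k) : lift e' y' psi' H (y D k) = y' k :=
  (RingQuot.liftAlgHom_mkAlgHom_apply K _ _ _).trans (FreeAlgebra.lift_ι_apply _ _)

theorem lift_psi (k h) : lift e' y' psi' H (psi D k h) = psi' k h :=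
  (RingQuot.liftAlgHom_mkAlgHom_apply K _ _ _).trans (FreeAlgebra.lift_ι_apply _ _)

end

/-- The generators of the KLR algebra satisfy the relations. -/
theorem rel_eq {a b : Alg D n} (h : Rel D n (e D) (y D) (psi D) a b) : a = b := by
  have key : ∀ a b, Rel D n (e D) (y D) (psi D) a b →
      ∃ a' b', FreeRel D n a' b' ∧ mk D n a' = a ∧
        mk D n b' = b := by
    intro a b h
    cases h
    · exact ⟨_, _, .e_mul_self _, by simp only [map_mul]; rfl, rfl⟩
    · exact ⟨_, _, .e_mul_ne _ _ ‹_›, by simp only [map_mul]; rfl, map_zero _⟩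
    · exact ⟨_, _, .e_sum, by simp only [map_sum]; rfl, map_one _⟩
    · exact ⟨_, _, .y_mul_e _ _, by simp only [map_mul]; rfl, by simp only [map_mul]; rfl⟩
    · exact ⟨_, _, .psi_mul_e _ _ _, by simp only [map_mul]; rfl, by simp only [map_mul]; rfl⟩
    · exact ⟨_, _, .y_mul_y _ _, by simp only [map_mul]; rfl, by simp only [map_mul]; rfl⟩
    · rename_i k h l h1 h2
      exact ⟨_, _, .psi_mul_y k h l h1 h2, by simp only [map_mul]; rfl,
        by simp only [map_mul]; rfl⟩
    · exact ⟨_, _, .psi_mul_psi _ _ _ _ ‹_›, by simp only [map_mul]; rfl,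
        by simp only [map_mul]; rfl⟩
    · exact ⟨_, _, .dot_left_ne _ _ _ ‹_›, by simp only [map_mul]; rfl,
        by simp only [map_mul]; rfl⟩
    · exact ⟨_, _, .dot_right_ne _ _ _ ‹_›, by simp only [map_mul]; rfl,
        by simp only [map_mul]; rfl⟩
    · exact ⟨_, _, .dot_left_eq _ _ _ ‹_›, by simp only [map_mul]; rfl,
        by simp only [map_mul, map_add]; rfl⟩
    · exact ⟨_, _, .dot_right_eq _ _ _ ‹_›, by simp only [map_mul]; rfl,
        by simp only [map_mul, map_add]; rfl⟩
    · exact ⟨_, _, .psi_sq_eq _ _ _ ‹_›, by simp only [map_mul]; rfl, map_zero _⟩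
    · exact ⟨_, _, .psi_sq_ne _ _ _ ‹_›, by simp only [map_mul]; rfl,
        by simp only [map_mul, map_evalPoly]; rfl⟩
    · exact ⟨_, _, .braid _ _ _ ‹_›, by simp only [map_mul]; rfl, by simp only [map_mul]; rfl⟩
    · exact ⟨_, _, .braid_ne _ _ _ ‹_›, by simp only [map_mul]; rfl,
        by simp only [map_mul, map_add, map_evalDivDiff]; rfl⟩
  obtain ⟨a', b', hr, rfl, rfl⟩ := key a b h
  exact RingQuot.mkAlgHom_rel K hr

/-! #### Horizontal juxtaposition of diagrams -/

theorem hom_commute {A : Type*} [Ring A] [Algebra K A] (f : Alg D n →ₐ[K] A) (x : A)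
    (he : ∀ i, Commute (f (e D i)) x) (hy : ∀ k, Commute (f (y D k)) x)
    (hpsi : ∀ k h, Commute (f (psi D k h)) x) (a : Alg D n) : Commute (f a) x := by
  obtain ⟨a, rfl⟩ := mk_surjective D n a
  induction a using FreeAlgebra.induction with
  | grade0 r =>
    rw [AlgHom.commutes, AlgHom.commutes]
    exact Algebra.commutes r x
  | grade1 g =>
    cases g with
    | e i => exact he i
    | y k => exact hy k
    | psi k h => exact hpsi k h
  | mul a b ha hb => rw [map_mul, map_mul]; exact ha.mul_left hb
  | add a b ha hb => rw [map_add, map_add]; exact ha.add_left hb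

theorem e_commute (i j : Fin n → I) : Commute (e D i) (e D j) := by
  by_cases hij : i = j
  · rw [hij]
  · exact (rel_eq (.e_mul_ne i j hij)).trans (rel_eq (.e_mul_ne j i (Ne.symm hij))).symm

/-- Placing `n` vertical strands to the right of a diagram on `m` strands. -/
noncomputable def inclLeft (D : Params I K) (m n : ℕ) : Alg D m →ₐ[K] Alg D (m + n) :=
  lift (fun i => ∑ j : Fin n → I, e D (Fin.append i j)) (fun k => y D (Fin.castAdd n k))
    (fun k _ => psi D k (by omega)) (by
    classical
    intro a b h
    cases h with
    | e_mul_self i =>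
      rw [Finset.sum_mul]
      refine Finset.sum_congr rfl fun j _ => ?_
      rw [Finset.mul_sum, Finset.sum_eq_single j]
      · exact rel_eq (.e_mul_self _)
      · intro j' _ hj
        exact rel_eq (.e_mul_ne _ _ fun h => hj (append_inj h).2.symm)
      · simp
    | e_mul_ne i i' h =>
      rw [Finset.sum_mul_sum]
      exact Finset.sum_eq_zero fun j _ => Finset.sum_eq_zero fun j' _ =>
        rel_eq (.e_mul_ne _ _ fun h' => h (append_inj h').1)
    | e_sum =>
      rw [← rel_eq (D := D) .e_sum, ← (Fin.appendEquiv m n).sum_comp, Fintype.sum_prod_type]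
      rfl
    | y_mul_e k i =>
      rw [Finset.mul_sum, Finset.sum_mul]
      exact Finset.sum_congr rfl fun j _ => rel_eq (.y_mul_e _ _)
    | psi_mul_e k h i =>
      rw [Finset.mul_sum, Finset.sum_mul]
      refine Finset.sum_congr rfl fun j _ => ?_
      rw [← swapWord_append_left]
      exact rel_eq (.psi_mul_e _ _ _)
    | y_mul_y k l => exact rel_eq (.y_mul_y _ _)
    | psi_mul_y k h l h1 h2 => exact rel_eq (.psi_mul_y _ _ _ h1 h2)
    | psi_mul_psi k h l h' hkl => exact rel_eq (.psi_mul_psi _ _ _ _ hkl)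
    | dot_left_ne k h i hi =>
      simp only [Finset.mul_sum]
      refine Finset.sum_congr rfl fun j _ => rel_eq (.dot_left_ne k (by omega) (Fin.append i j) ?_)
      rwa [append_left_mk i j k (by omega), append_left_mk i j (k + 1) h]
    | dot_right_ne k h i hi =>
      simp only [Finset.mul_sum]
      refine Finset.sum_congr rfl fun j _ => rel_eq (.dot_right_ne k (by omega) (Fin.append i j) ?_)
      rwa [append_left_mk i j k (by omega), append_left_mk i j (k + 1) h]
    | dot_left_eq k h i hi =>
      simp only [Finset.mul_sum, ← Finset.sum_add_distrib]
      refine Finset.sum_congr rfl fun j _ => rel_eq (.dot_left_eq k (by omega) (Fin.append i j) ?_)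
      rwa [append_left_mk i j k (by omega), append_left_mk i j (k + 1) h]
    | dot_right_eq k h i hi =>
      simp only [Finset.mul_sum, ← Finset.sum_add_distrib]
      refine Finset.sum_congr rfl fun j _ => rel_eq (.dot_right_eq k (by omega) (Fin.append i j) ?_)
      rwa [append_left_mk i j k (by omega), append_left_mk i j (k + 1) h]
    | psi_sq_eq k h i hi =>
      simp only [Finset.mul_sum]
      refine Finset.sum_eq_zero fun j _ => rel_eq (.psi_sq_eq k (by omega) (Fin.append i j) ?_)
      rwa [append_left_mk i j k (by omega), append_left_mk i j (k + 1) h]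
    | psi_sq_ne k h i hi =>
      simp only [Finset.mul_sum]
      refine Finset.sum_congr rfl fun j _ => ?_
      rw [← append_left_mk i j k (by omega), ← append_left_mk i j (k + 1) h] at hi ⊢
      exact rel_eq (.psi_sq_ne k (by omega) (Fin.append i j) hi)
    | braid k h i hi =>
      simp only [Finset.mul_sum]
      refine Finset.sum_congr rfl fun j _ => rel_eq (.braid k (by omega) (Fin.append i j) ?_)
      rwa [append_left_mk i j k (by omega), append_left_mk i j (k + 1) (by omega),
        append_left_mk i j (k + 2) h]
    | braid_ne k h i hi =>
      simp only [Finset.mul_sum, ← Finset.sum_add_distrib]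
      refine Finset.sum_congr rfl fun j _ => ?_
      rw [← append_left_mk i j k (by omega), ← append_left_mk i j (k + 1) (by omega),
        ← append_left_mk i j (k + 2) h] at hi
      rw [← append_left_mk i j k (by omega), ← append_left_mk i j (k + 1) (by omega)]
      exact rel_eq (.braid_ne k (by omega) (Fin.append i j) hi))

/-- Placing `m` vertical strands to the left of a diagram on `n` strands. -/
noncomputable def inclRight (D : Params I K) (m n : ℕ) : Alg D n →ₐ[K] Alg D (m + n) :=
  lift (fun j => ∑ i : Fin m → I, e D (Fin.append i j)) (fun k => y D (Fin.natAdd m k))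
    (fun k _ => psi D (m + k) (by omega)) (by
    classical
    intro a b h
    cases h with
    | e_mul_self j =>
      rw [Finset.sum_mul]
      refine Finset.sum_congr rfl fun i _ => ?_
      rw [Finset.mul_sum, Finset.sum_eq_single i]
      · exact rel_eq (.e_mul_self _)
      · intro i' _ hi
        exact rel_eq (.e_mul_ne _ _ fun h => hi (append_inj h).1.symm)
      · simp
    | e_mul_ne j j' h =>
      rw [Finset.sum_mul_sum]
      exact Finset.sum_eq_zero fun i _ => Finset.sum_eq_zero fun i' _ =>
        rel_eq (.e_mul_ne _ _ fun h' => h (append_inj h').2)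
    | e_sum =>
      rw [← rel_eq (D := D) .e_sum, ← (Fin.appendEquiv m n).sum_comp, Fintype.sum_prod_type_right]
      rfl
    | y_mul_e k j =>
      rw [Finset.mul_sum, Finset.sum_mul]
      exact Finset.sum_congr rfl fun i _ => rel_eq (.y_mul_e _ _)
    | psi_mul_e k h j =>
      rw [Finset.mul_sum, Finset.sum_mul]
      refine Finset.sum_congr rfl fun i _ => ?_
      rw [← swapWord_append_right]
      exact rel_eq (.psi_mul_e _ _ _)
    | y_mul_y k l => exact rel_eq (.y_mul_y _ _)
    | psi_mul_y k h l h1 h2 =>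
      refine rel_eq (.psi_mul_y _ _ _ ?_ ?_) <;> rw [Fin.val_natAdd] <;> omega
    | psi_mul_psi k h l h' hkl => exact rel_eq (.psi_mul_psi _ _ _ _ (by omega))
    | dot_left_ne k h j hj =>
      simp only [Finset.mul_sum]
      refine Finset.sum_congr rfl fun i _ =>
        rel_eq (.dot_left_ne (m + k) (by omega) (Fin.append i j) ?_)
      rw [← append_right_mk i j k (by omega), ← append_right_mk i j (k + 1) h] at hj
      exact hj
    | dot_right_ne k h j hj =>
      simp only [Finset.mul_sum]
      refine Finset.sum_congr rfl fun i _ =>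
        rel_eq (.dot_right_ne (m + k) (by omega) (Fin.append i j) ?_)
      rw [← append_right_mk i j k (by omega), ← append_right_mk i j (k + 1) h] at hj
      exact hj
    | dot_left_eq k h j hj =>
      simp only [Finset.mul_sum, ← Finset.sum_add_distrib]
      refine Finset.sum_congr rfl fun i _ =>
        rel_eq (.dot_left_eq (m + k) (by omega) (Fin.append i j) ?_)
      rw [← append_right_mk i j k (by omega), ← append_right_mk i j (k + 1) h] at hj
      exact hj
    | dot_right_eq k h j hj =>
      simp only [Finset.mul_sum, ← Finset.sum_add_distrib]
      refine Finset.sum_congr rfl fun i _ =>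
        rel_eq (.dot_right_eq (m + k) (by omega) (Fin.append i j) ?_)
      rw [← append_right_mk i j k (by omega), ← append_right_mk i j (k + 1) h] at hj
      exact hj
    | psi_sq_eq k h j hj =>
      simp only [Finset.mul_sum]
      refine Finset.sum_eq_zero fun i _ =>
        rel_eq (.psi_sq_eq (m + k) (by omega) (Fin.append i j) ?_)
      rw [← append_right_mk i j k (by omega), ← append_right_mk i j (k + 1) h] at hj
      exact hj
    | psi_sq_ne k h j hj =>
      simp only [Finset.mul_sum]
      refine Finset.sum_congr rfl fun i _ => ?_
      rw [← append_right_mk i j k (by omega), ← append_right_mk i j (k + 1) h] at hj ⊢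
      exact rel_eq (.psi_sq_ne (m + k) (by omega) (Fin.append i j) hj)
    | braid k h j hj =>
      simp only [Finset.mul_sum]
      refine Finset.sum_congr rfl fun i _ =>
        rel_eq (.braid (m + k) (by omega) (Fin.append i j) ?_)
      rw [← append_right_mk i j k (by omega), ← append_right_mk i j (k + 1) (by omega),
        ← append_right_mk i j (k + 2) h] at hj
      exact hj
    | braid_ne k h j hj =>
      simp only [Finset.mul_sum, ← Finset.sum_add_distrib]
      refine Finset.sum_congr rfl fun i _ => ?_
      rw [← append_right_mk i j k (by omega), ← append_right_mk i j (k + 1) (by omega),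
        ← append_right_mk i j (k + 2) h] at hj
      rw [← append_right_mk i j k (by omega), ← append_right_mk i j (k + 1) (by omega)]
      exact rel_eq (.braid_ne (m + k) (by omega) (Fin.append i j) hj))

theorem incl_commute (m n : ℕ) (a : Alg D m) (b : Alg D n) :
    Commute (inclLeft D m n a) (inclRight D m n b) := by
  refine hom_commute _ _ (fun i => ?_) (fun k => ?_) (fun k h => ?_) a <;>
    refine (hom_commute _ _ (fun j => ?_) (fun l => ?_) (fun l h' => ?_) b).symm <;>
    simp only [inclLeft, inclRight, lift_e, lift_y, lift_psi]
  · exact Commute.sum_left _ _ _ fun _ _ => Commute.sum_right _ _ _ fun _ _ => e_commute _ _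
  · exact Commute.sum_right _ _ _ fun _ _ => rel_eq (.y_mul_e _ _)
  · rw [Commute, SemiconjBy, Finset.mul_sum, Finset.sum_mul]
    refine Fintype.sum_equiv ⟨swapWord l h', swapWord l h', swapWord_swapWord l h',
      swapWord_swapWord l h'⟩ _ _ fun j => ?_
    rw [Equiv.coe_fn_mk, ← swapWord_append_right]
    exact rel_eq (.psi_mul_e _ _ _)
  · exact Commute.sum_left _ _ _ fun _ _ => (Commute.symm (rel_eq (.y_mul_e _ _)))
  · exact rel_eq (.y_mul_y _ _)
  · refine rel_eq (.psi_mul_y _ _ _ ?_ ?_) <;> rw [Fin.val_castAdd] <;> omega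
  · refine Commute.symm ?_
    rw [Commute, SemiconjBy, Finset.mul_sum, Finset.sum_mul]
    refine Fintype.sum_equiv ⟨swapWord k h, swapWord k h, swapWord_swapWord k h,
      swapWord_swapWord k h⟩ _ _ fun j => ?_
    rw [Equiv.coe_fn_mk, ← swapWord_append_left]
    exact rel_eq (.psi_mul_e _ _ _)
  · refine Commute.symm (rel_eq (.psi_mul_y _ _ _ ?_ ?_)) <;> rw [Fin.val_natAdd] <;> omega
  · exact Commute.symm (rel_eq (.psi_mul_psi _ _ _ _ (by omega)))

/-- Horizontal juxtaposition `R_m ⊗ R_n → R_{m+n}`, `a ⊗ b ↦ a | b`.  It is unital, and maps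
`R(μ) ⊗ R(ν)` to `R(μ + ν)` with `1 ⊗ 1 ↦ e_{μ,ν}`. -/
noncomputable def juxt (D : Params I K) (m n : ℕ) : Alg D m ⊗[K] Alg D n →ₐ[K] Alg D (m + n) :=
  Algebra.TensorProduct.lift (inclLeft D m n) (inclRight D m n) (incl_commute m n)

end Alg

/-! ### Modules and induction -/

/-- A (left) module over the KLR algebra on `n` strands, for some `n`. -/
structure Rep (D : Params I K) : Type (u + 1) where
  n : ℕ
  V : Type u
  [addCommGroup : AddCommGroup V]
  [moduleK : Module K V]
  [moduleAlg : Module (Alg D n) V]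
  [isScalarTower : IsScalarTower K (Alg D n) V]

namespace Rep

variable {D : Params I K}

attribute [instance] addCommGroup moduleK moduleAlg isScalarTower

/-- The `R_{m+n}`-submodule of `R_{m+n} ⊗_K (L ⊗_K M)` by which one has to divide in order to get
`R_{m+n} ⊗_{R_m ⊗ R_n} (L ⊠ M)`. -/
noncomputable def indRel (L M : Rep D) :
    Submodule (Alg D (L.n + M.n)) (Alg D (L.n + M.n) ⊗[K] (L.V ⊗[K] M.V)) :=
  Submodule.span _ {z | ∃ (r : Alg D (L.n + M.n)) (a : Alg D L.n) (b : Alg D M.n)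
    (v : L.V) (w : M.V),
    z = (r * Alg.juxt D L.n M.n (a ⊗ₜ b)) ⊗ₜ[K] (v ⊗ₜ[K] w) - r ⊗ₜ[K] ((a • v) ⊗ₜ[K] (b • w))}

/-- The induction product `L ∘ M = R_{m+n} ⊗_{R_m ⊗ R_n} (L ⊠ M)`.  If `L` is an `R(μ)`-module and
`M` is an `R(ν)`-module then it is `R(μ + ν) ⊗_{R(μ) ⊗ R(ν)} (L ⊠ M)`. -/
noncomputable def ind (L M : Rep D) : Rep D where
  n := L.n + M.n
  V := (Alg D (L.n + M.n) ⊗[K] (L.V ⊗[K] M.V)) ⧸ indRel L M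

/-- The neutral element of the induction product: the algebra `R_0 = R(0) = K` as a module over
itself. -/
noncomputable def unit (D : Params I K) : Rep D where
  n := 0
  V := Alg D 0

/-- The iterated induction product `L_1 ∘ ⋯ ∘ L_h`, associated to the right.  The empty product is
the one-dimensional module over `R(0) = K`. -/
noncomputable def indList : List (Rep D) → Rep D
  | [] => unit D
  | [L] => L
  | L :: L' :: Ls => ind L (indList (L' :: Ls))

/-- `f` is a homomorphism of modules over the KLR algebra; nonzero ones exist only between
modules over the same number of strands. -/
def IsHom (M N : Rep D) (h : M.n = N.n) (f : M.V →ₗ[K] N.V) : Prop :=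
  ∀ (r : Alg D M.n) (x : M.V), f (r • x) = (h ▸ r : Alg D N.n) • f x

/-- `M` and `N` are isomorphic. -/
def Iso (M N : Rep D) : Prop :=
  ∃ (h : M.n = N.n) (f : M.V →ₗ[K] N.V), IsHom M N h f ∧ Function.Bijective f

/-- `N` is isomorphic to a quotient of `M`. -/
def HasQuotient (M N : Rep D) : Prop :=
  ∃ (h : M.n = N.n) (f : M.V →ₗ[K] N.V), IsHom M N h f ∧ Function.Surjective f

end Rep

variable [DecidableEq I]

/-- A representative of an element of `KLR`: a weight `ν ∈ Q⁺` and a simple module over `R(ν)`, that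
is a simple module over the KLR algebra on which `e_i` vanishes unless `i` has weight `ν`, which is
finite dimensional and on which all `y_k e_i` are nilpotent. -/
structure Simple (D : Params I K) : Type (u + 1) extends Rep D where
  wt : I → ℕ
  supported : ∀ (i : Fin n → I), wordWeight i ≠ wt → ∀ x : V, Alg.e D i • x = 0
  simple : IsSimpleModule (Alg D n) V
  finite : FiniteDimensional K V
  nilpotent : ∀ (k : Fin n) (i : Fin n → I), ∃ N : ℕ, ∀ x : V, (Alg.y D k * Alg.e D i) ^ N • x = 0

/-! ### Charges and semi-cuspidal modules -/

/-- A charge: a linear map `c` from the real span of the simple roots to `ℂ` sending all nonzero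
elements of `Q⁺` to an open half plane bounded by a line through the origin, given here as
`{z | 0 < Re (z / dir)}` for a complex number `dir`. -/
structure Charge (I : Type u) where
  toLinearMap : (I → ℝ) →ₗ[ℝ] ℂ
  dir : ℂ
  half_plane : ∀ ν : I → ℕ, ν ≠ 0 → 0 < (toLinearMap (fun i => (ν i : ℝ)) / dir).re

/-- The argument of `c(ν)` for nonzero `ν ∈ Q⁺`, up to a constant independent of `ν`: angles are
measured from the direction `dir`, so that the branch cut `ℝ_{≤0} * dir` is outside the half
plane.  `α ≥_c β` means `c.arg β ≤ c.arg α`. -/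
noncomputable def Charge.arg (c : Charge I) (ν : I → ℕ) : ℝ :=
  Complex.arg (c.toLinearMap (fun i => (ν i : ℝ)) / c.dir)

/-- A word is `c`-semi-cuspidal if no nonempty proper prefix has weight `>_c` that of the word. -/
def SemiCuspidalWord (c : Charge I) {n : ℕ} (i : Fin n → I) : Prop :=
  ∀ j, 1 ≤ j → j < n → c.arg (prefixWeight i j) ≤ c.arg (wordWeight i)

/-- A simple module (of nonzero weight, as its weight has to have an argument) is
`c`-semi-cuspidal if all the words in its character are. -/
def SemiCuspidal {D : Params I K} (c : Charge I) (L : Simple D) : Prop :=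
  L.wt ≠ 0 ∧ ∀ i : Fin L.n → I, (∃ x : L.V, Alg.e D i • x ≠ 0) → SemiCuspidalWord c i

/-- `L_1, …, L_h` are `c`-semi-cuspidal with `wt L_1 >_c ⋯ >_c wt L_h`. -/
def SemiCuspidalSeq {D : Params I K} (c : Charge I) (Ls : List (Simple D)) : Prop :=
  (∀ L ∈ Ls, SemiCuspidal c L) ∧ Ls.Pairwise fun L L' => c.arg L'.wt < c.arg L.wt

/-- The induction product `L_1 ∘ ⋯ ∘ L_h` of simple modules. -/
noncomputable def indSimple {D : Params I K} (Ls : List (Simple D)) : Rep D :=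
  Rep.indList (Ls.map Simple.toRep)

/-- `M` has a unique simple quotient: there is exactly one submodule with simple quotient. -/
def HasUniqueSimpleQuotient {D : Params I K} (M : Rep D) : Prop :=
  ∃! N : Submodule (Alg D M.n) M.V, IsSimpleModule (Alg D M.n) (M.V ⧸ N)

end KLR

set_option linter.unusedSectionVars false

/-! The words of an induction product `L ∘ M` are shuffles of a word of `L` and a word of `M`, so
each prefix has as weight the sum of a prefix weight of the one and a prefix weight of the other.
Whether the argument of a weight exceeds that of `wt L` is decided by the sign of an additive
function, `Charge.slope`. Let `L` be semi-cuspidal and let all nonempty prefixes of words of `M`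
have negative slope with respect to `wt L`, as is the case for the product `M` of the later terms of
a sequence. Then prefixes in `L ∘ M` have slope at most `0`, and the prefix with as many letters as
`L` can have weight `wt L` only for the trivial shuffle (`StandardModule.shuffleFree`). The part of
`L ∘ M` on such words is therefore formed by tensors without crossings.

Simple quotient: `L` is absolutely simple (`Alg.endomorphism_eq_smul`), so by density the algebra
contains all rank one operators on `L`, and these extract from a nonzero sum of tensors `b k ⊗ w k`
all tensors `v ⊗ w k` with a fixed nonzero `w k`. Hence, if every nonzero element of a distinguished
part of `M` generates `M`, the same holds for `L ∘ M` (`Ind.headed`), and a module with this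
property has exactly one maximal submodule (`Headed.existsUnique`). That `L ∘ M` is nonzero requires
the algebra on `m + n` strands to be free over `R_m ⊗ R_n` with the shuffles as a basis
(`Alg.bijective_shufPerm_elt`). Shuffles span by straightening (`Alg.shuf_mul`); they are
independent because the algebra acts on functions on the symmetric group with values in a field of
rational functions, where a delta function is cyclic and there is no room for relations.

Existence: among all prefixes of words of a simple module `V` take one of maximal argument and,
among these, of maximal length. A simple submodule `L` of the restriction of `V` on words of its
weight is semi-cuspidal. The remaining strands act on the homomorphisms from `L` to `V`; a simple
submodule there is treated by induction, and Frobenius reciprocity gives the surjection onto `V`.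

Uniqueness: length and weight of the first term are visible in the quotient as those of the longest
prefix of maximal argument. The first term is then recovered up to isomorphism, and its
homomorphisms into the quotient form a common quotient of the two tails, so that induction applies.
-/

namespace KLR

/-! ### Consequences of the relations and the image of juxtaposition -/

namespace Alg

variable {I K : Type u} [Fintype I] [Field K] {D : Params I K} {n : ℕ}

theorem e_mul_self (i : Fin n → I) : e D i * e D i = e D i := rel_eq (.e_mul_self i)

theorem e_mul_of_ne {i j : Fin n → I} (h : i ≠ j) : e D i * e D j = 0 := rel_eq (.e_mul_ne i j h)

theorem sum_e : ∑ i : Fin n → I, e D i = 1 := rel_eq .e_sum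

theorem y_mul_e (k : Fin n) (i : Fin n → I) : y D k * e D i = e D i * y D k :=
  rel_eq (.y_mul_e k i)

theorem psi_mul_e (k : ℕ) (h : k + 1 < n) (i : Fin n → I) :
    psi D k h * e D i = e D (swapWord k h i) * psi D k h := rel_eq (.psi_mul_e k h i)

theorem psi_mul_psi {k l : ℕ} (h : k + 1 < n) (h' : l + 1 < n) (hkl : k + 1 < l ∨ l + 1 < k) :
    psi D k h * psi D l h' = psi D l h' * psi D k h := by
  rcases hkl with hkl | hkl
  · exact rel_eq (.psi_mul_psi _ _ _ _ hkl)
  · exact (rel_eq (.psi_mul_psi _ _ _ _ hkl)).symm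

theorem eq_of_mul_e {a b : Alg D n} (h : ∀ i, a * e D i = b * e D i) : a = b := by
  rw [← mul_one a, ← mul_one b, ← sum_e, Finset.mul_sum, Finset.mul_sum]
  exact Finset.sum_congr rfl fun i _ => h i

/-- A subset of the algebra containing the generators and closed under the operations is
everything. -/
theorem induction {P : Alg D n → Prop} (he : ∀ i, P (e D i)) (hy : ∀ k, P (y D k))
    (hpsi : ∀ k h, P (psi D k h)) (hc : ∀ c : K, P (algebraMap K _ c))
    (hadd : ∀ a b, P a → P b → P (a + b)) (hmul : ∀ a b, P a → P b → P (a * b))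
    (a : Alg D n) : P a := by
  obtain ⟨a, rfl⟩ := mk_surjective D n a
  induction a using FreeAlgebra.induction with
  | grade0 r => rw [AlgHom.commutes]; exact hc r
  | grade1 g =>
    cases g with
    | e i => exact he i
    | y k => exact hy k
    | psi k h => exact hpsi k h
  | mul a b ha hb => rw [map_mul]; exact hmul _ _ ha hb
  | add a b ha hb => rw [map_add]; exact hadd _ _ ha hb

/-- The subalgebra generated by dots and idempotents. -/
noncomputable def pol (D : Params I K) (n : ℕ) : Subalgebra K (Alg D n) :=
  Algebra.adjoin K (Set.range (e D) ∪ Set.range (y D))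

theorem e_mem_pol (i : Fin n → I) : e D i ∈ pol D n :=
  Algebra.subset_adjoin (Or.inl ⟨i, rfl⟩)

theorem y_mem_pol (k : Fin n) : y D k ∈ pol D n :=
  Algebra.subset_adjoin (Or.inr ⟨k, rfl⟩)

theorem evalPoly_mem {A : Type*} [Ring A] [Algebra K A] {S : Subalgebra K A} {a b : A}
    (ha : a ∈ S) (hb : b ∈ S) (P : MvPolynomial (Fin 2) K) : evalPoly P a b ∈ S :=
  Subalgebra.sum_mem _ fun _ _ => Subalgebra.smul_mem _
    (mul_mem (pow_mem ha _) (pow_mem hb _)) _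

theorem evalDivDiff_mem {A : Type*} [Ring A] [Algebra K A] {S : Subalgebra K A} {a b c : A}
    (ha : a ∈ S) (hb : b ∈ S) (hc : c ∈ S) (P : MvPolynomial (Fin 2) K) :
    evalDivDiff P a b c ∈ S :=
  Subalgebra.sum_mem _ fun _ _ => Subalgebra.smul_mem _
    (mul_mem (Subalgebra.sum_mem _ fun _ _ => mul_mem (pow_mem hc _) (pow_mem ha _))
      (pow_mem hb _)) _

theorem mem_pol_of_mul_e {a : Alg D n} (h : ∀ i, a * e D i ∈ pol D n) : a ∈ pol D n := by
  rw [← mul_one a, ← sum_e, Finset.mul_sum]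
  exact Subalgebra.sum_mem _ fun i _ => h i

/-- This lemma, `braid_sub_mem_pol` and `y_psi_sub_mem_pol` hide the precise error terms of the
relations: straightening only needs that they contain no crossings. -/
theorem psi_sq_mem_pol (k : ℕ) (h : k + 1 < n) : psi D k h * psi D k h ∈ pol D n := by
  refine mem_pol_of_mul_e fun i => ?_
  by_cases hi : i ⟨k, by omega⟩ = i ⟨k + 1, h⟩
  · rw [rel_eq (.psi_sq_eq k h i hi)]; exact zero_mem _
  · rw [rel_eq (.psi_sq_ne k h i hi)]
    exact mul_mem (evalPoly_mem (y_mem_pol _) (y_mem_pol _) _) (e_mem_pol _)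

theorem braid_sub_mem_pol (k : ℕ) (h : k + 2 < n) :
    psi D k (by omega) * psi D (k + 1) h * psi D k (by omega) -
      psi D (k + 1) h * psi D k (by omega) * psi D (k + 1) h ∈ pol D n := by
  refine mem_pol_of_mul_e fun i => ?_
  rw [sub_mul]
  by_cases hi : i ⟨k, by omega⟩ = i ⟨k + 2, h⟩ ∧ i ⟨k, by omega⟩ ≠ i ⟨k + 1, by omega⟩
  · rw [rel_eq (.braid_ne k h i hi), add_sub_cancel_left]
    exact mul_mem (evalDivDiff_mem (y_mem_pol _) (y_mem_pol _) (y_mem_pol _) _) (e_mem_pol _)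
  · rw [rel_eq (.braid k h i hi), sub_self]; exact zero_mem _

/-- The transposition of the positions `k` and `k + 1`. -/
def sw {n : ℕ} (k : ℕ) (h : k + 1 < n) : Equiv.Perm (Fin n) :=
  Equiv.swap ⟨k, by omega⟩ ⟨k + 1, h⟩

theorem sw_left (k : ℕ) (h : k + 1 < n) : sw k h ⟨k, by omega⟩ = ⟨k + 1, h⟩ :=
  Equiv.swap_apply_left _ _

theorem sw_right (k : ℕ) (h : k + 1 < n) : sw k h ⟨k + 1, h⟩ = ⟨k, by omega⟩ :=
  Equiv.swap_apply_right _ _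

theorem sw_of_ne (k : ℕ) (h : k + 1 < n) {p : Fin n} (h1 : (p : ℕ) ≠ k) (h2 : (p : ℕ) ≠ k + 1) :
    sw k h p = p :=
  Equiv.swap_apply_of_ne_of_ne (fun h => h1 (by rw [h])) (fun h => h2 (by rw [h]))

theorem sw_mul_self (k : ℕ) (h : k + 1 < n) : sw k h * sw k h = 1 := Equiv.swap_mul_self _ _

theorem sw_comm {k l : ℕ} (h : k + 1 < n) (h' : l + 1 < n) (hkl : k + 1 < l ∨ l + 1 < k) :
    sw k h * sw l h' = sw l h' * sw k h := by
  refine Equiv.Perm.Disjoint.commute fun p => ?_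
  by_cases h1 : (p : ℕ) = k ∨ (p : ℕ) = k + 1
  · exact Or.inr (sw_of_ne _ _ (by omega) (by omega))
  · exact Or.inl (sw_of_ne _ _ (by omega) (by omega))

theorem y_psi_sub_mem_pol (k : ℕ) (h : k + 1 < n) (p : Fin n) :
    y D p * psi D k h - psi D k h * y D (sw k h p) ∈ pol D n := by
  refine mem_pol_of_mul_e fun i => ?_
  rw [sub_mul]
  by_cases h1 : (p : ℕ) = k
  · rw [show p = ⟨k, by omega⟩ from Fin.ext h1, sw_left]
    by_cases hi : i ⟨k, by omega⟩ = i ⟨k + 1, h⟩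
    · rw [rel_eq (.dot_left_eq k h i hi), add_sub_cancel_left]; exact e_mem_pol _
    · rw [rel_eq (.dot_left_ne k h i hi), sub_self]; exact zero_mem _
  by_cases h2 : (p : ℕ) = k + 1
  · rw [show p = ⟨k + 1, h⟩ from Fin.ext h2, sw_right]
    by_cases hi : i ⟨k, by omega⟩ = i ⟨k + 1, h⟩
    · rw [rel_eq (.dot_right_eq k h i hi), sub_add_cancel_left]; exact neg_mem (e_mem_pol _)
    · rw [rel_eq (.dot_right_ne k h i hi), sub_self]; exact zero_mem _
  · rw [sw_of_ne k h h1 h2, rel_eq (.psi_mul_y k h p h1 h2), sub_self]; exact zero_mem _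

section Juxt

variable {m : ℕ}

theorem juxt_tmul (a : Alg D m) (b : Alg D n) :
    juxt D m n (a ⊗ₜ b) = inclLeft D m n a * inclRight D m n b :=
  Algebra.TensorProduct.lift_tmul _ _ _ _ _

theorem inclLeft_e (i : Fin m → I) :
    inclLeft D m n (e D i) = ∑ j : Fin n → I, e D (Fin.append i j) := lift_e _ _

theorem inclLeft_y (k : Fin m) : inclLeft D m n (y D k) = y D (Fin.castAdd n k) := lift_y _ _

theorem inclLeft_psi (k : ℕ) (h : k + 1 < m) :
    inclLeft D m n (psi D k h) = psi D k (by omega) := lift_psi _ _ _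

theorem inclRight_e (j : Fin n → I) :
    inclRight D m n (e D j) = ∑ i : Fin m → I, e D (Fin.append i j) := lift_e _ _

theorem inclRight_y (k : Fin n) : inclRight D m n (y D k) = y D (Fin.natAdd m k) := lift_y _ _

theorem inclRight_psi (k : ℕ) (h : k + 1 < n) :
    inclRight D m n (psi D k h) = psi D (m + k) (by omega) := lift_psi _ _ _

theorem inclLeft_e_mul (i i' : Fin m → I) (j : Fin n → I) [Decidable (i = i')] :
    inclLeft D m n (e D i) * e D (Fin.append i' j) =
      if i = i' then e D (Fin.append i j) else 0 := by
  rw [inclLeft_e, Finset.sum_mul]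
  split_ifs with h
  · subst h
    rw [Finset.sum_eq_single j, e_mul_self]
    · exact fun j' _ hj => e_mul_of_ne fun h => hj (append_inj h).2
    · simp
  · exact Finset.sum_eq_zero fun j' _ => e_mul_of_ne fun h' => h (append_inj h').1

theorem inclLeft_mul_inclRight_e (i : Fin m → I) (j : Fin n → I) :
    inclLeft D m n (e D i) * inclRight D m n (e D j) = e D (Fin.append i j) := by
  classical
  rw [inclRight_e, Finset.mul_sum, Finset.sum_eq_single i]
  · rw [inclLeft_e_mul, if_pos rfl]
  · exact fun i' _ h => by rw [inclLeft_e_mul, if_neg (Ne.symm h)]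
  · simp

theorem juxt_e (i : Fin m → I) (j : Fin n → I) :
    juxt D m n (e D i ⊗ₜ e D j) = e D (Fin.append i j) := by
  rw [juxt_tmul, inclLeft_mul_inclRight_e]

theorem e_mem_juxt (k : Fin (m + n) → I) : e D k ∈ (juxt D m n).range := by
  obtain ⟨⟨i, j⟩, rfl⟩ := (Fin.appendEquiv m n).surjective k
  exact ⟨_, juxt_e i j⟩

theorem y_mem_juxt (k : Fin (m + n)) : y D k ∈ (juxt D m n).range := by
  refine Fin.addCases (fun k => ?_) (fun k => ?_) k
  · exact ⟨y D k ⊗ₜ 1, by change juxt D m n _ = _; rw [juxt_tmul, map_one, mul_one, inclLeft_y]⟩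
  · exact ⟨1 ⊗ₜ y D k, by change juxt D m n _ = _; rw [juxt_tmul, map_one, one_mul, inclRight_y]⟩

/-- With positions counted from `0`, the crossing at `k + 1 = m` is the only one joining the two
blocks of strands. -/
theorem psi_mem_juxt (k : ℕ) (h : k + 1 < m + n) (hk : k + 1 ≠ m) :
    psi D k h ∈ (juxt D m n).range := by
  rcases lt_or_gt_of_ne hk with hk | hk
  · exact ⟨psi D k hk ⊗ₜ 1, by
      change juxt D m n _ = _; rw [juxt_tmul, map_one, mul_one, inclLeft_psi]⟩
  · obtain ⟨l, rfl⟩ := Nat.exists_eq_add_of_le (show m ≤ k by omega)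
    exact ⟨1 ⊗ₜ psi D l (by omega), by
      change juxt D m n _ = _; rw [juxt_tmul, map_one, one_mul, inclRight_psi]⟩

end Juxt

end Alg
end KLR

/-! ### Straightening: shuffles span the algebra over `R_m ⊗ R_n` -/

namespace KLR

namespace Alg

variable {I K : Type u} [Fintype I] [Field K] {D : Params I K} {m n : ℕ}

/-- The elements `psi_{k_1} ⋯ psi_{k_l}` of the algebra belonging to reduced words of the
permutations shuffling the first `m` strands with the other ones.  The permutation maps a
position to the strand in this position. -/
inductive Shuf (D : Params I K) (m n : ℕ) : ℕ → Alg D n → Equiv.Perm (Fin n) → Prop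
  | one : Shuf D m n 0 1 1
  | step {l x a} (k : ℕ) (h : k + 1 < n) (hx : Shuf D m n l x a)
      (hl : (a ⟨k, by omega⟩ : ℕ) < m) (hr : m ≤ (a ⟨k + 1, h⟩ : ℕ)) :
      Shuf D m n (l + 1) (psi D k h * x) (a * sw k h)

namespace Shuf

variable {l : ℕ} {x : Alg D n} {a : Equiv.Perm (Fin n)}

/-- Exchange property: a right strand standing just before a left one has crossed it, and this
crossing can be moved to the top. It only has to pass distant crossings, since a top crossing at
position `k - 1` or `k + 1` contradicts the sides of the two strands. -/
theorem exists_descent (hx : Shuf D m n l x a) (k : ℕ) (h : k + 1 < n)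
    (hr : m ≤ (a ⟨k, by omega⟩ : ℕ)) (hl : (a ⟨k + 1, h⟩ : ℕ) < m) :
    ∃ l' x', l = l' + 1 ∧ Shuf D m n l' x' (a * sw k h) ∧ x = psi D k h * x' := by
  induction hx with
  | one => simp only [Equiv.Perm.coe_one, id] at hl hr; omega
  | @step l x a j hj hx hl' hr' ih =>
    simp only [Equiv.Perm.mul_apply] at hr hl
    by_cases hkj : k = j
    · subst hkj
      exact ⟨l, x, rfl, by rwa [mul_assoc, sw_mul_self, mul_one], rfl⟩
    by_cases h1 : k = j + 1
    · subst h1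
      rw [sw_right] at hr
      omega
    by_cases h2 : k + 1 = j
    · subst h2
      rw [sw_left] at hl
      omega
    have hd : k + 1 < j ∨ j + 1 < k := by omega
    rw [sw_of_ne _ _ (by simpa using hkj) (by simpa using h1)] at hr
    rw [sw_of_ne _ _ (by simpa using h2) (by simpa using hkj)] at hl
    obtain ⟨l', x', rfl, hx', rfl⟩ := ih hr hl
    refine ⟨l' + 1, psi D j hj * x', rfl, ?_, ?_⟩
    · rw [mul_assoc, ← sw_comm h hj hd, ← mul_assoc]
      refine hx'.step j hj ?_ ?_
      · rw [Equiv.Perm.mul_apply, sw_of_ne _ _ (by simp; omega) (by simp; omega)]; exact hl'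
      · rw [Equiv.Perm.mul_apply, sw_of_ne _ _ (by simp; omega) (by simp; omega)]; exact hr'
    · rw [← mul_assoc, ← mul_assoc, psi_mul_psi h hj hd]

/-- Shuffles are fully commutative permutations: their reduced words differ by commutations of
distant crossings, so the product depends on the permutation alone although the braid relation has
error terms. -/
theorem eq_of_perm {l' : ℕ} {x' : Alg D n} (hx : Shuf D m n l x a) (hx' : Shuf D m n l' x' a) :
    x = x' := by
  induction hx generalizing l' x' with
  | one =>
    generalize ha : (1 : Equiv.Perm (Fin n)) = a' at hx'
    cases hx' with
    | one => rfl
    | @step l x a k h hx hl hr =>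
      obtain rfl : a = sw k h := by
        rw [← one_mul (sw k h), ha, mul_assoc, sw_mul_self, mul_one]
      rw [sw_left] at hl; rw [sw_right] at hr
      simp only at hl hr; omega
  | @step l x a k h hx hl hr ih =>
    obtain ⟨l', x'', rfl, hx'', rfl⟩ := hx'.exists_descent k h
      (by rwa [Equiv.Perm.mul_apply, sw_left]) (by rwa [Equiv.Perm.mul_apply, sw_right])
    rw [mul_assoc, sw_mul_self, mul_one] at hx''
    rw [ih hx'']

theorem mul_e (hx : Shuf D m n l x a) (i : Fin n → I) : x * e D i = e D (i ∘ a) * x := by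
  induction hx with
  | one => rw [one_mul, mul_one, Equiv.Perm.coe_one, Function.comp_id]
  | step k h hx hl hr ih =>
    rw [mul_assoc, ih, ← mul_assoc, psi_mul_e, mul_assoc]
    rfl

theorem e_mul (hx : Shuf D m n l x a) (i : Fin n → I) :
    e D i * x = x * e D (i ∘ a.symm) := by
  rw [hx.mul_e, Function.comp_assoc, Equiv.symm_comp_self, Function.comp_id]

/-- Each step crosses a left strand with a right one, so strands of the same block stay in order. -/
theorem monotone (hx : Shuf D m n l x a) {p q : Fin n} (hpq : p < q)
    (h : (a p : ℕ) < m ∧ (a q : ℕ) < m ∨ m ≤ (a p : ℕ) ∧ m ≤ (a q : ℕ)) : a p < a q := by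
  induction hx generalizing p q with
  | one => exact hpq
  | @step l x a k hk hx hl hr ih =>
    simp only [Equiv.Perm.mul_apply] at h ⊢
    refine ih ?_ h
    have key : ∀ r : Fin n, ((r : ℕ) = k ∧ (sw k hk r) = ⟨k + 1, hk⟩) ∨
        ((r : ℕ) = k + 1 ∧ (sw k hk r) = ⟨k, by omega⟩) ∨
        ((r : ℕ) ≠ k ∧ (r : ℕ) ≠ k + 1 ∧ sw k hk r = r) := by
      intro r
      by_cases h1 : (r : ℕ) = k
      · obtain rfl : r = ⟨k, Nat.lt_of_succ_lt hk⟩ := Fin.ext h1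
        exact Or.inl ⟨rfl, sw_left _ _⟩
      by_cases h2 : (r : ℕ) = k + 1
      · obtain rfl : r = ⟨k + 1, hk⟩ := Fin.ext h2
        exact Or.inr (Or.inl ⟨rfl, sw_right _ _⟩)
      exact Or.inr (Or.inr ⟨h1, h2, sw_of_ne _ _ h1 h2⟩)
    rcases key p with ⟨h1, h2⟩ | ⟨h1, h2⟩ | ⟨h1, h3, h2⟩ <;>
    rcases key q with ⟨h4, h5⟩ | ⟨h4, h5⟩ | ⟨h4, h6, h5⟩ <;> rw [h2, h5] at h ⊢ <;>
    simp only [Fin.lt_def] at hpq ⊢ <;> omega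

/-- A step at `k < m` puts a right strand in position `k`; a step at `k ≥ m` leaves the first `m`
positions alone and cannot be the first one, as the strand in position `k` would have to be a left
one. -/
theorem eq_one_or (hx : Shuf D m n l x a) :
    (x = 1 ∧ a = 1) ∨ ∃ q : Fin n, (q : ℕ) < m ∧ m ≤ (a q : ℕ) := by
  induction hx with
  | one => exact Or.inl ⟨rfl, rfl⟩
  | @step l x a k h hx hl hr ih =>
    right
    by_cases hk : k < m
    · exact ⟨⟨k, by omega⟩, hk, by rwa [Equiv.Perm.mul_apply, sw_left]⟩
    rcases ih with ⟨rfl, rfl⟩ | ⟨q, hq, hq'⟩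
    · exact absurd hl hk
    · exact ⟨q, hq, by rwa [Equiv.Perm.mul_apply, sw_of_ne _ _ (by omega) (by omega)]⟩

end Shuf

/-- The span of the products `x * b`, where `x` belongs to a shuffle of length less than `l` and
`b` to the subalgebra `R_m ⊗ R_n`. -/
noncomputable def shufSpan (D : Params I K) (m n l : ℕ) : Submodule K (Alg D (m + n)) :=
  Submodule.span K {z | ∃ j x a b, j < l ∧ Shuf D m (m + n) j x a ∧ b ∈ (juxt D m n).range ∧
    z = x * b}

theorem mul_mem_shufSpan {l j : ℕ} {x b : Alg D (m + n)} {a} (hx : Shuf D m (m + n) j x a)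
    (hj : j < l) (hb : b ∈ (juxt D m n).range) : x * b ∈ shufSpan D m n l :=
  Submodule.subset_span ⟨j, x, a, b, hj, hx, hb, rfl⟩

theorem mem_shufSpan {l j : ℕ} {x : Alg D (m + n)} {a} (hx : Shuf D m (m + n) j x a)
    (hj : j < l) : x ∈ shufSpan D m n l := by
  simpa using mul_mem_shufSpan hx hj (one_mem _)

theorem shufSpan_mono {l l' : ℕ} (h : l ≤ l') : shufSpan D m n l ≤ shufSpan D m n l' :=
  Submodule.span_mono fun _ ⟨j, x, a, b, hj, h'⟩ => ⟨j, x, a, b, by omega, h'⟩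

theorem shufSpan_mul {l : ℕ} {z b : Alg D (m + n)} (hz : z ∈ shufSpan D m n l)
    (hb : b ∈ (juxt D m n).range) : z * b ∈ shufSpan D m n l := by
  induction hz using Submodule.span_induction with
  | mem z hz =>
    obtain ⟨j, x, a, c, hj, hx, hc, rfl⟩ := hz
    rw [mul_assoc]
    exact mul_mem_shufSpan hx hj (mul_mem hc hb)
  | zero => rw [zero_mul]; exact zero_mem _
  | add x y _ _ hx hy => rw [add_mul]; exact add_mem hx hy
  | smul c x _ hx => rw [smul_mul_assoc]; exact Submodule.smul_mem _ _ hx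

/-- To map a span of products into another one by a left multiplication it suffices to do so for
the elements belonging to shuffles. -/
theorem mul_shufSpan_le {l l' : ℕ} {r : Alg D (m + n)}
    (h : ∀ j x a, j < l → Shuf D m (m + n) j x a → r * x ∈ shufSpan D m n l')
    {z : Alg D (m + n)} (hz : z ∈ shufSpan D m n l) : r * z ∈ shufSpan D m n l' := by
  induction hz using Submodule.span_induction with
  | mem z hz =>
    obtain ⟨j, x, a, c, hj, hx, hc, rfl⟩ := hz
    rw [← mul_assoc]
    exact shufSpan_mul (h j x a hj hx) hc
  | zero => rw [mul_zero]; exact zero_mem _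
  | add x y _ _ hx hy => rw [mul_add]; exact add_mem hx hy
  | smul c x _ hx => rw [mul_smul_comm]; exact Submodule.smul_mem _ _ hx

theorem pol_mul_shufSpan {l : ℕ}
    (hy : ∀ p, ∀ z ∈ shufSpan D m n l, y D p * z ∈ shufSpan D m n l) {r z : Alg D (m + n)}
    (hr : r ∈ pol D (m + n)) (hz : z ∈ shufSpan D m n l) : r * z ∈ shufSpan D m n l := by
  induction hr using Algebra.adjoin_induction generalizing z with
  | mem r hr =>
    rcases hr with ⟨i, rfl⟩ | ⟨p, rfl⟩
    · refine mul_shufSpan_le (fun j x a hj hx => ?_) hz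
      rw [hx.e_mul]
      exact mul_mem_shufSpan hx hj (e_mem_juxt _)
    · exact hy p z hz
  | algebraMap c => rw [← Algebra.smul_def]; exact Submodule.smul_mem _ _ hz
  | add r s _ _ hr hs => rw [add_mul]; exact add_mem (hr hz) (hs hz)
  | mul r s _ _ hr hs => rw [mul_assoc]; exact hr (hs hz)

/-- The action of dots and crossings on the elements belonging to shuffles of length `l`. -/
theorem shuf_mul (l : ℕ) : ∀ x a, Shuf D m (m + n) l x a →
    (∀ p, y D p * x - x * y D (a p) ∈ shufSpan D m n l) ∧
    (∀ k h, psi D k h * x ∈ shufSpan D m n (l + 2)) ∧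
    ∀ k h, ¬ ((a ⟨k, by omega⟩ : ℕ) < m ∧ m ≤ (a ⟨k + 1, h⟩ : ℕ)) →
      psi D k h * x ∈ shufSpan D m n (l + 1) := by
  induction l using Nat.strong_induction_on with
  | _ l ih =>
  intro x a hx
  -- The induction hypothesis, extended from shuffles to spans: dots do not raise the length, and a
  -- crossing raises it by at most one.
  have hy : ∀ l' ≤ l, ∀ p, ∀ z ∈ shufSpan D m n l', y D p * z ∈ shufSpan D m n l' := by
    intro l' hl' p z hz
    refine mul_shufSpan_le (fun j x a hj hx => ?_) hz
    rw [← sub_add_cancel (y D p * x) (x * y D (a p))]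
    exact add_mem (shufSpan_mono hj.le ((ih j (by omega) x a hx).1 p))
      (mul_mem_shufSpan hx hj (y_mem_juxt _))
  have hpsi : ∀ l' ≤ l, ∀ k h, ∀ z ∈ shufSpan D m n l', psi D k h * z ∈ shufSpan D m n (l' + 1) :=
    fun l' hl' k h z hz => mul_shufSpan_le (fun j x a hj hx =>
      shufSpan_mono (by omega) ((ih j (by omega) x a hx).2.1 k h)) hz
  have h3 : ∀ k h, ¬ ((a ⟨k, by omega⟩ : ℕ) < m ∧ m ≤ (a ⟨k + 1, h⟩ : ℕ)) →
      psi D k h * x ∈ shufSpan D m n (l + 1) := by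
    intro k h hk
    -- A right strand before a left one: the new crossing meets an equal one at the top of `x`, and
    -- the square of a crossing lies in `pol`.
    by_cases hrl : m ≤ (a ⟨k, by omega⟩ : ℕ) ∧ (a ⟨k + 1, h⟩ : ℕ) < m
    · obtain ⟨l', x', rfl, hx', rfl⟩ := hx.exists_descent k h hrl.1 hrl.2
      rw [← mul_assoc]
      exact shufSpan_mono (by omega) (pol_mul_shufSpan (hy (l' + 1) le_rfl) (psi_sq_mem_pol k h)
        (mem_shufSpan hx' (by omega)))
    have hsame : ((a ⟨k, by omega⟩ : ℕ) < m ↔ (a ⟨k + 1, h⟩ : ℕ) < m) := by omega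
    clear hk hrl
    -- Both strands now belong to the same block. The crossing is moved down through `x` until it
    -- reaches the bottom, where it is an element of `R_m ⊗ R_n`.
    cases hx with
    | one =>
      have := mul_mem_shufSpan (D := D) (n := n) (Shuf.one (m := m)) (show 0 < 0 + 1 by omega)
        (psi_mem_juxt k h (by simp at hsame; omega))
      rw [one_mul] at this
      rwa [mul_one]
    | @step l x a j hj hx hl hr =>
    simp only [Equiv.Perm.mul_apply] at hsame
    by_cases hkj : k = j
    · subst hkj
      rw [sw_left, sw_right] at hsame
      omega
    by_cases h1 : k = j + 1
    -- Below the crossing `j` the strands in positions `j`, `j + 1`, `j + 2` are left, right, left,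
    -- so another crossing `j + 1` can be split off. The braid relation then leaves `psi j * psi (j
    -- + 1) * psi j` in front of `x'`, and its lowest crossing joins two left strands. The case `k +
    -- 1 = j` is the mirror image.
    · subst h1
      rw [sw_right, sw_of_ne _ _ (by simp; omega) (by simp)] at hsame
      obtain ⟨l', x', rfl, hx', rfl⟩ := hx.exists_descent (j + 1) h hr (by omega)
      rw [← mul_assoc, ← mul_assoc, ← sub_sub_cancel (psi D j hj * psi D (j + 1) h * psi D j hj)
        (psi D (j + 1) h * psi D j hj * psi D (j + 1) h), sub_mul]
      refine sub_mem ?_ (shufSpan_mono (by omega) (pol_mul_shufSpan (hy (l' + 1) (by omega))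
        (braid_sub_mem_pol j h) (mem_shufSpan hx' (by omega))))
      rw [mul_assoc, mul_assoc]
      refine hpsi (l' + 2) (by omega) _ _ _ (hpsi (l' + 1) (by omega) _ _ _
        ((ih l' (by omega) x' _ hx').2.2 _ _ ?_))
      simp only [Equiv.Perm.mul_apply]
      rw [sw_left, sw_of_ne _ _ (by simp) (by simp; omega)]
      omega
    by_cases h2 : k + 1 = j
    · subst h2
      rw [sw_left, sw_of_ne _ _ (by simp) (by simp; omega)] at hsame
      obtain ⟨l', x', rfl, hx', rfl⟩ := hx.exists_descent k h (by omega) hl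
      rw [← mul_assoc, ← mul_assoc, ← sub_add_cancel (psi D k h * psi D (k + 1) hj * psi D k h)
        (psi D (k + 1) hj * psi D k h * psi D (k + 1) hj), add_mul]
      refine add_mem (shufSpan_mono (by omega) (pol_mul_shufSpan (hy (l' + 1) (by omega))
        (braid_sub_mem_pol k hj) (mem_shufSpan hx' (by omega)))) ?_
      rw [mul_assoc, mul_assoc]
      refine hpsi (l' + 2) (by omega) _ _ _ (hpsi (l' + 1) (by omega) _ _ _
        ((ih l' (by omega) x' _ hx').2.2 _ _ ?_))
      simp only [Equiv.Perm.mul_apply]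
      rw [sw_right, sw_of_ne _ _ (by simp; omega) (by simp)]
      omega
    have hd : k + 1 < j ∨ j + 1 < k := by omega
    rw [sw_of_ne _ _ (by simpa using hkj) (by simpa using h1),
      sw_of_ne _ _ (by simpa using h2) (by simpa using hkj)] at hsame
    rw [← mul_assoc, psi_mul_psi h hj hd, mul_assoc]
    exact hpsi (l + 1) le_rfl _ _ _ ((ih l (by omega) x a hx).2.2 k h (by omega))
  refine ⟨?_, ?_, h3⟩
  · intro p
    cases hx with
    | one => simp
    | @step l x a k h hx hl hr =>
    rw [Equiv.Perm.mul_apply, ← mul_assoc,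
      ← sub_add_cancel (y D p * psi D k h) (psi D k h * y D (sw k h p)), add_mul, mul_assoc,
      mul_assoc, add_sub_assoc, ← mul_sub]
    exact add_mem (pol_mul_shufSpan (hy (l + 1) le_rfl) (y_psi_sub_mem_pol k h p)
      (mem_shufSpan hx (by omega))) (hpsi l (by omega) _ _ _ ((ih l (by omega) x a hx).1 _))
  · intro k h
    by_cases hlr : (a ⟨k, by omega⟩ : ℕ) < m ∧ m ≤ (a ⟨k + 1, h⟩ : ℕ)
    · exact mem_shufSpan (hx.step k h hlr.1 hlr.2) (by omega)
    · exact shufSpan_mono (by omega) (h3 k h hlr)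

theorem Shuf.y_mul_sub_mem {l : ℕ} {x : Alg D (m + n)} {a} (hx : Shuf D m (m + n) l x a)
    (p : Fin (m + n)) : y D p * x - x * y D (a p) ∈ shufSpan D m n l :=
  (shuf_mul l x a hx).1 p

/-- The algebra `R_{m+n}` is generated as a right module over `R_m ⊗ R_n` by the elements
belonging to shuffles. -/
theorem exists_mem_shufSpan (r : Alg D (m + n)) : ∃ l, r ∈ shufSpan D m n l := by
  have key : ∀ r : Alg D (m + n), ∀ l, ∃ l', ∀ z ∈ shufSpan D m n l, r * z ∈ shufSpan D m n l' := by
    intro r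
    have hy : ∀ l p, ∀ z ∈ shufSpan D m n l, y D p * z ∈ shufSpan D m n l := by
      intro l p z hz
      refine mul_shufSpan_le (fun j x a hj hx => ?_) hz
      rw [← sub_add_cancel (y D p * x) (x * y D (a p))]
      exact add_mem (shufSpan_mono hj.le (hx.y_mul_sub_mem p))
        (mul_mem_shufSpan hx hj (y_mem_juxt _))
    induction r using Alg.induction with
    | he i => exact fun l => ⟨l, fun z hz => pol_mul_shufSpan (hy l) (e_mem_pol _) hz⟩
    | hy k => exact fun l => ⟨l, hy l k⟩
    | hpsi k h => exact fun l => ⟨l + 1, fun z hz => mul_shufSpan_le (fun j x a hj hx =>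
        shufSpan_mono (by omega) ((shuf_mul j x a hx).2.1 k h)) hz⟩
    | hc c => exact fun l => ⟨l, fun z hz => by
        rw [← Algebra.smul_def]; exact Submodule.smul_mem _ _ hz⟩
    | hadd r s hr hs =>
      intro l
      obtain ⟨l1, h1⟩ := hr l
      obtain ⟨l2, h2⟩ := hs l
      exact ⟨max l1 l2, fun z hz => by
        rw [add_mul]
        exact add_mem (shufSpan_mono (le_max_left _ _) (h1 z hz))
          (shufSpan_mono (le_max_right _ _) (h2 z hz))⟩
    | hmul r s hr hs =>
      intro l
      obtain ⟨l1, h1⟩ := hs l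
      obtain ⟨l2, h2⟩ := hr l1
      exact ⟨l2, fun z hz => by rw [mul_assoc]; exact h2 _ (h1 z hz)⟩
  -- The lengths are bounded strictly: the element `1`, of length `0`, lies in the span with bound
  -- `1`.
  obtain ⟨l, hl⟩ := key r 1
  exact ⟨l, by simpa using hl 1 (mem_shufSpan .one one_pos)⟩

end Alg
end KLR

/-! ### The generic representation on functions on the symmetric group -/

namespace KLR

namespace Generic

open Alg

variable {I K F : Type u} [Fintype I] [DecidableEq I] [Field K] [Field F] [Algebra K F]
  (D : Params I K) {n : ℕ} (i : Fin n → I) (x : Fin n → F)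

/-- The diagonal coefficient of a crossing of the strands `p` and `q`. -/
noncomputable def diagCoeff (p q : Fin n) : F := if i p = i q then (x p - x q)⁻¹ else 0

/-- The square of the off-diagonal part of a crossing of the strands `p` and `q`. -/
noncomputable def norm (p q : Fin n) : F :=
  if i p = i q then -((x p - x q)⁻¹) ^ 2 else evalPoly (D.Q (i p) (i q)) (x p) (x q)

/-- The off-diagonal coefficient of a crossing of the strands `p` and `q`. -/
noncomputable def offCoeff (p q : Fin n) : F := if q < p then 1 else norm D i x p q

theorem evalPoly_swap {A : Type*} [CommRing A] [Algebra K A] {i j : I} (h : i ≠ j) (a b : A) :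
    evalPoly (D.Q j i) b a = evalPoly (D.Q i j) a b := by
  rw [evalPoly_eq_aeval, evalPoly_eq_aeval, D.Q_symm i j h, MvPolynomial.aeval_rename]
  congr 2
  ext k
  fin_cases k <;> rfl

theorem evalPoly_apply {X : Type*} (P : MvPolynomial (Fin 2) K) (f g : X → F) (a : X) :
    evalPoly P f g a = evalPoly P (f a) (g a) := by
  simp [evalPoly]

theorem evalDivDiff_apply {X : Type*} (P : MvPolynomial (Fin 2) K) (f g h : X → F) (a : X) :
    evalDivDiff P f g h a = evalDivDiff P (f a) (g a) (h a) := by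
  simp [evalDivDiff]

theorem diagCoeff_swap (p q : Fin n) : diagCoeff i x q p = -diagCoeff i x p q := by
  unfold diagCoeff
  by_cases h : i p = i q
  · rw [if_pos h, if_pos h.symm, ← neg_sub, inv_neg]
  · rw [if_neg h, if_neg (Ne.symm h), neg_zero]

theorem norm_swap (p q : Fin n) : norm D i x q p = norm D i x p q := by
  unfold norm
  by_cases h : i p = i q
  · rw [if_pos h, if_pos h.symm, ← neg_sub, inv_neg, neg_sq]
  · rw [if_neg h, if_neg (Ne.symm h), evalPoly_swap D h]

/-- The relations constrain only the product of the two off-diagonal coefficients, so one of them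
can be normalized to `1`. -/
theorem offCoeff_mul {p q : Fin n} (h : p ≠ q) :
    offCoeff D i x p q * offCoeff D i x q p = norm D i x p q := by
  unfold offCoeff
  rcases lt_or_gt_of_ne h with h | h
  · rw [if_neg h.not_gt, if_pos h, mul_one]
  · rw [if_pos h, if_neg h.not_gt, one_mul, norm_swap]

/-- Functions act by multiplication. -/
noncomputable def diag (n : ℕ) (F K : Type u) [Field K] [Field F] [Algebra K F] :
    (Equiv.Perm (Fin n) → F) →ₐ[K] Module.End F (Equiv.Perm (Fin n) → F) :=
  (Algebra.lmul F (Equiv.Perm (Fin n) → F)).restrictScalars K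

theorem diag_apply (g f : Equiv.Perm (Fin n) → F) (a) : diag n F K g f a = g a * f a := rfl

variable (F K) in
/-- The operator of an idempotent. -/
noncomputable def opE (j : Fin n → I) : Module.End F (Equiv.Perm (Fin n) → F) :=
  diag n F K fun a => if j = i ∘ a then 1 else 0

variable (K) in
/-- The operator of a dot. -/
noncomputable def opY (p : Fin n) : Module.End F (Equiv.Perm (Fin n) → F) :=
  diag n F K fun a => x (a p)

/-- The operator of a crossing. -/
noncomputable def opPsi (k : ℕ) (h : k + 1 < n) : Module.End F (Equiv.Perm (Fin n) → F) where
  toFun f a := offCoeff D i x (a ⟨k, by omega⟩) (a ⟨k + 1, h⟩) * f (a * sw k h) +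
    diagCoeff i x (a ⟨k, by omega⟩) (a ⟨k + 1, h⟩) * f a
  map_add' f g := by ext a; simp only [Pi.add_apply]; ring
  map_smul' c f := by ext a; simp only [Pi.smul_apply, smul_eq_mul, RingHom.id_apply]; ring

theorem opPsi_apply (k : ℕ) (h : k + 1 < n) (f : Equiv.Perm (Fin n) → F) (a) :
    opPsi D i x k h f a = offCoeff D i x (a ⟨k, by omega⟩) (a ⟨k + 1, h⟩) * f (a * sw k h) +
      diagCoeff i x (a ⟨k, by omega⟩) (a ⟨k + 1, h⟩) * f a := rfl

theorem perm_ne (a : Equiv.Perm (Fin n)) {k l : ℕ} (hk : k < n) (hl : l < n) (h : k ≠ l) :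
    a ⟨k, hk⟩ ≠ a ⟨l, hl⟩ :=
  fun h' => h (Fin.mk.inj (a.injective h'))

variable (hx : ∀ p q, p ≠ q → x p ≠ x q)
include hx

/-- On the values of a function at `a` and `a * sw k h` a crossing is a 2×2 matrix with opposite
diagonal entries. Its square is the scalar `norm + diagCoeff ^ 2`, and `norm` is chosen so that this
is `0` for equal labels and `Q` for different ones. -/
theorem opPsi_sq (k : ℕ) (h : k + 1 < n) :
    opPsi D i x k h * opPsi D i x k h = diag n F K fun a =>
      if i (a ⟨k, by omega⟩) = i (a ⟨k + 1, h⟩) then 0 else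
        evalPoly (D.Q (i (a ⟨k, by omega⟩)) (i (a ⟨k + 1, h⟩))) (x (a ⟨k, by omega⟩))
          (x (a ⟨k + 1, h⟩)) := by
  refine LinearMap.ext fun f => funext fun a => ?_
  rw [diag_apply, Module.End.mul_apply]
  simp only [opPsi_apply, Equiv.Perm.mul_apply, sw_left, sw_right, mul_assoc a, sw_mul_self,
    mul_one]
  have hne := perm_ne a (show k < n by omega) h (by omega)
  set p := a ⟨k, by omega⟩
  set q := a ⟨k + 1, h⟩
  have h1 := offCoeff_mul D i x hne
  have h2 : norm D i x p q + diagCoeff i x p q ^ 2 =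
      if i p = i q then 0 else evalPoly (D.Q (i p) (i q)) (x p) (x q) := by
    unfold norm diagCoeff
    split_ifs <;> ring
  rw [← h2, diagCoeff_swap i x p q, ← h1]
  ring

theorem opY_mul_opPsi_left (k : ℕ) (h : k + 1 < n) :
    opY K x ⟨k, by omega⟩ * opPsi D i x k h = opPsi D i x k h * opY K x ⟨k + 1, h⟩ +
      diag n F K fun a => if i (a ⟨k, by omega⟩) = i (a ⟨k + 1, h⟩) then 1 else 0 := by
  refine LinearMap.ext fun f => funext fun a => ?_
  simp only [LinearMap.add_apply, Pi.add_apply, Module.End.mul_apply, opPsi_apply, opY, diag_apply,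
    Equiv.Perm.mul_apply, sw_right]
  have hne := sub_ne_zero.2 (hx _ _ (perm_ne a (show k < n by omega) h (by omega)))
  unfold diagCoeff
  split_ifs
  · field_simp
    ring
  · ring

theorem opPsi_mul_opY_left (k : ℕ) (h : k + 1 < n) :
    opPsi D i x k h * opY K x ⟨k, by omega⟩ = opY K x ⟨k + 1, h⟩ * opPsi D i x k h +
      diag n F K fun a => if i (a ⟨k, by omega⟩) = i (a ⟨k + 1, h⟩) then 1 else 0 := by
  refine LinearMap.ext fun f => funext fun a => ?_
  simp only [LinearMap.add_apply, Pi.add_apply, Module.End.mul_apply, opPsi_apply, opY, diag_apply,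
    Equiv.Perm.mul_apply, sw_left]
  have hne := sub_ne_zero.2 (hx _ _ (perm_ne a (show k < n by omega) h (by omega)))
  unfold diagCoeff
  split_ifs
  · field_simp
    ring
  · ring

omit hx in
theorem sw_braid (k : ℕ) (h : k + 2 < n) :
    sw k (by omega) * sw (k + 1) h * sw k (by omega) =
      sw (k + 1) h * sw k (by omega) * sw (k + 1) h := by
  unfold sw
  have h1 := Equiv.swap_mul_swap_mul_swap (x := (⟨k + 2, h⟩ : Fin n)) (y := ⟨k + 1, by omega⟩)
    (z := ⟨k, by omega⟩) (by simp) (by simp)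
  have h2 := Equiv.swap_mul_swap_mul_swap (x := (⟨k, by omega⟩ : Fin n)) (y := ⟨k + 1, by omega⟩)
    (z := ⟨k + 2, h⟩) (by simp) (by simp)
  rw [Equiv.swap_comm (⟨k + 1, by omega⟩ : Fin n) ⟨k, by omega⟩,
    Equiv.swap_comm (⟨k + 2, h⟩ : Fin n) ⟨k + 1, by omega⟩,
    Equiv.swap_comm (⟨k, by omega⟩ : Fin n) ⟨k + 2, h⟩] at h1
  exact h1.trans h2.symm

/-- Partial fractions: `1 / (u * v) = (1 / u + 1 / v) / (u + v)` for `u = x p - x q`, `v = x q - x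
r`. Unless all three labels agree, both sides vanish. -/
theorem diagCoeff_mul {p q r : Fin n} (hpq : p ≠ q) (hqr : q ≠ r) (hpr : p ≠ r) :
    diagCoeff i x p q * diagCoeff i x q r =
      diagCoeff i x p r * (diagCoeff i x p q + diagCoeff i x q r) := by
  have h1 := sub_ne_zero.2 (hx _ _ hpq)
  have h2 := sub_ne_zero.2 (hx _ _ hqr)
  have h3 := sub_ne_zero.2 (hx _ _ hpr)
  unfold diagCoeff
  by_cases hpq : i p = i q <;> by_cases hqr : i q = i r
  · rw [if_pos hpq, if_pos hqr, if_pos (hpq.trans hqr)]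
    field_simp
    ring
  · rw [if_pos hpq, if_neg hqr, if_neg (fun h => hqr (hpq.symm.trans h))]; ring
  · rw [if_neg hpq, if_pos hqr, if_neg (fun h => hpq (h.trans hqr.symm))]; ring
  · rw [if_neg hpq, if_neg hqr]; ring

/-- The left side is the coefficient of `f a` in the difference of the two triple products of
crossings. For labels `i p = i r ≠ i q` only its first term survives, which is the divided
difference of `Q` by the symmetry of `Q`. For three equal labels the two terms cancel by
`diagCoeff_mul`. -/
theorem diagCoeff_norm {p q r : Fin n} (hpq : p ≠ q) (hqr : q ≠ r) (hpr : p ≠ r) :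
    diagCoeff i x p r * (norm D i x p q - norm D i x q r) +
      diagCoeff i x p q * diagCoeff i x q r * (diagCoeff i x p q - diagCoeff i x q r) =
      if i p = i r ∧ i p ≠ i q then evalDivDiff (D.Q (i p) (i q)) (x p) (x q) (x r) else 0 := by
  have h1 := sub_ne_zero.2 (hx _ _ hpq)
  have h2 := sub_ne_zero.2 (hx _ _ hqr)
  have h3 := sub_ne_zero.2 (hx _ _ hpr)
  split_ifs with h
  · have hq : i q ≠ i r := fun h' => h.2 (h.1.trans h'.symm)
    unfold diagCoeff norm
    rw [if_pos h.1, if_neg h.2, if_neg hq, if_neg h.2, if_neg hq, ← h.1,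
      evalPoly_swap D h.2 (x r) (x q)]
    have := evalDivDiff_mul (D.Q (i p) (i q)) (x p) (x q) (x r)
    field_simp
    linear_combination this
  · rw [diagCoeff_mul i x hx hpq hqr hpr]
    unfold diagCoeff norm
    by_cases hpr' : i p = i r
    · have hq : i p = i q := by by_contra hq; exact h ⟨hpr', hq⟩
      rw [if_pos hpr', if_pos hq, if_pos (hq.symm.trans hpr'), if_pos hq,
        if_pos (hq.symm.trans hpr')]
      ring
    · rw [if_neg hpr']; ring

theorem opPsi_braid (k : ℕ) (h : k + 2 < n) :
    opPsi D i x k (by omega) * opPsi D i x (k + 1) h * opPsi D i x k (by omega) =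
      opPsi D i x (k + 1) h * opPsi D i x k (by omega) * opPsi D i x (k + 1) h +
      diag n F K fun a =>
        if i (a ⟨k, by omega⟩) = i (a ⟨k + 2, h⟩) ∧ i (a ⟨k, by omega⟩) ≠ i (a ⟨k + 1, by omega⟩)
        then evalDivDiff (D.Q (i (a ⟨k, by omega⟩)) (i (a ⟨k + 1, by omega⟩)))
          (x (a ⟨k, by omega⟩)) (x (a ⟨k + 1, by omega⟩)) (x (a ⟨k + 2, h⟩)) else 0 := by
  refine LinearMap.ext fun f => funext fun a => ?_
  have s1 : sw k (by omega) ⟨k + 2, h⟩ = ⟨k + 2, h⟩ := sw_of_ne _ _ (by simp) (by simp)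
  have s2 : sw (k + 1) h ⟨k, by omega⟩ = ⟨k, by omega⟩ :=
    sw_of_ne _ _ (by simp) (by simp; omega)
  have s3 : sw (k + 1) h ⟨k + 2, h⟩ = ⟨k + 1, by omega⟩ := sw_right _ _
  have s4 : sw (k + 1) h ⟨k + 1, by omega⟩ = ⟨k + 2, h⟩ := sw_left _ _
  have hpq := perm_ne a (show k < n by omega) (show k + 1 < n by omega) (by omega)
  have hqr := perm_ne a (show k + 1 < n by omega) h (by omega)
  have hpr := perm_ne a (show k < n by omega) h (by omega)
  simp only [LinearMap.add_apply, Pi.add_apply, Module.End.mul_apply, opPsi_apply, diag_apply,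
    Equiv.Perm.mul_apply, sw_left, sw_right, mul_assoc a, sw_mul_self, mul_one, s1, s2, s3, s4]
  rw [sw_braid k h, ← diagCoeff_norm D i x hx hpq hqr hpr, ← offCoeff_mul D i x hpq, ← offCoeff_mul D i x hqr,
    diagCoeff_swap i x (a ⟨k, by omega⟩) (a ⟨k + 1, by omega⟩),
    diagCoeff_swap i x (a ⟨k + 1, by omega⟩) (a ⟨k + 2, by omega⟩)]
  -- The coefficients at `a * sw k` and `a * sw (k + 1)` also have to match; both are instances of
  -- the partial fraction identity.
  linear_combination (offCoeff D i x (a ⟨k, by omega⟩) (a ⟨k + 1, by omega⟩) *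
    f (a * sw k (by omega)) - offCoeff D i x (a ⟨k + 1, by omega⟩) (a ⟨k + 2, by omega⟩) *
    f (a * sw (k + 1) h)) * diagCoeff_mul i x hx hpq hqr hpr

omit hx in
-- `opE j` restricts functions to the permutations with `j = i ∘ a`, so conditions on the labels of
-- `j` turn into conditions on those of `i ∘ a`.
theorem diag_mul_opE {g g' : Equiv.Perm (Fin n) → F} {j : Fin n → I}
    (h : ∀ a : Equiv.Perm (Fin n), j = i ∘ a → g a = g' a) :
    diag n F K g * opE K F i j = diag n F K g' * opE K F i j := by
  rw [opE, ← map_mul, ← map_mul]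
  congr 1
  ext a
  simp only [Pi.mul_apply]
  split_ifs with h'
  · rw [h a h']
  · simp

theorem rel (a b : Module.End F (Equiv.Perm (Fin n) → F))
    (h : Rel D n (opE K F i) (opY K x) (opPsi D i x) a b) : a = b := by
  cases h with
  | e_mul_self j =>
    rw [opE, ← map_mul]
    congr 1; ext a; simp
  | e_mul_ne j j' hj =>
    rw [opE, opE, ← map_mul, ← map_zero (diag n F K)]
    congr 1; ext a
    simp only [Pi.mul_apply, Pi.zero_apply]
    split_ifs with h1 h2
    · exact absurd (h1.trans h2.symm) hj
    all_goals simp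
  | e_sum =>
    simp only [opE]
    rw [← map_sum, ← map_one (diag n F K)]
    congr 1; ext a; simp
  | y_mul_e k j => rw [opE, opY, ← map_mul, ← map_mul, mul_comm]
  | psi_mul_e k h j =>
    refine LinearMap.ext fun f => funext fun a => ?_
    simp only [Module.End.mul_apply, opPsi_apply, opE, diag_apply]
    have e1 : (j = i ∘ (a * sw k h)) ↔ swapWord k h j = i ∘ a := by
      constructor
      · rintro rfl
        funext p
        simp only [swapWord, Function.comp_apply, Equiv.Perm.mul_apply, sw, Equiv.swap_apply_self]
      · intro h'
        rw [← swapWord_swapWord k h j, h']; rfl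
    simp only [e1]
    -- A nonzero diagonal coefficient forces equal labels in positions `k`, `k + 1` of `i ∘ a`. This
    -- word is then fixed by the exchange, and the two conditions on `j` are equivalent.
    have e2 : diagCoeff i x (a ⟨k, by omega⟩) (a ⟨k + 1, h⟩) * (if j = i ∘ a then 1 else 0) =
        diagCoeff i x (a ⟨k, by omega⟩) (a ⟨k + 1, h⟩) *
          (if swapWord k h j = i ∘ a then 1 else 0) := by
      unfold diagCoeff
      split_ifs with h1 h2 h3 h3 <;> try simp
      · refine absurd ?_ h3
        subst h2
        rw [← e1]
        funext p
        by_cases h5 : (p : ℕ) = k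
        · obtain rfl : p = ⟨k, Nat.lt_of_succ_lt h⟩ := Fin.ext h5
          simp [sw_left, h1]
        by_cases h6 : (p : ℕ) = k + 1
        · obtain rfl : p = ⟨k + 1, h⟩ := Fin.ext h6
          simp [sw_right, h1]
        simp [sw_of_ne k h h5 h6]
      · refine absurd ?_ h2
        rw [← e1] at h3
        subst h3
        funext p
        by_cases h5 : (p : ℕ) = k
        · obtain rfl : p = ⟨k, Nat.lt_of_succ_lt h⟩ := Fin.ext h5
          simp [sw_left, h1]
        by_cases h6 : (p : ℕ) = k + 1
        · obtain rfl : p = ⟨k + 1, h⟩ := Fin.ext h6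
          simp [sw_right, h1]
        simp [sw_of_ne k h h5 h6]
    linear_combination f a * e2
  | y_mul_y k l => rw [opY, opY, ← map_mul, ← map_mul, mul_comm]
  | psi_mul_y k h l h1 h2 =>
    refine LinearMap.ext fun f => funext fun a => ?_
    simp only [Module.End.mul_apply, opPsi_apply, opY, diag_apply, Equiv.Perm.mul_apply,
      sw_of_ne k h h1 h2]
    ring
  | psi_mul_psi k h l h' hkl =>
    refine LinearMap.ext fun f => funext fun a => ?_
    simp only [Module.End.mul_apply, opPsi_apply, Equiv.Perm.mul_apply, mul_assoc a,
      sw_comm h h' (Or.inl hkl)]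
    rw [sw_of_ne k h (p := ⟨l, _⟩) (by simp; omega) (by simp; omega),
      sw_of_ne k h (p := ⟨l + 1, _⟩) (by simp; omega) (by simp; omega),
      sw_of_ne l h' (p := ⟨k, _⟩) (by simp; omega) (by simp; omega),
      sw_of_ne l h' (p := ⟨k + 1, _⟩) (by simp; omega) (by simp; omega)]
    ring
  | dot_left_ne k h j hj =>
    rw [opY_mul_opPsi_left D i x hx, add_mul, diag_mul_opE (K := K) i (g' := 0), map_zero, zero_mul,
      add_zero]
    rintro a rfl
    exact if_neg hj
  | dot_right_ne k h j hj =>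
    rw [opPsi_mul_opY_left D i x hx, add_mul, diag_mul_opE (K := K) i (g' := 0), map_zero, zero_mul,
      add_zero]
    rintro a rfl
    exact if_neg hj
  | dot_left_eq k h j hj =>
    rw [opY_mul_opPsi_left D i x hx, add_mul, diag_mul_opE (K := K) i (g' := 1), map_one, one_mul]
    rintro a rfl
    exact if_pos hj
  | dot_right_eq k h j hj =>
    rw [opPsi_mul_opY_left D i x hx, add_mul, diag_mul_opE (K := K) i (g' := 1), map_one, one_mul]
    rintro a rfl
    exact if_pos hj
  | psi_sq_eq k h j hj =>
    rw [opPsi_sq D i x hx, diag_mul_opE (K := K) i (g' := 0), map_zero, zero_mul]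
    rintro a rfl
    exact if_pos hj
  | psi_sq_ne k h j hj =>
    rw [opPsi_sq D i x hx, opY, opY, ← map_evalPoly]
    refine diag_mul_opE (K := K) i ?_
    rintro a rfl
    refine (if_neg hj).trans ?_
    rw [evalPoly_apply]
    rfl
  | braid k h j hj =>
    rw [opPsi_braid D i x hx, add_mul, diag_mul_opE (K := K) i (g' := 0), map_zero, zero_mul,
      add_zero]
    rintro a rfl
    exact if_neg hj
  | braid_ne k h j hj =>
    rw [opPsi_braid D i x hx, add_mul, opY, opY, opY, ← map_evalDivDiff]
    congr 1
    refine diag_mul_opE (K := K) i ?_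
    rintro a rfl
    refine (if_pos hj).trans ?_
    rw [evalDivDiff_apply]
    rfl

/-- The module induced from the one-dimensional module over the dots and idempotents, on which the
idempotent of the word `i` is the identity and the dots act by the numbers `x`, which have to be
distinct. -/
noncomputable def rep : Alg D n →ₐ[K] Module.End F (Equiv.Perm (Fin n) → F) :=
  Alg.lift (opE K F i) (opY K x) (opPsi D i x) (rel D i x hx)

theorem rep_e_single (j : Fin n → I) : rep D i x hx (e D j) (Pi.single 1 1) =
    if j = i then Pi.single 1 1 else 0 := by
  rw [rep, lift_e]
  ext a
  rw [opE, diag_apply]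
  by_cases ha : a = 1
  · subst ha
    simp only [Pi.single_eq_same, mul_one, Equiv.Perm.coe_one, Function.comp_id]
    split_ifs with h <;> simp [h]
  · split_ifs <;> simp [ha]

theorem rep_y_single (p : Fin n) : rep D i x hx (y D p) (Pi.single 1 1) =
    x p • Pi.single 1 1 := by
  rw [rep, lift_y]
  ext a
  rw [opY, diag_apply]
  by_cases ha : a = 1
  · subst ha; simp
  · simp [ha]

/-- Since off-diagonal coefficients are invertible, a crossing takes the delta function at `a` to a
nonzero multiple of the one at `a * sw k h`, up to a multiple of itself; adjacent transpositions
reach every permutation. -/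
theorem span_rep_single (hnorm : ∀ p q, p ≠ q → norm D i x p q ≠ 0) :
    Submodule.span F (Set.range fun r => rep D i x hx r (Pi.single 1 1)) = ⊤ := by
  set W := Submodule.span F (Set.range fun r => rep D i x hx r (Pi.single 1 1)) with hW
  have hstab : ∀ r, ∀ f ∈ W, rep D i x hx r f ∈ W := by
    intro r f hf
    induction hf using Submodule.span_induction with
    | mem f hf =>
      obtain ⟨s, rfl⟩ := hf
      exact Submodule.subset_span ⟨r * s, by simp [map_mul]⟩
    | zero => rw [map_zero]; exact zero_mem _
    | add f g _ _ hf hg => rw [map_add]; exact add_mem hf hg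
    | smul c f _ hf => rw [map_smul]; exact Submodule.smul_mem _ _ hf
  have hstep : ∀ a k h, Pi.single a (1 : F) ∈ W → Pi.single (a * sw k h) (1 : F) ∈ W := by
    intro a k h ha
    have key : rep D i x hx (psi D k h) (Pi.single a 1) =
        offCoeff D i x (a ⟨k + 1, h⟩) (a ⟨k, by omega⟩) • Pi.single (a * sw k h) (1 : F) +
        diagCoeff i x (a ⟨k, by omega⟩) (a ⟨k + 1, h⟩) • Pi.single a (1 : F) := by
      rw [rep, lift_psi]
      ext b
      rw [opPsi_apply]
      simp only [Pi.add_apply, Pi.smul_apply, smul_eq_mul, Pi.single_apply]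
      congr 1
      · by_cases hb : b = a * sw k h
        · subst hb
          rw [mul_assoc, sw_mul_self, mul_one, if_pos rfl, if_pos rfl, Equiv.Perm.mul_apply,
            Equiv.Perm.mul_apply, sw_left, sw_right]
        · rw [if_neg hb, if_neg, mul_zero, mul_zero]
          rintro rfl
          exact hb (by rw [mul_assoc, sw_mul_self, mul_one])
      · by_cases hb : b = a
        · subst hb; rfl
        · rw [if_neg hb, mul_zero, mul_zero]
    have hne : offCoeff D i x (a ⟨k + 1, h⟩) (a ⟨k, by omega⟩) ≠ 0 := by
      have hpq := perm_ne a h (show k < n by omega) (by omega)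
      have := offCoeff_mul D i x hpq
      intro h0
      rw [h0, zero_mul] at this
      exact hnorm _ _ hpq this.symm
    have := sub_mem (hstab (psi D k h) _ ha)
      (Submodule.smul_mem W (diagCoeff i x (a ⟨k, by omega⟩) (a ⟨k + 1, h⟩)) ha)
    rw [key, add_sub_cancel_right] at this
    exact (Submodule.smul_mem_iff _ hne).1 this
  have hone : Pi.single (1 : Equiv.Perm (Fin n)) (1 : F) ∈ W :=
    Submodule.subset_span ⟨1, by simp⟩
  have hall : ∀ a, Pi.single a (1 : F) ∈ W := by
    clear_value W
    intro a
    cases n with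
    | zero => rwa [Subsingleton.elim a 1]
    | succ n =>
      have ha : a ∈ Submonoid.closure
          (Set.range fun i : Fin n => Equiv.swap i.castSucc i.succ) := by
        rw [Equiv.Perm.mclosure_swap_castSucc_succ]; trivial
      induction ha using Submonoid.closure_induction_right with
      | one => exact hone
      | mul_right a _ b hb ih =>
        obtain ⟨k, rfl⟩ := hb
        exact hstep a k (by omega) ih
  rw [eq_top_iff]
  intro f _
  rw [← Finset.univ_sum_single f]
  refine sum_mem fun a _ => ?_
  have : (Pi.single a (f a) : Equiv.Perm (Fin n) → F) = f a • Pi.single a (1 : F) := by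
    rw [← Pi.single_smul, smul_eq_mul, mul_one]
  rw [this]
  exact Submodule.smul_mem _ _ (hall a)

end Generic
end KLR

/-! ### Spanning families with at most `n!` elements are independent -/

namespace KLR

namespace Alg

variable {I K : Type u} [Fintype I] [Field K] {D : Params I K} {m n : ℕ}

/-- A monomial in the dots. -/
noncomputable def yMon (D : Params I K) (s : Fin n → ℕ) : Alg D n :=
  (List.ofFn fun k => y D k ^ s k).prod

theorem yMon_append (s : Fin m → ℕ) (t : Fin n → ℕ) :
    yMon D (Fin.append s t) = inclLeft D m n (yMon D s) * inclRight D m n (yMon D t) := by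
  rw [yMon, yMon, yMon, map_list_prod, map_list_prod, List.map_ofFn, List.map_ofFn,
    List.ofFn_add, List.prod_append]
  congr 3 <;> ext k
  · simp only [Function.comp_apply, map_pow, inclLeft_y]
    exact congrArg (y D (Fin.castAdd n k) ^ ·) (Fin.append_left s t k)
  · simp only [Function.comp_apply, map_pow, inclRight_y, Fin.append_right]

variable (D) in
/-- A family spanning the algebra as a right module over dots and idempotents, in the sense that
its products with monomials in the dots and with idempotents span the algebra. -/
def IsSpanning {T : Type} (f : T → Alg D n) : Prop :=
  Submodule.span K (Set.range fun p : T × (Fin n → ℕ) × (Fin n → I) =>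
    f p.1 * yMon D p.2.1 * e D p.2.2) = ⊤

section Independence

variable [DecidableEq I]

/-- For different labels the value of `Q` at two distinct variables is a renaming of `Q` along an
injective map, so it is nonzero because `Q` is. -/
theorem norm_generic_ne_zero (i : Fin n → I) {p q : Fin n} (hpq : p ≠ q) :
    Generic.norm D i (fun k => algebraMap (MvPolynomial (Fin n) K)
      (FractionRing (MvPolynomial (Fin n) K)) (MvPolynomial.X k)) p q ≠ 0 := by
  unfold Generic.norm
  split_ifs with h
  · rw [neg_ne_zero]
    refine pow_ne_zero _ (inv_ne_zero (sub_ne_zero.2 fun h' => hpq ?_))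
    exact MvPolynomial.X_injective (IsFractionRing.injective _ _ h')
  · change evalPoly _ (IsScalarTower.toAlgHom K (MvPolynomial (Fin n) K)
      (FractionRing (MvPolynomial (Fin n) K)) (MvPolynomial.X p)) (IsScalarTower.toAlgHom K
      (MvPolynomial (Fin n) K) (FractionRing (MvPolynomial (Fin n) K)) (MvPolynomial.X q)) ≠ 0
    rw [← map_evalPoly (IsScalarTower.toAlgHom K (MvPolynomial (Fin n) K)
      (FractionRing (MvPolynomial (Fin n) K))), evalPoly_eq_aeval]
    have h1 : (MvPolynomial.aeval ![MvPolynomial.X p, MvPolynomial.X q] :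
        MvPolynomial (Fin 2) K →ₐ[K] MvPolynomial (Fin n) K) = MvPolynomial.rename ![p, q] := by
      refine MvPolynomial.algHom_ext fun k => ?_
      fin_cases k <;> simp
    rw [h1]
    intro h2
    refine D.Q_ne_zero _ _ h (MvPolynomial.rename_injective ![p, q] ?_ ?_)
    · intro a b hab
      fin_cases a <;> fin_cases b <;> simp_all
    · rw [map_zero]
      exact IsFractionRing.injective (MvPolynomial (Fin n) K)
        (FractionRing (MvPolynomial (Fin n) K)) (h2.trans (map_zero _).symm)

theorem rep_yMon {F : Type u} [Field F] [Algebra K F] (i : Fin n → I) (x : Fin n → F)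
    (hx : ∀ p q, p ≠ q → x p ≠ x q) (s : Fin n → ℕ) :
    Generic.rep D i x hx (yMon D s) (Pi.single 1 1) = (∏ k, x k ^ s k) • Pi.single 1 1 := by
  have key : ∀ l : List (Fin n),
      Generic.rep D i x hx (l.map fun k => y D k ^ s k).prod (Pi.single 1 1) =
        (l.map fun k => x k ^ s k).prod • Pi.single 1 1 := by
    intro l
    induction l with
    | nil => simp
    | cons k l ih =>
      have hp : ∀ N : ℕ, Generic.rep D i x hx (y D k ^ N) (Pi.single 1 1) =
          x k ^ N • Pi.single 1 1 := by
        intro N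
        induction N with
        | zero => simp
        | succ N ihN =>
          rw [pow_succ, map_mul, Module.End.mul_apply, Generic.rep_y_single, map_smul, ihN,
            smul_smul, pow_succ, mul_comm]
      rw [List.map_cons, List.prod_cons, map_mul, Module.End.mul_apply, ih, map_smul, hp,
        smul_smul, List.map_cons, List.prod_cons, mul_comm]
  have := key (List.finRange n)
  rw [← List.ofFn_eq_map, ← List.ofFn_eq_map, List.prod_ofFn] at this
  exact this

/-- A spanning family with at most `n!` elements is independent. -/
theorem IsSpanning.linearIndependent {T : Type} [Fintype T] {f : T → Alg D n}
    (hf : IsSpanning D f) (hT : Fintype.card T ≤ n.factorial) :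
    LinearIndependent K fun p : T × (Fin n → ℕ) × (Fin n → I) =>
      f p.1 * yMon D p.2.1 * e D p.2.2 := by
  classical
  let F := FractionRing (MvPolynomial (Fin n) K)
  let x : Fin n → F := fun k => algebraMap (MvPolynomial (Fin n) K) F (MvPolynomial.X k)
  have hx : ∀ p q, p ≠ q → x p ≠ x q := fun p q hpq h =>
    hpq (MvPolynomial.X_injective (IsFractionRing.injective _ _ h))
  rw [linearIndependent_iff]
  intro c hc
  ext ⟨t, s, i⟩
  let v : T → (Equiv.Perm (Fin n) → F) := fun t => Generic.rep D i x hx (f t) (Pi.single 1 1)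
  have hval : ∀ p : T × (Fin n → ℕ) × (Fin n → I),
      Generic.rep D i x hx (f p.1 * yMon D p.2.1 * e D p.2.2) (Pi.single 1 1) =
        (if p.2.2 = i then ∏ k, x k ^ p.2.1 k else 0) • v p.1 := by
    intro p
    rw [map_mul, map_mul, Module.End.mul_apply, Module.End.mul_apply, Generic.rep_e_single]
    split_ifs
    · rw [rep_yMon, map_smul]
    · rw [map_zero, map_zero, zero_smul]
  -- The delta function at `1` is a joint eigenvector of dots and idempotents, so the `v t` already
  -- span over `F` everything that the algebra generates from it.
  have hspan : ⊤ ≤ Submodule.span F (Set.range v) := by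
    rw [← Generic.span_rep_single D i x hx fun p q hpq => norm_generic_ne_zero i hpq,
      Submodule.span_le]
    rintro _ ⟨r, rfl⟩
    have hr : r ∈ Submodule.span K (Set.range fun p : T × (Fin n → ℕ) × (Fin n → I) =>
      f p.1 * yMon D p.2.1 * e D p.2.2) := by rw [hf]; trivial
    induction hr using Submodule.span_induction with
    | mem r hr =>
      obtain ⟨p, rfl⟩ := hr
      simp only [hval]
      exact Submodule.smul_mem _ _ (Submodule.subset_span ⟨_, rfl⟩)
    | zero => simp
    | add r r' _ _ hr hr' => simp only [map_add, LinearMap.add_apply]; exact add_mem hr hr'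
    | smul c r _ hr =>
      simp only [map_smul, LinearMap.smul_apply]
      rw [← algebraMap_smul F c]
      exact Submodule.smul_mem _ _ hr
  -- At most `n!` vectors spanning a space of dimension `n!` are independent.
  have hind : LinearIndependent F v := by
    refine linearIndependent_of_top_le_span_of_card_le_finrank hspan ?_
    rw [Module.finrank_fintype_fun_eq_card, Fintype.card_perm, Fintype.card_fin]
    exact hT
  have h0 := congrArg (fun r => Generic.rep D i x hx r (Pi.single 1 1)) hc
  simp only [map_zero, LinearMap.zero_apply, Finsupp.linearCombination_apply, Finsupp.sum,
    map_sum, LinearMap.sum_apply, map_smul, LinearMap.smul_apply, hval] at h0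
  -- Applied to the delta function for the word `i`, the relation `c` becomes a relation among the
  -- `v t` over the polynomial ring. Its coefficients `P t` collect the terms with bottom word `i`,
  -- and the coefficient of `P t` at the monomial `s` is the value of `c` at `(t, s, i)`.
  let P : T → MvPolynomial (Fin n) K := fun t =>
    ∑ p ∈ c.support, if p.1 = t ∧ p.2.2 = i then
      MvPolynomial.monomial (Finsupp.equivFunOnFinite.symm p.2.1) (c p) else 0
  have h1 : ∑ t, algebraMap _ F (P t) • v t = 0 := by
    rw [← h0]
    simp only [P, map_sum, Finset.sum_smul]
    rw [Finset.sum_comm]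
    refine Finset.sum_congr rfl fun p _ => ?_
    rw [Finset.sum_eq_single p.1]
    · by_cases hp : p.2.2 = i
      · rw [if_pos ⟨rfl, hp⟩, if_pos hp, ← algebraMap_smul F (c p), smul_smul]
        congr 1
        rw [MvPolynomial.monomial_eq, map_mul, IsScalarTower.algebraMap_apply K
          (MvPolynomial (Fin n) K) F, MvPolynomial.algebraMap_eq, Finsupp.prod_fintype _ _ (by simp),
          map_prod]
        simp only [map_pow]
        rfl
      · rw [if_neg (fun h => hp h.2), if_neg hp, map_zero]
        simp
    · intro t _ ht
      rw [if_neg (fun h => ht h.1.symm), map_zero, zero_smul]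
    · simp
  have h2 := Fintype.linearIndependent_iff.1 hind _ h1 t
  have h3 : P t = 0 := IsFractionRing.injective _ F (h2.trans (map_zero _).symm)
  have h4 := congrArg (MvPolynomial.coeff (Finsupp.equivFunOnFinite.symm s)) h3
  simp only [P, MvPolynomial.coeff_sum, MvPolynomial.coeff_zero] at h4
  rw [Finset.sum_eq_single (t, s, i)] at h4
  · simpa using h4
  · rintro ⟨t', s', i'⟩ _ hne
    split_ifs with h
    · obtain ⟨rfl, rfl⟩ := h
      rw [MvPolynomial.coeff_monomial, if_neg]
      intro h
      exact hne (Prod.ext rfl (Prod.ext (Finsupp.equivFunOnFinite.symm.injective h) rfl))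
    · exact MvPolynomial.coeff_zero _
  · intro h
    simp [Finsupp.notMem_support_iff.1 h]

end Independence

/-! ### The basis theorem and freeness over `R_m ⊗ R_n` -/

section Shuffles

variable (D m n) in
/-- The permutations shuffling the first `m` strands with the last `n` strands. -/
def ShufPerm : Type := {a : Equiv.Perm (Fin (m + n)) // ∃ l x, Shuf D m (m + n) l x a}

noncomputable instance : Fintype (ShufPerm D m n) := by
  classical exact inferInstanceAs (Fintype {a // _})

/-- The element of the algebra belonging to a shuffle. -/
noncomputable def ShufPerm.elt (a : ShufPerm D m n) : Alg D (m + n) := a.2.choose_spec.choose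

theorem ShufPerm.shuf (a : ShufPerm D m n) :
    Shuf D m (m + n) a.2.choose a.elt a.1 := a.2.choose_spec.choose_spec

/-- A shuffle is determined by the set of positions of the left strands, because the strands of each
block stay in order. -/
theorem card_shufPerm_le : Fintype.card (ShufPerm D m n) ≤ (m + n).choose m := by
  classical
  let φ : ShufPerm D m n → Finset (Fin (m + n)) := fun a =>
    Finset.univ.filter fun p => (a.1 p : ℕ) < m
  have h1 : ∀ a, φ a ∈ Finset.powersetCard m (Finset.univ : Finset (Fin (m + n))) := by
    intro a
    rw [Finset.mem_powersetCard]
    refine ⟨Finset.subset_univ _, ?_⟩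
    have : (φ a).map a.1.toEmbedding = Finset.univ.map (Fin.castAddEmb (n := m) n) := by
      ext q
      simp only [φ, Finset.mem_map, Finset.mem_filter, Finset.mem_univ, true_and,
        Equiv.coe_toEmbedding, Fin.castAddEmb_apply]
      constructor
      · rintro ⟨p, hp, rfl⟩
        exact ⟨⟨a.1 p, hp⟩, rfl⟩
      · rintro ⟨p, rfl⟩
        exact ⟨a.1.symm (Fin.castAdd n p), by simp, by simp⟩
    have := congrArg Finset.card this
    simpa using this
  have h2 : Function.Injective φ := by
    have key : ∀ (a : ShufPerm D m n) p q, a.1 q < a.1 p ↔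
        (q < p ∧ (q ∈ φ a ↔ p ∈ φ a)) ∨ (q ∈ φ a ∧ p ∉ φ a) := by
      intro a p q
      simp only [φ, Finset.mem_filter, Finset.mem_univ, true_and]
      rcases lt_trichotomy q p with h | h | h
      · by_cases hc : ((a.1 q : ℕ) < m ↔ (a.1 p : ℕ) < m)
        · exact iff_of_true (a.shuf.monotone h (by omega)) (Or.inl ⟨h, hc⟩)
        · rw [Fin.lt_def]; omega
      · subst h; simp
      · by_cases hc : ((a.1 q : ℕ) < m ↔ (a.1 p : ℕ) < m)
        · have := a.shuf.monotone h (by omega)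
          refine iff_of_false this.not_gt ?_
          rintro (h' | h')
          · exact h'.1.not_gt h
          · omega
        · have := h.not_gt
          rw [Fin.lt_def]; omega
    intro a b hab
    refine Subtype.ext (Equiv.ext fun p => Fin.ext ?_)
    -- The value of a permutation at `p` counts the `q` with smaller value, and by `key` these
    -- comparisons depend on `φ a` only.
    have hcard : ∀ a : ShufPerm D m n, (a.1 p : ℕ) =
        (Finset.univ.filter fun q => a.1 q < a.1 p).card := by
      intro a
      have : (Finset.univ.filter fun q => a.1 q < a.1 p).map a.1.toEmbedding =
          Finset.Iio (a.1 p) := by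
        ext q
        simp only [Finset.mem_map, Finset.mem_filter, Finset.mem_univ, true_and,
          Equiv.coe_toEmbedding, Finset.mem_Iio]
        constructor
        · rintro ⟨q, h, rfl⟩; exact h
        · intro h; exact ⟨a.1.symm q, by simpa using h, by simp⟩
      have := congrArg Finset.card this
      rw [Finset.card_map, Fin.card_Iio] at this
      exact this.symm
    rw [hcard a, hcard b]
    congr 1
    ext q
    simp only [Finset.mem_filter, Finset.mem_univ, true_and, key, hab]
  have := Finset.card_le_card_of_injOn φ (s := Finset.univ) (fun a _ => h1 a) h2.injOn
  rwa [Finset.card_powersetCard, Finset.card_univ, Finset.card_univ, Fintype.card_fin] at this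

theorem mem_span_shufPerm (r : Alg D (m + n)) : r ∈ Submodule.span K
    (Set.range fun p : ShufPerm D m n × (Alg D m ⊗[K] Alg D n) => p.1.elt * juxt D m n p.2) := by
  obtain ⟨l, hl⟩ := exists_mem_shufSpan r
  refine Submodule.span_le.2 ?_ hl
  rintro _ ⟨j, x, a, b, -, hx, ⟨t, rfl⟩, rfl⟩
  let α : ShufPerm D m n := ⟨a, j, x, hx⟩
  refine Submodule.subset_span ⟨(α, t), ?_⟩
  change α.elt * juxt D m n t = _
  rw [α.shuf.eq_of_perm hx]
  rfl

variable {T U : Type} {f : T → Alg D m} {g : U → Alg D n}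

theorem span_tmul_of_isSpanning (hf : IsSpanning D f) (hg : IsSpanning D g) :
    Submodule.span K (Set.range fun p : (T × (Fin m → ℕ) × (Fin m → I)) ×
      (U × (Fin n → ℕ) × (Fin n → I)) =>
      (f p.1.1 * yMon D p.1.2.1 * e D p.1.2.2) ⊗ₜ[K] (g p.2.1 * yMon D p.2.2.1 * e D p.2.2.2)) =
      ⊤ := by
  have h := Submodule.map₂_span_span K (TensorProduct.mk K (Alg D m) (Alg D n))
    (Set.range fun p : T × (Fin m → ℕ) × (Fin m → I) => f p.1 * yMon D p.2.1 * e D p.2.2)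
    (Set.range fun p : U × (Fin n → ℕ) × (Fin n → I) => g p.1 * yMon D p.2.1 * e D p.2.2)
  rw [hf, hg, TensorProduct.map₂_mk_top_top_eq_top] at h
  rw [h]
  congr 1
  ext z
  simp only [Set.mem_range, Set.mem_image2, Prod.exists, TensorProduct.mk_apply]
  constructor
  · rintro ⟨a, b, c, a', b', c', rfl⟩
    exact ⟨_, ⟨a, b, c, rfl⟩, _, ⟨a', b', c', rfl⟩, rfl⟩
  · rintro ⟨_, ⟨a, b, c, rfl⟩, _, ⟨a', b', c', rfl⟩, rfl⟩
    exact ⟨a, b, c, a', b', c', rfl⟩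

theorem juxt_mul_yMon_mul_e (a : Alg D m) (b : Alg D n) (s : Fin m → ℕ) (t : Fin n → ℕ)
    (i : Fin m → I) (j : Fin n → I) :
    juxt D m n ((a * yMon D s * e D i) ⊗ₜ (b * yMon D t * e D j)) =
      juxt D m n (a ⊗ₜ b) * yMon D (Fin.append s t) * e D (Fin.append i j) := by
  rw [← juxt_e, yMon_append, ← juxt_tmul, ← map_mul, ← map_mul,
    Algebra.TensorProduct.tmul_mul_tmul, Algebra.TensorProduct.tmul_mul_tmul]

/-- The product family. -/
noncomputable def shufFamily (f : T → Alg D m) (g : U → Alg D n) :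
    ShufPerm D m n × T × U → Alg D (m + n) :=
  fun p => p.1.elt * juxt D m n (f p.2.1 ⊗ₜ g p.2.2)

theorem isSpanning_shufFamily (hf : IsSpanning D f) (hg : IsSpanning D g) :
    IsSpanning D (shufFamily f g) := by
  rw [IsSpanning, eq_top_iff]
  intro r _
  refine Submodule.span_le.2 ?_ (mem_span_shufPerm r)
  rintro _ ⟨⟨a, t⟩, rfl⟩
  have ht : t ∈ (⊤ : Submodule K (Alg D m ⊗[K] Alg D n)) := trivial
  rw [← span_tmul_of_isSpanning hf hg] at ht
  simp only [SetLike.mem_coe]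
  induction ht using Submodule.span_induction with
  | mem t ht =>
    obtain ⟨⟨⟨t, s, i⟩, ⟨u, s', i'⟩⟩, rfl⟩ := ht
    refine Submodule.subset_span ⟨((a, t, u), Fin.append s s', Fin.append i i'), ?_⟩
    simp only [shufFamily]
    rw [juxt_mul_yMon_mul_e, mul_assoc, mul_assoc, mul_assoc]
  | zero => rw [map_zero, mul_zero]; exact zero_mem _
  | add t t' _ _ h h' => rw [map_add, mul_add]; exact add_mem h h'
  | smul c t _ h => rw [map_smul, mul_smul_comm]; exact Submodule.smul_mem _ _ h

/-- The identity `(m + n).choose m * m! * n! = (m + n)!` is what makes the bound required for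
independence survive products of families. -/
theorem card_shufFamily_le [Fintype T] [Fintype U] (hT : Fintype.card T ≤ m.factorial)
    (hU : Fintype.card U ≤ n.factorial) :
    Fintype.card (ShufPerm D m n × T × U) ≤ (m + n).factorial := by
  rw [Fintype.card_prod, Fintype.card_prod, ← Nat.add_choose_mul_factorial_mul_factorial,
    mul_assoc]
  exact Nat.mul_le_mul (card_shufPerm_le.trans Nat.choose_symm_add.le) (Nat.mul_le_mul hT hU)

/-- On at most one strand there are no crossings; this starts the induction that adds one strand at
a time. -/
theorem isSpanning_one_of_le_one (hn : n ≤ 1) : IsSpanning D fun _ : Unit => (1 : Alg D n) := by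
  rw [IsSpanning]
  set W := Submodule.span K (Set.range fun p : Unit × (Fin n → ℕ) × (Fin n → I) =>
    (1 : Alg D n) * yMon D p.2.1 * e D p.2.2) with hW
  have hy : ∀ s : Fin n → ℕ, ∀ k, y D k * yMon D s = yMon D (s + Pi.single k 1) := by
    intro s k
    obtain rfl : n = 1 := by have := k.2; omega
    obtain rfl := Subsingleton.elim k 0
    simp [yMon, pow_succ']
  have hc : ∀ s : Fin n → ℕ, ∀ i, e D i * yMon D s = yMon D s * e D i := by
    intro s i
    rw [yMon]
    refine (Commute.list_prod_right _ _ fun x hx => ?_).eq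
    obtain ⟨k, rfl⟩ := (List.mem_ofFn' _ _).1 hx
    exact (Commute.symm (y_mul_e k i)).pow_right _
  have hstab : ∀ r : Alg D n, ∀ z ∈ W, r * z ∈ W := by
    intro r
    induction r using Alg.induction with
    | he i =>
      intro z hz
      induction hz using Submodule.span_induction with
      | mem z hz =>
        obtain ⟨⟨-, s, j⟩, rfl⟩ := hz
        simp only [one_mul]
        rw [← mul_assoc, hc, mul_assoc]
        by_cases hij : i = j
        · subst hij
          rw [e_mul_self]
          exact Submodule.subset_span ⟨((), s, i), by simp⟩
        · rw [e_mul_of_ne hij, mul_zero]; exact zero_mem _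
      | zero => rw [mul_zero]; exact zero_mem _
      | add x y _ _ hx hy => rw [mul_add]; exact add_mem hx hy
      | smul c x _ hx => rw [mul_smul_comm]; exact Submodule.smul_mem _ _ hx
    | hy k =>
      intro z hz
      induction hz using Submodule.span_induction with
      | mem z hz =>
        obtain ⟨⟨-, s, j⟩, rfl⟩ := hz
        simp only [one_mul]
        rw [← mul_assoc, hy]
        exact Submodule.subset_span ⟨((), s + Pi.single k 1, j), by simp⟩
      | zero => rw [mul_zero]; exact zero_mem _
      | add x y _ _ hx hy => rw [mul_add]; exact add_mem hx hy
      | smul c x _ hx => rw [mul_smul_comm]; exact Submodule.smul_mem _ _ hx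
    | hpsi k h => omega
    | hc c => intro z hz; rw [← Algebra.smul_def]; exact Submodule.smul_mem _ _ hz
    | hadd a b ha hb => intro z hz; rw [add_mul]; exact add_mem (ha z hz) (hb z hz)
    | hmul a b ha hb => intro z hz; rw [mul_assoc]; exact ha _ (hb z hz)
  rw [eq_top_iff]
  intro r _
  have h1 : (1 : Alg D n) ∈ W := by
    rw [← sum_e]
    refine sum_mem fun i _ => Submodule.subset_span ⟨((), 0, i), ?_⟩
    simp [yMon]
  simpa using hstab r 1 h1

variable (D) in
theorem exists_isSpanning (n : ℕ) : ∃ (T : Type) (_ : Fintype T) (f : T → Alg D n),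
    Fintype.card T ≤ n.factorial ∧ IsSpanning D f := by
  induction n with
  | zero => exact ⟨Unit, inferInstance, _, by simp, isSpanning_one_of_le_one zero_le_one⟩
  | succ n ih =>
    obtain ⟨T, _, f, hT, hf⟩ := ih
    exact ⟨_, inferInstance, _,
      card_shufFamily_le hT (U := Unit) (n := 1) (D := D) (by simp),
      isSpanning_shufFamily hf (isSpanning_one_of_le_one le_rfl)⟩

/-- The algebra `R_{m+n}` is a free right module over `R_m ⊗ R_n`, and the elements belonging to
shuffles are a basis. -/
theorem bijective_shufPerm_elt (D : Params I K) (m n : ℕ) : Function.Bijective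
    fun b : ShufPerm D m n → Alg D m ⊗[K] Alg D n => ∑ a, a.elt * juxt D m n (b a) := by
  classical
  obtain ⟨T, _, f, hT, hf⟩ := exists_isSpanning D m
  obtain ⟨U, _, g, hU, hg⟩ := exists_isSpanning D n
  have hind := (isSpanning_shufFamily hf hg).linearIndependent (card_shufFamily_le hT hU)
  have hspan := span_tmul_of_isSpanning hf hg
  constructor
  · let Θ : (ShufPerm D m n → Alg D m ⊗[K] Alg D n) →ₗ[K] Alg D (m + n) :=
      ∑ a, (LinearMap.mulLeft K a.elt ∘ₗ (juxt D m n).toLinearMap) ∘ₗ LinearMap.proj a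
    have hΘ : ∀ b, Θ b = ∑ a, a.elt * juxt D m n (b a) := by
      intro b
      simp [Θ]
    refine fun b b' h => ?_
    refine (injective_iff_map_eq_zero Θ).2 (fun b hb => ?_) ((hΘ b).trans (h.trans (hΘ b').symm))
    rw [hΘ] at hb
    have hex : ∀ a, ∃ c : ((T × (Fin m → ℕ) × (Fin m → I)) ×
        (U × (Fin n → ℕ) × (Fin n → I))) →₀ K, Finsupp.linearCombination K
        (fun p : (T × (Fin m → ℕ) × (Fin m → I)) × (U × (Fin n → ℕ) × (Fin n → I)) =>
        (f p.1.1 * yMon D p.1.2.1 * e D p.1.2.2) ⊗ₜ[K]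
          (g p.2.1 * yMon D p.2.2.1 * e D p.2.2.2)) c = b a := by
      intro a
      have : b a ∈ (⊤ : Submodule K (Alg D m ⊗[K] Alg D n)) := trivial
      rw [← hspan] at this
      exact (Finsupp.mem_span_range_iff_exists_finsupp.1 this)
    choose c hc using hex
    -- Concatenating the monomials and the words of the two blocks identifies products of a shuffle
    -- with a pure tensor of the two families as members of the product family. The identification
    -- is injective, so these products stay independent.
    let ε : ShufPerm D m n × ((T × (Fin m → ℕ) × (Fin m → I)) ×
        (U × (Fin n → ℕ) × (Fin n → I))) →
        (ShufPerm D m n × T × U) × (Fin (m + n) → ℕ) × (Fin (m + n) → I) := fun p =>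
      ((p.1, p.2.1.1, p.2.2.1), Fin.append p.2.1.2.1 p.2.2.2.1, Fin.append p.2.1.2.2 p.2.2.2.2)
    have hε : Function.Injective ε := by
      rintro ⟨a, ⟨t, s, i⟩, ⟨u, s', i'⟩⟩ ⟨a', ⟨t', s2, i2⟩, ⟨u', s2', i2'⟩⟩ h
      simp only [ε, Prod.mk.injEq] at h
      obtain ⟨⟨rfl, rfl, rfl⟩, h1, h2⟩ := h
      obtain ⟨rfl, rfl⟩ := (Prod.mk.inj ((Fin.appendEquiv m n).injective (a₁ := (s, s'))
        (a₂ := (s2, s2')) h1))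
      obtain ⟨rfl, rfl⟩ := append_inj h2
      rfl
    have hind' := hind.comp ε hε
    have hterm : ∀ a, a.elt * juxt D m n (b a) = (c a).sum fun p k => k •
        ((fun p : (ShufPerm D m n × T × U) × (Fin (m + n) → ℕ) × (Fin (m + n) → I) =>
          shufFamily f g p.1 * yMon D p.2.1 * e D p.2.2) ∘ ε) (a, p) := by
      intro a
      rw [← hc, Finsupp.linearCombination_apply, Finsupp.sum, map_sum, Finset.mul_sum]
      refine Finset.sum_congr rfl fun p _ => ?_
      simp only [Function.comp_apply, shufFamily, ε]
      rw [map_smul, mul_smul_comm, juxt_mul_yMon_mul_e, mul_assoc, mul_assoc, mul_assoc]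
    simp only [hterm] at hb
    have hz : ∀ a p, c a p = 0 := by
      -- The coefficients for all shuffles, assembled into one finitely supported function, so that
      -- independence applies to the total sum.
      let C : (ShufPerm D m n × ((T × (Fin m → ℕ) × (Fin m → I)) ×
        (U × (Fin n → ℕ) × (Fin n → I)))) →₀ K :=
        Finsupp.curryEquiv.symm (Finsupp.equivFunOnFinite.symm c)
      have hC : ∀ a p, C (a, p) = c a p := fun a p => rfl
      have h0 : C = 0 := by
        refine (linearIndependent_iff.1 hind') C ?_
        rw [← hb, Finsupp.linearCombination_apply]
        refine (Finsupp.sum_curry_index C (fun a p k => k •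
          ((fun p : (ShufPerm D m n × T × U) × (Fin (m + n) → ℕ) × (Fin (m + n) → I) =>
          shufFamily f g p.1 * yMon D p.2.1 * e D p.2.2) ∘ ε) (a, p))).symm.trans ?_
        rw [Finsupp.sum_fintype _ _ (by simp)]
        refine Finset.sum_congr rfl fun a _ => ?_
        rw [show C.curry a = c a from Finsupp.ext (hC a)]
      intro a p
      rw [← hC, h0]; rfl
    ext a
    rw [← hc, show c a = 0 from Finsupp.ext (hz a), map_zero]
    rfl
  · intro r
    induction mem_span_shufPerm r using Submodule.span_induction with
    | mem r hr =>
      obtain ⟨⟨a, t⟩, rfl⟩ := hr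
      refine ⟨Pi.single a t, ?_⟩
      simp only
      rw [Finset.sum_eq_single a]
      · rw [Pi.single_eq_same]
      · intro b _ hb
        rw [Pi.single_eq_of_ne hb, map_zero, mul_zero]
      · simp
    | zero => exact ⟨0, by simp⟩
    | add r r' _ _ h h' =>
      obtain ⟨b, rfl⟩ := h
      obtain ⟨b', rfl⟩ := h'
      exact ⟨b + b', by simp [mul_add, Finset.sum_add_distrib]⟩
    | smul k r _ h =>
      obtain ⟨b, rfl⟩ := h
      exact ⟨k • b, by simp [Finset.smul_sum]⟩

end Shuffles

end Alg
end KLR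

/-! ### Absolute simplicity of simple modules with nilpotent dots -/

namespace KLR

theorem exists_simple_le {K A V : Type*} [Field K] [Ring A] [Algebra K A] [AddCommGroup V]
    [Module K V] [Module A V] [IsScalarTower K A V] [FiniteDimensional K V] (W : Submodule A V)
    (hW : W ≠ ⊥) : ∃ N ≤ W, IsSimpleModule A N := by
  have : IsArtinian A V := isArtinian_of_tower K inferInstance
  obtain ⟨N, hN, hle⟩ := (eq_bot_or_exists_atom_le W).resolve_left hW
  exact ⟨N, hle, isSimpleModule_iff_isAtom.2 hN⟩

theorem exists_smul_eq {A V : Type*} [Ring A] [AddCommGroup V] [Module A V] [IsSimpleModule A V]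
    {v : V} (hv : v ≠ 0) (w : V) : ∃ a : A, a • v = w :=
  IsSimpleModule.toSpanSingleton_surjective A hv w

namespace Alg

variable {I K : Type u} [Fintype I] [Field K] {D : Params I K} {m n : ℕ}

theorem exists_eq_algebraMap (r : Alg D 0) : ∃ c : K, r = algebraMap K _ c := by
  induction r using Alg.induction with
  | he i =>
    refine ⟨1, ?_⟩
    rw [map_one, ← sum_e, Fintype.sum_unique, Subsingleton.elim i]
  | hy k => exact k.elim0
  | hpsi k h => omega
  | hc c => exact ⟨c, rfl⟩
  | hadd a b ha hb =>
    obtain ⟨c, rfl⟩ := ha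
    obtain ⟨d, rfl⟩ := hb
    exact ⟨c + d, (map_add _ _ _).symm⟩
  | hmul a b ha hb =>
    obtain ⟨c, rfl⟩ := ha
    obtain ⟨d, rfl⟩ := hb
    exact ⟨c * d, (map_mul _ _ _).symm⟩

/-- A single left strand must first cross its neighbour by `psi 0`. It never returns to position
`0`, so all later crossings come from the right block. -/
theorem Shuf.eq_one_or_eq_mul_psi {x : Alg D (1 + n)} {a : Equiv.Perm (Fin (1 + n))} {l : ℕ}
    (hx : Shuf D 1 (1 + n) l x a) :
    (x = 1 ∧ a = 1) ∨ ∃ (h : 0 + 1 < 1 + n) (g : Alg D n), x = inclRight D 1 n g * psi D 0 h := by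
  induction hx with
  | one => exact Or.inl ⟨rfl, rfl⟩
  | @step l x a k h hx hl hr ih =>
    right
    cases k with
    | zero =>
      rcases hx.eq_one_or with ⟨rfl, rfl⟩ | ⟨q, hq, hq'⟩
      · exact ⟨h, 1, by rw [map_one, one_mul, mul_one]⟩
      · obtain rfl : q = ⟨0, Nat.lt_of_succ_lt h⟩ := Fin.ext (show (q : ℕ) = 0 by omega)
        omega
    | succ k =>
      rcases ih with ⟨rfl, rfl⟩ | ⟨h', g, rfl⟩
      · simp at hl
      · refine ⟨h', psi D k (by omega) * g, ?_⟩
        rw [map_mul, inclRight_psi, mul_assoc]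
        congr 2
        exact Nat.add_comm _ _

theorem exists_eq_append (w : Fin (m + n) → I) :
    ∃ (i : Fin m → I) (j : Fin n → I), w = Fin.append i j := by
  obtain ⟨⟨i, j⟩, rfl⟩ := (Fin.appendEquiv m n).surjective w
  exact ⟨i, j, rfl⟩

theorem append_one_zero (i : Fin 1 → I) (j : Fin n → I) (h : 0 < 1 + n) :
    Fin.append i j ⟨0, h⟩ = i 0 := Fin.append_left i j 0

theorem inclLeft_e_one_mul [DecidableEq I] (i : Fin 1 → I) (w : Fin (1 + n) → I) :
    inclLeft D 1 n (e D i) * e D w = if w ⟨0, by omega⟩ = i 0 then e D w else 0 := by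
  obtain ⟨i', j, rfl⟩ := exists_eq_append w
  rw [inclLeft_e_mul, append_one_zero]
  have : i = i' ↔ i' 0 = i 0 := by
    constructor
    · rintro rfl; rfl
    · intro h
      ext k
      rw [Subsingleton.elim k 0, h]
  by_cases h : i = i'
  · rw [if_pos h, if_pos (this.1 h), h]
  · rw [if_neg h, if_neg (fun h' => h (this.2 h'))]

theorem inclRight_e_mul [DecidableEq I] (j : Fin n → I) (i : Fin m → I) (j' : Fin n → I) :
    inclRight D m n (e D j) * e D (Fin.append i j') =
      if j = j' then e D (Fin.append i j) else 0 := by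
  rw [inclRight_e, Finset.sum_mul]
  split_ifs with h
  · subst h
    rw [Finset.sum_eq_single i, e_mul_self]
    · exact fun i' _ hi => e_mul_of_ne fun h => hi (append_inj h).1
    · simp
  · exact Finset.sum_eq_zero fun i' _ => e_mul_of_ne fun h' => h (append_inj h').2

open Classical in
/-- The sum of the idempotents of the words beginning with the letter `i`. -/
noncomputable def firstLetter (D : Params I K) (n : ℕ) (i : I) : Alg D n :=
  ∑ j ∈ Finset.univ.filter (fun j : Fin n → I => ∃ h : 0 < n, j ⟨0, h⟩ = i), e D j

open Classical in
theorem firstLetter_mul_e (i : I) (j : Fin n → I) :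
    firstLetter D n i * e D j = if ∃ h : 0 < n, j ⟨0, h⟩ = i then e D j else 0 := by
  rw [firstLetter, Finset.sum_mul]
  split_ifs with h
  · rw [Finset.sum_eq_single j, e_mul_self]
    · exact fun j' _ hj => e_mul_of_ne hj
    · simp [h]
  · refine Finset.sum_eq_zero fun j' hj' => e_mul_of_ne ?_
    rintro rfl
    exact h (Finset.mem_filter.1 hj').2

theorem inclRight_firstLetter_mul [DecidableEq I] (i : I) (h : 0 + 1 < 1 + n)
    (w : Fin (1 + n) → I) :
    inclRight D 1 n (firstLetter D n i) * e D w =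
      if w ⟨0 + 1, h⟩ = i then e D w else 0 := by
  classical
  obtain ⟨i', j, rfl⟩ := exists_eq_append w
  have h1 : Fin.append i' j ⟨0 + 1, h⟩ = j ⟨0, by omega⟩ := append_right_mk i' j 0 (by omega)
  rw [h1, firstLetter, map_sum, Finset.sum_mul]
  simp only [inclRight_e_mul]
  rw [Finset.sum_ite_eq']
  have h2 : 0 < n := by omega
  simp [h2]

/-- Schur's lemma with scalars in the given field, by splitting off the first strand. Let `E`
project to a first letter that occurs in `V`, let `Y` be the first dot, and let `N` be a simple
submodule, over the other strands, of the vectors fixed by `E` and killed by `Y`. For a suitable `t`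
the operator `Y ^ t * E` commutes with the other strands and maps `V` onto a nonzero part of `N`. An
endomorphism commutes with this operator, so it preserves `N`. There it is a scalar by induction,
hence also on `V`, which `N` generates. -/
theorem endomorphism_eq_smul (n : ℕ) : ∀ (V : Type u) [AddCommGroup V] [Module K V]
    [Module (Alg D n) V] [IsScalarTower K (Alg D n) V] [IsSimpleModule (Alg D n) V]
    [FiniteDimensional K V], (∀ k : Fin n, ∃ N : ℕ, ∀ x : V, y D k ^ N • x = 0) →
    ∀ φ : V →ₗ[Alg D n] V, ∃ c : K, ∀ x, φ x = c • x := by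
  classical
  induction n with
  | zero =>
    intro V _ _ _ _ _ _ _ φ
    have hnt := IsSimpleModule.nontrivial (Alg D 0) V
    obtain ⟨x, hx⟩ := exists_ne (0 : V)
    obtain ⟨r, hr⟩ := exists_smul_eq (A := Alg D 0) hx (φ x)
    obtain ⟨c, rfl⟩ := exists_eq_algebraMap r
    refine ⟨c, fun z => ?_⟩
    obtain ⟨s, rfl⟩ := exists_smul_eq (A := Alg D 0) hx z
    rw [map_smul, ← hr, algebraMap_smul, smul_comm]
  | succ n ih =>
    rw [Nat.add_comm]
    intro V _ _ _ _ hsimp _ hnil φ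
    let _ : Module (Alg D n) V := Module.compHom V (inclRight D 1 n).toRingHom
    have hR : ∀ (r : Alg D n) (x : V), r • x = inclRight D 1 n r • x := fun _ _ => rfl
    have _ : IsScalarTower K (Alg D n) V := ⟨fun c r x => by
      rw [hR, hR, map_smul, smul_assoc]⟩
    have hnt := IsSimpleModule.nontrivial (Alg D (1 + n)) V
    obtain ⟨w, x₀, hx₀⟩ : ∃ w : Fin (1 + n) → I, ∃ x : V, e D w • x ≠ 0 := by
      by_contra! h
      obtain ⟨x, hx⟩ := exists_ne (0 : V)
      apply hx
      rw [← one_smul (Alg D (1 + n)) x, ← sum_e, Finset.sum_smul]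
      exact Finset.sum_eq_zero fun w _ => h w x
    set i : Fin 1 → I := fun _ => w ⟨0, by omega⟩ with hi
    set E : Alg D (1 + n) := inclLeft D 1 n (e D i) with hE
    set Y : Alg D (1 + n) := inclLeft D 1 n (y D 0) with hY
    have hEcomm : ∀ r, E * inclRight D 1 n r = inclRight D 1 n r * E :=
      fun r => incl_commute 1 n _ _
    have hYcomm : ∀ r, Y * inclRight D 1 n r = inclRight D 1 n r * Y :=
      fun r => incl_commute 1 n _ _
    have hEY : E * Y = Y * E := by rw [hE, hY, ← map_mul, ← map_mul, y_mul_e]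
    have hEE : E * E = E := by rw [hE, ← map_mul, e_mul_self]
    let X : Submodule (Alg D n) V :=
      { carrier := {x | E • x = x ∧ Y • x = 0}
        add_mem' := fun {a b} ha hb => ⟨by rw [smul_add, ha.1, hb.1],
          by rw [smul_add, ha.2, hb.2, add_zero]⟩
        zero_mem' := ⟨smul_zero _, smul_zero _⟩
        smul_mem' := fun r x hx => ⟨by rw [hR, ← mul_smul, hEcomm, mul_smul, hx.1],
          by rw [hR, ← mul_smul, hYcomm, mul_smul, hx.2, smul_zero]⟩ }
    -- The last nonzero power of the nilpotent `Y` applied to a vector with first letter `i`.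
    have hX : X ≠ ⊥ := by
      have h1 : E • e D w • x₀ = e D w • x₀ := by
        rw [← mul_smul, inclLeft_e_one_mul, if_pos rfl]
      obtain ⟨N, hN⟩ := hnil (Fin.castAdd n 0)
      have hex : ∃ N : ℕ, Y ^ N • e D w • x₀ = 0 := ⟨N, by rw [hY, inclLeft_y]; exact hN _⟩
      have hpos : Nat.find hex ≠ 0 := fun h0 => hx₀ (by
        have := Nat.find_spec hex
        rwa [h0, pow_zero, one_smul] at this)
      obtain ⟨t, ht⟩ := Nat.exists_eq_succ_of_ne_zero hpos
      refine (Submodule.ne_bot_iff _).2 ⟨Y ^ t • e D w • x₀, ⟨?_, ?_⟩, ?_⟩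
      · rw [← mul_smul, (Commute.pow_right hEY t).eq, mul_smul, h1]
      · have := Nat.find_spec hex
        rwa [ht, Nat.succ_eq_add_one, pow_succ', mul_smul] at this
      · exact Nat.find_min hex (by omega)
    obtain ⟨N, hNX, hN⟩ := exists_simple_le (K := K) X hX
    have hNE : ∀ v ∈ N, E • v = v := fun v hv => (hNX hv).1
    have hNY : ∀ v ∈ N, Y • v = 0 := fun v hv => (hNX hv).2
    obtain ⟨v₀, hv₀N, hv₀⟩ := (Submodule.ne_bot_iff N).1
      (isSimpleModule_iff_isAtom.1 hN).1
    have hNK : ∀ (c : K), ∀ v ∈ N, c • v ∈ N := fun c v hv => by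
      rw [← algebraMap_smul (Alg D n)]
      exact N.smul_mem _ hv
    -- `N` is stable under the whole parabolic subalgebra
    have hNleft : ∀ a : Alg D 1, ∀ v ∈ N, inclLeft D 1 n a • v ∈ N := by
      intro a
      induction a using Alg.induction with
      | he i' =>
        intro v hv
        by_cases h : i' = i
        · rw [h, hNE v hv]; exact hv
        · rw [← hNE v hv, ← mul_smul, hE, ← map_mul, e_mul_of_ne h, map_zero, zero_smul]
          exact zero_mem _
      | hy k => intro v hv; rw [Subsingleton.elim k 0, hNY v hv]; exact zero_mem _
      | hpsi k h => omega
      | hc c => intro v hv; rw [AlgHom.commutes, algebraMap_smul]; exact hNK c v hv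
      | hadd a b ha hb => intro v hv; rw [map_add, add_smul]; exact add_mem (ha v hv) (hb v hv)
      | hmul a b ha hb => intro v hv; rw [map_mul, mul_smul]; exact ha _ (hb v hv)
    have hNjuxt : ∀ b ∈ (juxt D 1 n).range, ∀ v ∈ N, b • v ∈ N := by
      rintro _ ⟨b, rfl⟩ v hv
      change juxt D 1 n b • v ∈ N
      induction b using TensorProduct.induction_on with
      | zero => rw [map_zero, zero_smul]; exact zero_mem _
      | tmul a b =>
        rw [juxt_tmul, mul_smul]
        exact hNleft a _ (N.smul_mem b hv)
      | add a b ha hb => rw [map_add, add_smul]; exact add_mem ha hb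
    -- `N` is stable under `R_1 ⊗ R_n`, so only shuffles are needed to generate `V` from it.
    have hspan : ∀ z : V, z ∈ Submodule.span K
        {z | ∃ l x a v, Shuf D 1 (1 + n) l x a ∧ v ∈ N ∧ z = x • v} := by
      intro z
      obtain ⟨r, rfl⟩ := exists_smul_eq (A := Alg D (1 + n)) hv₀ z
      obtain ⟨l, hl⟩ := exists_mem_shufSpan r
      induction hl using Submodule.span_induction with
      | mem r hr =>
        obtain ⟨j, x, a, b, -, hx, hb, rfl⟩ := hr
        refine Submodule.subset_span ⟨j, x, a, b • v₀, hx, hNjuxt b hb _ hv₀N, mul_smul _ _ _⟩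
      | zero => rw [zero_smul]; exact zero_mem _
      | add r s _ _ hr hs => rw [add_smul]; exact add_mem hr hs
      | smul c r _ hr => rw [smul_assoc]; exact Submodule.smul_mem _ _ hr
    -- `F` selects the words of `N` that begin with the letter `i` once more, and `Y1` is the first
    -- dot of the right block. For `n = 0` there is no such dot and `0` stands in its place.
    let F : Alg D n := firstLetter D n (w ⟨0, by omega⟩)
    let Y1 : Alg D n := if h : 0 < n then y D ⟨0, h⟩ else 0
    have hFF : F * F = F := by
      refine eq_of_mul_e fun j => ?_
      simp only [F, mul_assoc, firstLetter_mul_e]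
      split_ifs with h
      · rw [firstLetter_mul_e, if_pos h]
      · rw [mul_zero]
    have hYF : Y1 * F = F * Y1 := by
      simp only [Y1]
      split_ifs
      · simp only [F, firstLetter, Finset.mul_sum, Finset.sum_mul, y_mul_e]
      · rw [zero_mul, mul_zero]
    have hex : ∃ t : ℕ, ∀ v ∈ N, Y1 ^ t • F • v = 0 := by
      by_cases h : 0 < n
      · obtain ⟨t, ht⟩ := hnil (Fin.natAdd 1 ⟨0, h⟩)
        refine ⟨t, fun v hv => ?_⟩
        simp only [Y1]
        rw [dif_pos h, hR, map_pow, inclRight_y]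
        exact ht _
      · refine ⟨0, fun v hv => ?_⟩
        simp [F, firstLetter, h]
    have hpsiE : ∀ (h : 0 + 1 < 1 + n) v, v ∈ N → E • psi D 0 h • v = psi D 0 h • F • v := by
      intro h v hv
      have key : E * psi D 0 h * E = psi D 0 h * inclRight D 1 n F * E := by
        refine eq_of_mul_e fun w' => ?_
        rw [mul_assoc, mul_assoc, mul_assoc (psi D 0 h), mul_assoc (psi D 0 h), mul_assoc,
          hE, inclLeft_e_one_mul]
        split_ifs with h1
        · rw [psi_mul_e, ← mul_assoc, inclLeft_e_one_mul, inclRight_firstLetter_mul _ h]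
          have h2 : swapWord 0 h w' ⟨0, by omega⟩ = w' ⟨0 + 1, h⟩ := by simp [swapWord]
          rw [h2]
          split_ifs
          · rw [psi_mul_e]
          · rw [zero_mul, mul_zero]
        · rw [mul_zero, mul_zero, mul_zero, mul_zero]
      have := congrArg (· • v) key
      simp only [mul_smul, hNE v hv] at this
      exact this
    have hpsiY : ∀ (h : 0 + 1 < 1 + n) v, v ∈ N → F • v = v →
        Y • psi D 0 h • v = psi D 0 h • Y1 • v + v := by
      intro h v hv hFv
      have key : Y * psi D 0 h * (inclRight D 1 n F * E) =
          (psi D 0 h * inclRight D 1 n Y1 + 1) * (inclRight D 1 n F * E) := by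
        refine eq_of_mul_e fun w' => ?_
        rw [mul_assoc, mul_assoc (_ + _), mul_assoc (inclRight D 1 n F), hE, inclLeft_e_one_mul]
        split_ifs with h1
        · rw [inclRight_firstLetter_mul _ h]
          split_ifs with h2
          · have h3 : Y = y D ⟨0, by omega⟩ := inclLeft_y 0
            have h4 : inclRight D 1 n Y1 = y D ⟨0 + 1, h⟩ := by
              simp only [Y1]
              rw [dif_pos (by omega), inclRight_y]
              rfl
            rw [h3, h4, add_mul, one_mul]
            exact rel_eq (.dot_left_eq 0 h w' (h1.trans h2.symm))
          · rw [mul_zero, mul_zero]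
        · rw [mul_zero, mul_zero, mul_zero]
      have := congrArg (· • v) key
      simp only [mul_smul, hNE v hv, add_smul, one_smul] at this
      simp only [← hR, hFv] at this
      exact this
    -- Moving `Y ^ (t + 1)` through a crossing of equal letters produces the sum of all `Y ^ r * Y1
    -- ^ (t - r)`. As `Y` kills `N`, only `r = 0` remains.
    have hpow : ∀ (h : 0 + 1 < 1 + n) v, v ∈ N → F • v = v → ∀ t : ℕ,
        Y ^ (t + 1) • psi D 0 h • v = psi D 0 h • Y1 ^ (t + 1) • v + Y1 ^ t • v := by
      intro h v hv hFv t
      induction t with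
      | zero => simpa using hpsiY h v hv hFv
      | succ t iht =>
        rw [pow_succ', mul_smul, iht, smul_add, hpsiY h _ (N.smul_mem _ hv), hNY _ (N.smul_mem _ hv),
          add_zero, ← mul_smul Y1, ← pow_succ']
        rw [← mul_smul, ← (Commute.pow_left hYF (t + 1)).eq, mul_smul, hFv]
    -- The least power of `Y1` that kills `F • N`. If `t > 0`, then `Y ^ t` kills `N` itself and
    -- takes `psi 0 • F • v` to `Y1 ^ (t - 1) • F • v`, which lies in `N` and is nonzero for some
    -- `v`. If `t = 0`, then `E` alone kills the terms with a crossing and fixes `N`.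
    obtain ⟨t, ht, hmin⟩ : ∃ t : ℕ, (∀ v ∈ N, Y1 ^ t • F • v = 0) ∧
        ∀ s < t, ¬ ∀ v ∈ N, Y1 ^ s • F • v = 0 :=
      ⟨Nat.find hex, Nat.find_spec hex, fun s hs => Nat.find_min hex hs⟩
    have hmem : ∀ z : V, Y ^ t • E • z ∈ N := by
      intro z
      induction hspan z using Submodule.span_induction with
      | mem z hz =>
        obtain ⟨l, x, a, v, hx, hv, rfl⟩ := hz
        rcases hx.eq_one_or_eq_mul_psi with ⟨rfl, -⟩ | ⟨h, g, rfl⟩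
        · rw [one_smul, hNE v hv]
          cases t with
          | zero => simpa using hv
          | succ t => rw [pow_succ, mul_smul, hNY v hv, smul_zero]; exact zero_mem _
        · have h1 : Y ^ t • E • (inclRight D 1 n g * psi D 0 h) • v =
              g • Y ^ t • psi D 0 h • F • v := by
            rw [mul_smul, ← mul_smul E, hEcomm, mul_smul, hpsiE h v hv, ← mul_smul (Y ^ t),
              (Commute.pow_left (hYcomm g) t).eq, mul_smul]
            rfl
          rw [h1]
          refine N.smul_mem _ ?_
          have hFv : F • F • v = F • v := by rw [← mul_smul, hFF]
          have ht' := ht v hv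
          cases t with
          | zero =>
            rw [pow_zero, one_smul] at ht'
            rw [ht', smul_zero, smul_zero]
            exact zero_mem _
          | succ t =>
            rw [hpow h _ (N.smul_mem _ hv) hFv, ht', smul_zero, zero_add]
            exact N.smul_mem _ (N.smul_mem _ hv)
      | zero => rw [smul_zero, smul_zero]; exact zero_mem _
      | add x y _ _ hx hy => rw [smul_add, smul_add]; exact add_mem hx hy
      | smul c x _ hx => rw [smul_comm E, smul_comm (Y ^ t)]; exact hNK c _ hx
    obtain ⟨z, hz⟩ : ∃ z : V, Y ^ t • E • z ≠ 0 := by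
      rcases Nat.eq_zero_or_pos t with h0 | hpos
      · exact ⟨v₀, by rwa [h0, pow_zero, one_smul, hNE _ hv₀N]⟩
      · have hmin := hmin (t - 1) (by omega)
        push Not at hmin
        obtain ⟨v, hv, hv'⟩ := hmin
        have hn : 0 < n := by
          by_contra h
          refine hv' ?_
          rw [show F • v = 0 by simp [F, firstLetter, h], smul_zero]
        have h : 0 + 1 < 1 + n := by omega
        refine ⟨psi D 0 h • F • v, ?_⟩
        have hFv : F • F • v = F • v := by rw [← mul_smul, hFF]
        rw [hpsiE h _ (N.smul_mem _ hv), hFv]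
        obtain ⟨s, hs⟩ := Nat.exists_eq_add_of_lt hpos
        rw [zero_add] at hs
        rw [hs, hpow h _ (N.smul_mem _ hv) hFv, ← hs, ht v hv, smul_zero, zero_add]
        rwa [show t - 1 = s by omega] at hv'
    -- By simplicity of `N` each of its vectors is `g • Y ^ t • E • z` with `g` from the right
    -- block, and `φ` commutes with all of these factors.
    have hφ : ∀ v ∈ N, φ v ∈ N := by
      intro v hv
      obtain ⟨g, hg⟩ := exists_smul_eq (A := Alg D n) (V := N)
        (v := ⟨_, hmem z⟩) (fun h => hz (congrArg Subtype.val h)) ⟨v, hv⟩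
      have hg' : g • Y ^ t • E • z = v := congrArg Subtype.val hg
      rw [← hg', hR, map_smul, map_smul, map_smul, ← hR]
      exact N.smul_mem _ (hmem _)
    let φN : N →ₗ[Alg D n] N :=
      { toFun := fun v => ⟨φ v, hφ v v.2⟩
        map_add' := fun a b => Subtype.ext (map_add φ _ _)
        map_smul' := fun r a => Subtype.ext (map_smul φ (inclRight D 1 n r) _) }
    have : FiniteDimensional K N :=
      inferInstanceAs (FiniteDimensional K (N.restrictScalars K))
    obtain ⟨c, hc⟩ := ih N (fun k => by
      obtain ⟨M, hM⟩ := hnil (Fin.natAdd 1 k)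
      refine ⟨M, fun x => Subtype.ext ?_⟩
      change inclRight D 1 n (y D k ^ M) • (x : V) = 0
      rw [map_pow, inclRight_y]
      exact hM _) φN
    refine ⟨c, fun z => ?_⟩
    obtain ⟨r, rfl⟩ := exists_smul_eq (A := Alg D (1 + n)) hv₀ z
    have h0 : φ v₀ = c • v₀ := congrArg Subtype.val (hc ⟨v₀, hv₀N⟩)
    rw [map_smul, h0, smul_comm]

/-- A simple finite-dimensional module on which the dots are nilpotent is absolutely simple: every
linear endomorphism is the action of an element of the algebra. -/
theorem exists_smul_eq_linearMap {V : Type u} [AddCommGroup V] [Module K V]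
    [Module (Alg D n) V] [IsScalarTower K (Alg D n) V] [IsSimpleModule (Alg D n) V]
    [FiniteDimensional K V] (hnil : ∀ k : Fin n, ∃ N : ℕ, ∀ x : V, y D k ^ N • x = 0)
    (T : V →ₗ[K] V) : ∃ a : Alg D n, ∀ x, a • x = T x := by
  have hend := endomorphism_eq_smul n V hnil
  -- As all module endomorphisms are scalars, every `K`-linear map commutes with them, and the
  -- density theorem applies to it.
  let f : Module.End (Module.End (Alg D n) V) V :=
    { toFun := T
      map_add' := map_add T
      map_smul' := fun φ x => by
        obtain ⟨c, hc⟩ := hend φ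
        rw [Module.End.smul_def, hc, map_smul, RingHom.id_apply, Module.End.smul_def, hc] }
  obtain ⟨s, hs⟩ := (Module.finite_def (R := K) (M := V)).1 inferInstance
  obtain ⟨a, ha⟩ := jacobson_density f s
  refine ⟨a, fun x => ?_⟩
  have hx : x ∈ Submodule.span K (s : Set V) := by rw [hs]; trivial
  induction hx using Submodule.span_induction with
  | mem x hx => exact (ha x hx).symm
  | zero => rw [smul_zero, map_zero]
  | add x y _ _ hx hy => rw [smul_add, map_add, hx, hy]
  | smul c x _ hx => rw [smul_comm, map_smul, hx]

end Alg
end KLR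

/-! ### The induction product and Frobenius reciprocity -/

namespace KLR

variable {I K : Type u} [Fintype I] [Field K]

/-- The induction product of modules over the KLR algebras on `m` and `n` strands. -/
def Ind (D : Params I K) (m n : ℕ) (V W : Type u) [AddCommGroup V] [Module K V]
    [Module (Alg D m) V] [IsScalarTower K (Alg D m) V] [AddCommGroup W] [Module K W]
    [Module (Alg D n) W] [IsScalarTower K (Alg D n) W] : Type u :=
  (Rep.ind (Rep.mk m V : Rep D) (Rep.mk n W : Rep D)).V

namespace Ind

variable (D : Params I K) (m n : ℕ) {V W : Type u} [AddCommGroup V] [Module K V]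
  [Module (Alg D m) V] [IsScalarTower K (Alg D m) V] [AddCommGroup W] [Module K W]
  [Module (Alg D n) W] [IsScalarTower K (Alg D n) W]

noncomputable instance : AddCommGroup (Ind D m n V W) :=
  (Rep.ind (Rep.mk m V : Rep D) (Rep.mk n W : Rep D)).addCommGroup

noncomputable instance : Module K (Ind D m n V W) :=
  (Rep.ind (Rep.mk m V : Rep D) (Rep.mk n W : Rep D)).moduleK

noncomputable instance : Module (Alg D (m + n)) (Ind D m n V W) :=
  (Rep.ind (Rep.mk m V : Rep D) (Rep.mk n W : Rep D)).moduleAlg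

instance : IsScalarTower K (Alg D (m + n)) (Ind D m n V W) :=
  (Rep.ind (Rep.mk m V : Rep D) (Rep.mk n W : Rep D)).isScalarTower

variable (V W) in
/-- The quotient map defining the induction product. -/
noncomputable def proj : Alg D (m + n) ⊗[K] (V ⊗[K] W) →ₗ[Alg D (m + n)] Ind D m n V W :=
  (Rep.indRel (Rep.mk m V : Rep D) (Rep.mk n W : Rep D)).mkQ

theorem proj_surjective : Function.Surjective (proj D m n V W) :=
  Submodule.mkQ_surjective _

/-- The image of `1 ⊗ (v ⊗ w)` in the induction product. -/
noncomputable def tmul : V →ₗ[K] W →ₗ[K] Ind D m n V W :=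
  TensorProduct.curry (((proj D m n V W).restrictScalars K).comp
    (TensorProduct.mk K (Alg D (m + n)) (V ⊗[K] W) 1))

theorem proj_tmul (r : Alg D (m + n)) (v : V) (w : W) :
    proj D m n V W (r ⊗ₜ (v ⊗ₜ w)) = r • tmul D m n v w := by
  change _ = r • proj D m n V W ((1 : Alg D (m + n)) ⊗ₜ[K] (v ⊗ₜ[K] w))
  rw [← map_smul, TensorProduct.smul_tmul', smul_eq_mul, mul_one]

variable {m n}

theorem proj_eq_zero_iff (z : Alg D (m + n) ⊗[K] (V ⊗[K] W)) : proj D m n V W z = 0 ↔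
    z ∈ Rep.indRel (Rep.mk m V : Rep D) (Rep.mk n W : Rep D) :=
  Submodule.Quotient.mk_eq_zero _

theorem juxt_smul_tmul (a : Alg D m) (b : Alg D n) (v : V) (w : W) :
    Alg.juxt D m n (a ⊗ₜ b) • tmul D m n v w = tmul D m n (a • v) (b • w) := by
  have h : proj D m n V W ((1 * Alg.juxt D m n (a ⊗ₜ b)) ⊗ₜ[K] (v ⊗ₜ[K] w) -
      1 ⊗ₜ[K] ((a • v) ⊗ₜ[K] (b • w))) = 0 :=
    (proj_eq_zero_iff D _).2 (Submodule.subset_span ⟨1, a, b, v, w, rfl⟩)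
  rw [map_sub, sub_eq_zero, proj_tmul, proj_tmul, one_mul, one_smul] at h
  exact h

theorem inclLeft_smul_tmul (a : Alg D m) (v : V) (w : W) :
    Alg.inclLeft D m n a • tmul D m n v w = tmul D m n (a • v) w := by
  have := juxt_smul_tmul D a (1 : Alg D n) v w
  rwa [Alg.juxt_tmul, map_one, mul_one, one_smul] at this

theorem inclRight_smul_tmul (b : Alg D n) (v : V) (w : W) :
    Alg.inclRight D m n b • tmul D m n v w = tmul D m n v (b • w) := by
  have := juxt_smul_tmul D (1 : Alg D m) b v w
  rwa [Alg.juxt_tmul, map_one, one_mul, one_smul] at this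

/-- The induction product is additively generated by the `r • tmul v w`. -/
theorem induction_smul {p : Ind D m n V W → Prop} (z : Ind D m n V W)
    (hmul : ∀ (r : Alg D (m + n)) v w, p (r • tmul D m n v w)) (h0 : p 0)
    (hadd : ∀ x y, p x → p y → p (x + y)) : p z := by
  obtain ⟨z, rfl⟩ := proj_surjective D m n z
  induction z using TensorProduct.induction_on with
  | zero => rwa [map_zero]
  | add x y hx hy => rw [map_add]; exact hadd _ _ hx hy
  | tmul r t =>
    induction t using TensorProduct.induction_on with
    | zero => rwa [TensorProduct.tmul_zero, map_zero]
    | add x y hx hy => rw [TensorProduct.tmul_add, map_add]; exact hadd _ _ hx hy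
    | tmul v w => rw [proj_tmul]; exact hmul r v w

/-- Frobenius reciprocity. -/
theorem exists_lift {Z : Type*} [AddCommGroup Z] [Module K Z] [Module (Alg D (m + n)) Z]
    [IsScalarTower K (Alg D (m + n)) Z] (f : V →ₗ[K] W →ₗ[K] Z)
    (hf : ∀ (a : Alg D m) (b : Alg D n) v w,
      f (a • v) (b • w) = Alg.inclLeft D m n a • Alg.inclRight D m n b • f v w) :
    ∃ F : Ind D m n V W →ₗ[Alg D (m + n)] Z, ∀ v w, F (tmul D m n v w) = f v w := by
  let G : Alg D (m + n) ⊗[K] (V ⊗[K] W) →ₗ[Alg D (m + n)] Z :=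
    TensorProduct.AlgebraTensorModule.lift
      (LinearMap.toSpanSingleton (Alg D (m + n)) (V ⊗[K] W →ₗ[K] Z) (TensorProduct.lift f))
  have hG : ∀ r v w, G (r ⊗ₜ (v ⊗ₜ w)) = r • f v w := fun r v w => rfl
  refine ⟨(Rep.indRel (Rep.mk m V : Rep D) (Rep.mk n W : Rep D)).liftQ G ?_, fun v w => ?_⟩
  · refine Submodule.span_le.2 ?_
    rintro _ ⟨r, a, b, v, w, rfl⟩
    rw [SetLike.mem_coe, LinearMap.mem_ker, map_sub, sub_eq_zero]
    refine (hG _ _ _).trans (Eq.trans ?_ (hG r (a • v) (b • w)).symm)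
    rw [hf, mul_smul, Alg.juxt_tmul, mul_smul]
  · exact (hG 1 v w).trans (one_smul _ _)

theorem mem_span_shuf (z : Ind D m n V W) : z ∈ Submodule.span K
    {z | ∃ l x a v w, Alg.Shuf D m (m + n) l x a ∧ z = x • tmul D m n v w} := by
  induction z using induction_smul D with
  | h0 => exact zero_mem _
  | hadd x y hx hy => exact add_mem hx hy
  | hmul r v w =>
    obtain ⟨l, hl⟩ := Alg.exists_mem_shufSpan r
    induction hl using Submodule.span_induction with
    | mem r hr =>
      obtain ⟨j, x, a, b, -, hx, ⟨b, rfl⟩, rfl⟩ := hr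
      change (x * Alg.juxt D m n b) • _ ∈ _
      induction b using TensorProduct.induction_on with
      | zero => rw [map_zero, mul_zero, zero_smul]; exact zero_mem _
      | tmul b b' =>
        rw [mul_smul, juxt_smul_tmul]
        exact Submodule.subset_span ⟨j, x, a, _, _, hx, rfl⟩
      | add b b' hb hb' => rw [map_add, mul_add, add_smul]; exact add_mem hb hb'
    | zero => rw [zero_smul]; exact zero_mem _
    | add r s _ _ hr hs => rw [add_smul]; exact add_mem hr hs
    | smul c r _ hr => rw [smul_assoc]; exact Submodule.smul_mem _ _ hr

theorem e_append_smul_tmul (i : Fin m → I) (j : Fin n → I) (v : V) (w : W) :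
    Alg.e D (Fin.append i j) • tmul D m n v w = tmul D m n (Alg.e D i • v) (Alg.e D j • w) := by
  rw [← Alg.juxt_e, juxt_smul_tmul]

end Ind
end KLR

/-! ### Words, nilpotency, finiteness and nonvanishing of induction products -/

namespace KLR

variable {I K : Type u} [Fintype I] [Field K]

/-- The word `k` occurs in the character of the module. -/
def HasWord (D : Params I K) {n : ℕ} (V : Type u) [AddCommGroup V] [Module (Alg D n) V]
    (k : Fin n → I) : Prop :=
  ∃ x : V, Alg.e D k • x ≠ 0

/-- The dots act nilpotently. -/
def DotsNilpotent (D : Params I K) (n : ℕ) (V : Type u) [AddCommGroup V]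
    [Module (Alg D n) V] : Prop :=
  ∀ k : Fin n, ∃ N : ℕ, ∀ x : V, Alg.y D k ^ N • x = 0

theorem exists_hasWord (D : Params I K) (n : ℕ) {V : Type u} [AddCommGroup V]
    [Module (Alg D n) V] {x : V} (hx : x ≠ 0) : ∃ k : Fin n → I, Alg.e D k • x ≠ 0 := by
  by_contra! h
  apply hx
  rw [← one_smul (Alg D n) x, ← Alg.sum_e, Finset.sum_smul]
  exact Finset.sum_eq_zero fun k _ => h k

/-- The elements killed by a power of `r`. -/
def locallyNilpotent {A V : Type*} (K : Type*) [Field K] [Ring A] [Algebra K A] [AddCommGroup V]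
    [Module K V] [Module A V] [IsScalarTower K A V] (r : A) : Submodule K V where
  carrier := {x | ∃ N : ℕ, r ^ N • x = 0}
  zero_mem' := ⟨0, smul_zero _⟩
  add_mem' := by
    rintro x y ⟨N, hN⟩ ⟨M, hM⟩
    refine ⟨N + M, ?_⟩
    rw [smul_add, pow_add, mul_smul _ _ y, hM, smul_zero, add_zero, ← pow_add, add_comm, pow_add,
      mul_smul, hN, smul_zero]
  smul_mem' := by
    rintro c x ⟨N, hN⟩
    exact ⟨N, by rw [smul_comm, hN, smul_zero]⟩

theorem exists_pow_smul_eq_zero {A V : Type*} {K : Type*} [Field K] [Ring A] [Algebra K A]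
    [AddCommGroup V] [Module K V] [Module A V] [IsScalarTower K A V] [FiniteDimensional K V] {r : A}
    (h : ∀ x : V, x ∈ locallyNilpotent K r) : ∃ N : ℕ, ∀ x : V, r ^ N • x = 0 := by
  obtain ⟨s, hs⟩ := (Module.finite_def (R := K) (M := V)).1 inferInstance
  choose N hN using h
  refine ⟨s.sup N, fun x => ?_⟩
  have hx : x ∈ Submodule.span K (s : Set V) := by rw [hs]; trivial
  induction hx using Submodule.span_induction with
  | mem x hx =>
    obtain ⟨d, hd⟩ := Nat.exists_eq_add_of_le (Finset.le_sup (f := N) hx)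
    rw [hd, add_comm, pow_add, mul_smul, hN, smul_zero]
  | zero => rw [smul_zero]
  | add x y _ _ hx hy => rw [smul_add, hx, hy, add_zero]
  | smul c x _ hx => rw [smul_comm, hx, smul_zero]

namespace Ind

variable (D : Params I K) {m n : ℕ} {V W : Type u} [AddCommGroup V] [Module K V]
  [Module (Alg D m) V] [IsScalarTower K (Alg D m) V] [AddCommGroup W] [Module K W]
  [Module (Alg D n) W] [IsScalarTower K (Alg D n) W]

theorem e_smul_smul_tmul {l : ℕ} {x : Alg D (m + n)} {a} (hx : Alg.Shuf D m (m + n) l x a)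
    (k : Fin (m + n) → I) (v : V) (w : W) : ∃ i j, k = Fin.append i j ∘ a ∧
      Alg.e D k • x • tmul D m n v w = x • tmul D m n (Alg.e D i • v) (Alg.e D j • w) := by
  obtain ⟨i, j, hij⟩ := Alg.exists_eq_append (k ∘ a.symm)
  refine ⟨i, j, ?_, ?_⟩
  · rw [← hij, Function.comp_assoc, Equiv.symm_comp_self, Function.comp_id]
  · rw [← mul_smul, hx.e_mul, hij, mul_smul, e_append_smul_tmul]

/-- The words of an induction product are shuffles. -/
theorem exists_eq_append_comp_of_hasWord {k : Fin (m + n) → I} (hk : HasWord D (Ind D m n V W) k) :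
    ∃ l x a i j, Alg.Shuf D m (m + n) l x a ∧ HasWord D V i ∧ HasWord D W j ∧
      k = Fin.append i j ∘ a := by
  obtain ⟨z, hz⟩ := hk
  by_contra! h
  apply hz
  clear hz
  induction mem_span_shuf D z using Submodule.span_induction with
  | mem z hz =>
    obtain ⟨l, x, a, v, w, hx, rfl⟩ := hz
    obtain ⟨i, j, hk, he⟩ := e_smul_smul_tmul D hx k v w
    rw [he]
    by_cases hv : Alg.e D i • v = 0
    · rw [hv, map_zero, LinearMap.zero_apply, smul_zero]
    by_cases hw : Alg.e D j • w = 0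
    · rw [hw, map_zero, smul_zero]
    exact absurd hk (h l x a i j hx ⟨v, hv⟩ ⟨w, hw⟩)
  | zero => rw [smul_zero]
  | add x y _ _ hx hy => rw [smul_add, hx, hy, add_zero]
  | smul c x _ hx => rw [smul_comm, hx, smul_zero]

theorem smul_tmul_mem_of_mem_shufSpan {X : Submodule K (Ind D m n V W)} {l : ℕ}
    (hX : ∀ j x a, j < l → Alg.Shuf D m (m + n) j x a → ∀ v w, x • tmul D m n v w ∈ X)
    {r : Alg D (m + n)} (hr : r ∈ Alg.shufSpan D m n l) (v : V) (w : W) :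
    r • tmul D m n v w ∈ X := by
  induction hr using Submodule.span_induction with
  | mem r hr =>
    obtain ⟨j, x, a, b, hj, hx, ⟨b, rfl⟩, rfl⟩ := hr
    change (x * Alg.juxt D m n b) • _ ∈ _
    induction b using TensorProduct.induction_on with
    | zero => rw [map_zero, mul_zero, zero_smul]; exact zero_mem _
    | tmul b b' =>
      rw [mul_smul, juxt_smul_tmul]
      exact hX j x a hj hx _ _
    | add b b' hb hb' => rw [map_add, mul_add, add_smul]; exact add_mem hb hb'
  | zero => rw [zero_smul]; exact zero_mem _
  | add r s _ _ hr hs => rw [add_smul]; exact add_mem hr hs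
  | smul c r _ hr => rw [smul_assoc]; exact Submodule.smul_mem _ _ hr

/-- A dot touches only one factor of a pure tensor, so its powers run through pure tensors until
they vanish. The sequence `f` treats the two blocks uniformly. -/
theorem exists_y_smul_tmul (hV : DotsNilpotent D m V) (hW : DotsNilpotent D n W)
    (q : Fin (m + n)) (v : V) (w : W) :
    ∃ s : ℕ, ∃ f : ℕ → V × W, f 0 = (v, w) ∧ tmul D m n (f s).1 (f s).2 = 0 ∧
      ∀ t, Alg.y D q • tmul D m n (f t).1 (f t).2 = tmul D m n (f (t + 1)).1 (f (t + 1)).2 := by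
  refine Fin.addCases (fun q => ?_) (fun q => ?_) q
  · obtain ⟨s, hs⟩ := hV q
    refine ⟨s, fun t => (Alg.y D q ^ t • v, w), ?_, ?_, fun t => ?_⟩
    · simp
    · simp only [hs, map_zero, LinearMap.zero_apply]
    · rw [← Alg.inclLeft_y, inclLeft_smul_tmul, ← mul_smul, ← pow_succ']
  · obtain ⟨s, hs⟩ := hW q
    refine ⟨s, fun t => (v, Alg.y D q ^ t • w), ?_, ?_, fun t => ?_⟩
    · simp
    · simp only [hs, map_zero]
    · rw [← Alg.inclRight_y, inclRight_smul_tmul, ← mul_smul, ← pow_succ']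

/-- A dot passes through a shuffle up to shorter shuffles and is nilpotent at the bottom: induction
on the length and, within it, downwards along the chain of `exists_y_smul_tmul`. -/
theorem shuf_smul_tmul_mem_locallyNilpotent (hV : DotsNilpotent D m V) (hW : DotsNilpotent D n W)
    (p : Fin (m + n)) (l : ℕ) : ∀ x a, Alg.Shuf D m (m + n) l x a → ∀ (v : V) (w : W),
      x • tmul D m n v w ∈ locallyNilpotent K (Alg.y D p) := by
  induction l using Nat.strong_induction_on with
  | _ l ih =>
  intro x a hx v w
  obtain ⟨s, f, hf0, hfs, hf⟩ := exists_y_smul_tmul D hV hW (a p) v w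
  have key : ∀ d t, t + d = s →
      x • tmul D m n (f t).1 (f t).2 ∈ locallyNilpotent K (Alg.y D p) := by
    intro d
    induction d with
    | zero =>
      rintro t rfl
      rw [add_zero] at hfs
      rw [hfs, smul_zero]
      exact zero_mem _
    | succ d ihd =>
      intro t ht
      have iht := ihd (t + 1) (by omega)
      have h1 : Alg.y D p • x • tmul D m n (f t).1 (f t).2 ∈ locallyNilpotent K (Alg.y D p) := by
        have h2 := smul_tmul_mem_of_mem_shufSpan D (fun j x a hj hx v w => ih j hj x a hx v w)
          (hx.y_mul_sub_mem p) (f t).1 (f t).2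
        rw [sub_smul, mul_smul, mul_smul, hf] at h2
        have h3 := add_mem h2 iht
        rwa [sub_add_cancel] at h3
      obtain ⟨N, hN⟩ := h1
      exact ⟨N + 1, by rw [pow_succ, mul_smul, hN]⟩
  have := key s 0 (zero_add s)
  rwa [hf0] at this

instance finiteDimensional [FiniteDimensional K V] [FiniteDimensional K W] :
    FiniteDimensional K (Ind D m n V W) := by
  let T : V ⊗[K] W →ₗ[K] Ind D m n V W := TensorProduct.lift (tmul D m n)
  let F : (Alg.ShufPerm D m n → V ⊗[K] W) →ₗ[K] Ind D m n V W :=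
    ∑ a, (DistribSMul.toLinearMap K (Ind D m n V W) a.elt) ∘ₗ T ∘ₗ LinearMap.proj a
  have hF : ∀ b, F b = ∑ a, a.elt • T (b a) := fun b => by simp [F]
  refine Module.Finite.of_surjective F fun z => ?_
  induction z using induction_smul D with
  | h0 => exact ⟨0, map_zero _⟩
  | hadd x y hx hy =>
    obtain ⟨x, rfl⟩ := hx
    obtain ⟨y, rfl⟩ := hy
    exact ⟨x + y, map_add _ _ _⟩
  | hmul r v w =>
    obtain ⟨b, rfl⟩ := (Alg.bijective_shufPerm_elt D m n).2 r
    have hT : ∀ b : Alg D m ⊗[K] Alg D n, ∃ t, T t = Alg.juxt D m n b • tmul D m n v w := by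
      intro b
      induction b using TensorProduct.induction_on with
      | zero => exact ⟨0, by rw [map_zero, map_zero, zero_smul]⟩
      | tmul b b' => exact ⟨(b • v) ⊗ₜ (b' • w), (juxt_smul_tmul D b b' v w).symm⟩
      | add b b' hb hb' =>
        obtain ⟨t, ht⟩ := hb
        obtain ⟨t', ht'⟩ := hb'
        exact ⟨t + t', by rw [map_add, map_add, add_smul, ht, ht']⟩
    choose t ht using hT
    refine ⟨fun a => t (b a), ?_⟩
    rw [hF, Finset.sum_smul]
    exact Finset.sum_congr rfl fun a _ => by rw [ht, mul_smul]

theorem dotsNilpotent [FiniteDimensional K V] [FiniteDimensional K W] (hV : DotsNilpotent D m V)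
    (hW : DotsNilpotent D n W) : DotsNilpotent D (m + n) (Ind D m n V W) := by
  intro p
  refine exists_pow_smul_eq_zero (K := K) fun z => ?_
  refine Submodule.span_le.2 ?_ (mem_span_shuf D z)
  rintro _ ⟨l, x, a, v, w, hx, rfl⟩
  exact shuf_smul_tmul_mem_locallyNilpotent D hV hW p l x a hx v w

/-- By freeness, taking the coefficient at the identity shuffle is linear over `R_m ⊗ R_n` from the
right. It therefore induces a map from the induction product to `V ⊗ W`, under which the tensor
formed from `v₀` and `w₀` survives. -/
theorem nontrivial [Nontrivial V] [Nontrivial W] : Nontrivial (Ind D m n V W) := by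
  classical
  obtain ⟨v₀, hv₀⟩ := exists_ne (0 : V)
  obtain ⟨w₀, hw₀⟩ := exists_ne (0 : W)
  let Θ := Equiv.ofBijective _ (Alg.bijective_shufPerm_elt D m n)
  have hΘ : ∀ b, Θ b = ∑ a, a.elt * Alg.juxt D m n (b a) := fun b => rfl
  have hadd : ∀ b b', Θ (b + b') = Θ b + Θ b' := by
    intro b b'
    simp only [hΘ, Pi.add_apply, map_add, mul_add, Finset.sum_add_distrib]
  have hsmul : ∀ (c : K) b, Θ (c • b) = c • Θ b := by
    intro c b
    simp only [hΘ, Pi.smul_apply, map_smul, mul_smul_comm, Finset.smul_sum]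
  have hmul : ∀ b c, Θ (fun a => b a * c) = Θ b * Alg.juxt D m n c := by
    intro b c
    simp only [hΘ, map_mul, Finset.sum_mul, mul_assoc]
  let Λ : Alg D (m + n) →ₗ[K] (Alg.ShufPerm D m n → Alg D m ⊗[K] Alg D n) :=
    { toFun := Θ.symm
      map_add' := fun x y => Θ.injective (by simp [hadd])
      map_smul' := fun c x => Θ.injective (by simp [hsmul]) }
  have hΛ : ∀ r c a, Λ (r * Alg.juxt D m n c) a = Λ r a * c := by
    intro r c a
    have : Λ (r * Alg.juxt D m n c) = fun a => Λ r a * c := Θ.injective (by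
      rw [hmul]; simp [Λ])
    rw [this]
  let s₀ : Alg.ShufPerm D m n := ⟨1, 0, 1, .one⟩
  have hs₀ : Λ s₀.elt = Pi.single s₀ 1 := by
    refine Θ.symm_apply_eq.2 ?_
    rw [hΘ, Finset.sum_eq_single s₀]
    · rw [Pi.single_eq_same, map_one, mul_one]
    · intro b _ hb
      rw [Pi.single_eq_of_ne hb, map_zero, mul_zero]
    · simp
  let ρ : Alg D m ⊗[K] Alg D n →ₐ[K] Module.End K (V ⊗[K] W) :=
    (Module.endTensorEndAlgHom (R := K) (S := K) (A := K) (M := V) (N := W)).comp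
      (Algebra.TensorProduct.map (Algebra.lsmul K K V) (Algebra.lsmul K K W))
  have hρ : ∀ a b v w, ρ (a ⊗ₜ b) (v ⊗ₜ w) = (a • v) ⊗ₜ (b • w) := fun a b v w => rfl
  let Φ : Alg D (m + n) ⊗[K] (V ⊗[K] W) →ₗ[K] V ⊗[K] W :=
    TensorProduct.lift (ρ.toLinearMap ∘ₗ LinearMap.proj s₀ ∘ₗ Λ)
  have hΦ : ∀ r t, Φ (r ⊗ₜ t) = ρ (Λ r s₀) t := fun r t => rfl
  -- `Φ` is only `K`-linear, whereas the relations are spanned over the whole algebra; the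
  -- additional factor `s` lets the induction pass through scalar multiples.
  have hker : ∀ z ∈ Rep.indRel (Rep.mk m V : Rep D) (Rep.mk n W : Rep D), ∀ s : Alg D (m + n),
      Φ (s • z) = 0 := by
    intro z hz
    induction hz using Submodule.span_induction with
    | mem z hz =>
      obtain ⟨r, a, b, v, w, rfl⟩ := hz
      intro s
      rw [smul_sub, map_sub, sub_eq_zero]
      change Φ ((s * (r * Alg.juxt D m n (a ⊗ₜ b))) ⊗ₜ (v ⊗ₜ w)) =
        Φ ((s * r) ⊗ₜ ((a • v) ⊗ₜ (b • w)))
      rw [hΦ, hΦ, ← mul_assoc, hΛ, map_mul, Module.End.mul_apply, hρ]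
    | zero => intro s; rw [smul_zero, map_zero]
    | add x y _ _ hx hy => intro s; rw [smul_add, map_add, hx, hy, add_zero]
    | smul c x _ hx => intro s; rw [← mul_smul]; exact hx _
  refine ⟨⟨s₀.elt • tmul D m n v₀ w₀, 0, fun h => ?_⟩⟩
  rw [← proj_tmul, proj_eq_zero_iff] at h
  have h1 := hker _ h 1
  rw [one_smul] at h1
  have h2 : Φ (s₀.elt ⊗ₜ (v₀ ⊗ₜ w₀)) = v₀ ⊗ₜ w₀ := by
    rw [hΦ, hs₀, Pi.single_eq_same, map_one, Module.End.one_apply]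
  rw [h2] at h1
  obtain ⟨f, hf⟩ := not_forall.1 (mt (Module.forall_dual_apply_eq_zero_iff K v₀).1 hv₀)
  obtain ⟨g, hg⟩ := not_forall.1 (mt (Module.forall_dual_apply_eq_zero_iff K w₀).1 hw₀)
  have h3 := congrArg (LinearMap.mul' K K ∘ₗ TensorProduct.map f g) h1
  rw [map_zero] at h3
  exact mul_ne_zero hf hg h3

end Ind
end KLR

/-! ### Prefix weights of shuffles -/

namespace KLR

section Words

variable {I : Type u} [DecidableEq I] {m n : ℕ}

theorem prefixWeight_apply (i : Fin n → I) (p : ℕ) (a : I) :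
    prefixWeight i p a = ∑ k : Fin n, if (k : ℕ) < p ∧ i k = a then 1 else 0 :=
  Finset.card_filter _ _

theorem wordWeight_apply (i : Fin n → I) (a : I) :
    wordWeight i a = ∑ k : Fin n, if i k = a then 1 else 0 :=
  Finset.card_filter _ _

theorem prefixWeight_zero (i : Fin n → I) : prefixWeight i 0 = 0 := by
  funext a
  simp [prefixWeight_apply]

theorem prefixWeight_of_le (i : Fin n → I) {p : ℕ} (h : n ≤ p) :
    prefixWeight i p = wordWeight i := by
  funext a
  rw [prefixWeight_apply, wordWeight_apply]
  refine Finset.sum_congr rfl fun k _ => ?_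
  simp only [k.2.trans_le h, true_and]

theorem prefixWeight_ne_zero (i : Fin n → I) {p : ℕ} (hn : 0 < n) (hp : 0 < p) :
    prefixWeight i p ≠ 0 := by
  intro h
  have h1 := congrFun h (i ⟨0, hn⟩)
  rw [prefixWeight, Pi.zero_apply, Finset.card_eq_zero] at h1
  exact Finset.notMem_empty (⟨0, hn⟩ : Fin n)
    (h1 ▸ Finset.mem_filter.2 ⟨Finset.mem_univ _, hp, rfl⟩)

theorem wordWeight_ne_zero (i : Fin n → I) (hn : 0 < n) : wordWeight i ≠ 0 := by
  rw [← prefixWeight_of_le i le_rfl]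
  exact prefixWeight_ne_zero i hn hn

theorem wordWeight_of_zero (i : Fin n → I) (hn : n = 0) : wordWeight i = 0 := by
  subst hn
  funext a
  simp [wordWeight_apply]

theorem prefixWeight_append_left (i : Fin m → I) (j : Fin n → I) {p : ℕ} (h : p ≤ m) :
    prefixWeight (Fin.append i j) p = prefixWeight i p := by
  funext a
  rw [prefixWeight_apply, prefixWeight_apply, Fin.sum_univ_add]
  simp only [Fin.append_left, Fin.append_right, Fin.val_castAdd, Fin.val_natAdd]
  rw [add_eq_left]
  exact Finset.sum_eq_zero fun k _ => if_neg (by omega)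

theorem prefixWeight_append_right (i : Fin m → I) (j : Fin n → I) (p : ℕ) :
    prefixWeight (Fin.append i j) (m + p) = wordWeight i + prefixWeight j p := by
  funext a
  rw [Pi.add_apply, prefixWeight_apply, prefixWeight_apply, wordWeight_apply, Fin.sum_univ_add]
  simp only [Fin.append_left, Fin.append_right, Fin.val_castAdd, Fin.val_natAdd]
  congr 1
  · refine Finset.sum_congr rfl fun k _ => ?_
    simp only [show (k : ℕ) < m + p by omega, true_and]
  · refine Finset.sum_congr rfl fun k _ => ?_
    simp only [Nat.add_lt_add_iff_left]

theorem prefixWeight_append_self (i : Fin m → I) (j : Fin n → I) :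
    prefixWeight (Fin.append i j) m = wordWeight i := by
  rw [prefixWeight_append_left i j le_rfl, prefixWeight_of_le i le_rfl]

theorem wordWeight_comp_perm (i : Fin n → I) (a : Equiv.Perm (Fin n)) :
    wordWeight (i ∘ a) = wordWeight i := by
  funext b
  rw [wordWeight_apply, wordWeight_apply]
  exact Equiv.sum_comp a fun k => if i k = b then 1 else 0

theorem wordWeight_swapWord (k : ℕ) (h : k + 1 < n) (i : Fin n → I) :
    wordWeight (swapWord k h i) = wordWeight i :=
  wordWeight_comp_perm i _

/-- A lower subset of `Fin n` is an initial segment. -/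
theorem mem_iff_lt_card {S : Finset (Fin n)} (hS : ∀ k l, k < l → l ∈ S → k ∈ S) (k : Fin n) :
    k ∈ S ↔ (k : ℕ) < S.card := by
  constructor
  · intro hk
    have h : Finset.Iic k ⊆ S := fun l hl => by
      rcases (Finset.mem_Iic.1 hl).lt_or_eq with h | rfl
      · exact hS _ _ h hk
      · exact hk
    have := Finset.card_le_card h
    rw [Fin.card_Iic] at this
    omega
  · intro hk
    by_contra h
    have h' : S ⊆ Finset.Iio k := fun l hl => by
      rw [Finset.mem_Iio]
      by_contra hlt
      rcases (not_lt.1 hlt).lt_or_eq with h1 | rfl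
      · exact h (hS _ _ h1 hl)
      · exact h hl
    have := Finset.card_le_card h'
    rw [Fin.card_Iio] at this
    omega

variable {K : Type u} [Fintype I] [Field K] {D : Params I K}

/-- The prefixes of a shuffle of two words consist of prefixes of the two words. -/
theorem Alg.Shuf.exists_prefixWeight {l : ℕ} {x : Alg D (m + n)} {a : Equiv.Perm (Fin (m + n))}
    (hx : Shuf D m (m + n) l x a) (p : ℕ) (hp : p ≤ m + n) : ∃ s t, s + t = p ∧ s ≤ m ∧ t ≤ n ∧
      (∀ (i : Fin m → I) (j : Fin n → I), prefixWeight (Fin.append i j ∘ a) p =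
        prefixWeight i s + prefixWeight j t) ∧
      (p = m → t = 0 → x = 1 ∧ a = 1) := by
  let S : Finset (Fin m) := Finset.univ.filter fun k => (a.symm (Fin.castAdd n k) : ℕ) < p
  let T : Finset (Fin n) := Finset.univ.filter fun k => (a.symm (Fin.natAdd m k) : ℕ) < p
  have hS : ∀ k, (a.symm (Fin.castAdd n k) : ℕ) < p ↔ (k : ℕ) < S.card := by
    intro k
    rw [← mem_iff_lt_card]
    · simp [S]
    · intro k l hkl hl
      simp only [S, Finset.mem_filter, Finset.mem_univ, true_and] at hl ⊢
      by_contra h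
      have h1 : a.symm (Fin.castAdd n l) < a.symm (Fin.castAdd n k) :=
        Fin.lt_def.2 (lt_of_lt_of_le hl (Nat.not_lt.1 h))
      have h2 := hx.monotone h1 (Or.inl (by simp))
      simp only [Equiv.apply_symm_apply, Fin.lt_def, Fin.val_castAdd] at h2
      omega
  have hT : ∀ k, (a.symm (Fin.natAdd m k) : ℕ) < p ↔ (k : ℕ) < T.card := by
    intro k
    rw [← mem_iff_lt_card]
    · simp [T]
    · intro k l hkl hl
      simp only [T, Finset.mem_filter, Finset.mem_univ, true_and] at hl ⊢
      by_contra h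
      have h1 : a.symm (Fin.natAdd m l) < a.symm (Fin.natAdd m k) :=
        Fin.lt_def.2 (lt_of_lt_of_le hl (Nat.not_lt.1 h))
      have h2 := hx.monotone h1 (Or.inr (by simp))
      simp only [Equiv.apply_symm_apply, Fin.lt_def, Fin.val_natAdd] at h2
      omega
  have hST : S.card + T.card = p := by
    have h1 : (Finset.univ.filter fun k : Fin (m + n) => (k : ℕ) < p).card = p := by
      rw [Fin.card_filter_val_lt, min_eq_right hp]
    rw [Finset.card_filter, ← Equiv.sum_comp a.symm fun k : Fin (m + n) =>
      if (k : ℕ) < p then 1 else 0, Fin.sum_univ_add, ← Finset.card_filter,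
      ← Finset.card_filter] at h1
    exact h1
  refine ⟨S.card, T.card, hST, by simpa using S.card_le_univ, by simpa using T.card_le_univ,
    fun i j => ?_, ?_⟩
  · funext b
    rw [Pi.add_apply, prefixWeight_apply, prefixWeight_apply, prefixWeight_apply,
      ← Equiv.sum_comp a.symm, Fin.sum_univ_add]
    simp only [Function.comp_apply, Equiv.apply_symm_apply, Fin.append_left, Fin.append_right, hS,
      hT]
  -- A nontrivial shuffle has a right strand among its first `m` positions, which would be counted
  -- by `T`.
  · intro hpm ht
    refine hx.eq_one_or.resolve_right ?_
    rintro ⟨q, hq, hq'⟩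
    obtain ⟨k, hk⟩ : ∃ k : Fin n, a q = Fin.natAdd m k :=
      ⟨⟨(a q : ℕ) - m, by omega⟩, Fin.ext (by simp; omega)⟩
    have := (hT k).1 (by rw [← hk, Equiv.symm_apply_apply]; omega)
    omega

end Words

/-! ### Comparison of arguments by an additive function -/

namespace Charge

variable {I : Type u} (c : Charge I)

/-- The central charge, rotated so that the positive roots lie in the right half plane. -/
noncomputable def eval (α : I → ℕ) : ℂ := c.toLinearMap (fun i => (α i : ℝ)) / c.dir

theorem eval_add (α β : I → ℕ) : c.eval (α + β) = c.eval α + c.eval β := by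
  rw [eval, eval, eval, ← add_div, ← map_add]
  congr 2
  funext i
  simp

theorem eval_zero : c.eval 0 = 0 := by
  have h : (fun i : I => (((0 : I → ℕ) i : ℕ) : ℝ)) = 0 := by
    funext i
    simp
  rw [eval, h, map_zero, zero_div]

/-- The additive function of `α` whose sign is that of `arg α - arg μ`. -/
noncomputable def slope (μ α : I → ℕ) : ℝ :=
  (c.eval α).im * (c.eval μ).re - (c.eval μ).im * (c.eval α).re

theorem slope_add (μ α β : I → ℕ) : c.slope μ (α + β) = c.slope μ α + c.slope μ β := by
  simp only [slope, eval_add, Complex.add_im, Complex.add_re]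
  ring

theorem slope_zero (μ : I → ℕ) : c.slope μ 0 = 0 := by
  simp [slope, eval_zero]

theorem slope_self (μ : I → ℕ) : c.slope μ μ = 0 := sub_self _

variable {c} {μ α : I → ℕ}

theorem eval_re_pos (hα : α ≠ 0) : 0 < (c.eval α).re := c.half_plane α hα

theorem tan_arg : Real.tan (c.arg α) = (c.eval α).im / (c.eval α).re :=
  Complex.tan_arg _

theorem arg_mem (hα : α ≠ 0) : c.arg α ∈ Set.Ioo (-(Real.pi / 2)) (Real.pi / 2) :=
  abs_lt.1 (Complex.abs_arg_lt_pi_div_two_iff.2 (Or.inl (c.half_plane α hα)))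

/-- After the rotation all values lie in the right half plane, where arguments are ordered like
their tangents `im / re`. Clearing the positive denominators leaves the sign of `slope`. -/
theorem arg_le_arg_iff (hα : α ≠ 0) (hμ : μ ≠ 0) :
    c.arg α ≤ c.arg μ ↔ c.slope μ α ≤ 0 := by
  rw [← Real.strictMonoOn_tan.le_iff_le (arg_mem hα) (arg_mem hμ), tan_arg, tan_arg,
    div_le_div_iff₀ (eval_re_pos hα) (eval_re_pos hμ), slope, sub_nonpos]

theorem arg_lt_arg_iff (hα : α ≠ 0) (hμ : μ ≠ 0) :
    c.arg α < c.arg μ ↔ c.slope μ α < 0 := by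
  rw [← Real.strictMonoOn_tan.lt_iff_lt (arg_mem hα) (arg_mem hμ), tan_arg, tan_arg,
    div_lt_div_iff₀ (eval_re_pos hα) (eval_re_pos hμ), slope, sub_neg]

end Charge
end KLR

/-! ### Modules generated by each nonzero vector of a distinguished part -/

namespace KLR

section

variable {I K : Type u} [Fintype I] [Field K] {D : Params I K} {n : ℕ}

namespace Alg

open Classical in
/-- The sum of the idempotents of the words in `S`. -/
noncomputable def eSum (D : Params I K) (S : Set (Fin n → I)) : Alg D n :=
  ∑ k, if k ∈ S then e D k else 0

open Classical in
theorem eSum_mul_e (S : Set (Fin n → I)) (k : Fin n → I) :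
    eSum D S * e D k = if k ∈ S then e D k else 0 := by
  rw [eSum, Finset.sum_mul, Finset.sum_eq_single k]
  · split_ifs
    · exact e_mul_self k
    · exact zero_mul _
  · intro k' _ hk'
    split_ifs
    · exact e_mul_of_ne hk'
    · exact zero_mul _
  · simp

theorem e_mul_eSum_of_notMem {S : Set (Fin n → I)} {k : Fin n → I} (hk : k ∉ S) :
    e D k * eSum D S = 0 := by
  classical
  rw [eSum, Finset.mul_sum]
  refine Finset.sum_eq_zero fun k' _ => ?_
  split_ifs with h
  · exact e_mul_of_ne fun h' => hk (h' ▸ h)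
  · exact mul_zero _

theorem eSum_add_eSum_compl (S : Set (Fin n → I)) : eSum D S + eSum D Sᶜ = 1 := by
  classical
  refine eq_of_mul_e fun k => ?_
  rw [add_mul, eSum_mul_e, eSum_mul_e, one_mul]
  by_cases h : k ∈ S <;> simp [h]

variable [DecidableEq I]

/-- Crossings permute the letters of a word and preserve its weight. The central elements so
obtained are the units of the blocks `R(ν)`. -/
theorem commute_eSum_weight (ν : I → ℕ) (r : Alg D n) :
    eSum D {k : Fin n → I | wordWeight k = ν} * r =
      r * eSum D {k : Fin n → I | wordWeight k = ν} := by
  classical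
  have h : ∀ k, e D k * eSum D {k : Fin n → I | wordWeight k = ν} =
      eSum D {k : Fin n → I | wordWeight k = ν} * e D k := by
    intro k
    rw [eSum, Finset.mul_sum, Finset.sum_mul]
    refine Finset.sum_congr rfl fun k' _ => ?_
    split_ifs
    · exact e_commute _ _
    · rw [mul_zero, zero_mul]
  induction r using Alg.induction with
  | he k => exact (h k).symm
  | hy k =>
    refine eq_of_mul_e fun i => ?_
    rw [mul_assoc, y_mul_e, ← mul_assoc, eSum_mul_e, mul_assoc, eSum_mul_e]
    split_ifs
    · exact (y_mul_e k i).symm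
    · rw [zero_mul, mul_zero]
  | hpsi k hk =>
    refine eq_of_mul_e fun i => ?_
    rw [mul_assoc, psi_mul_e, ← mul_assoc, eSum_mul_e, mul_assoc, eSum_mul_e]
    simp only [Set.mem_ofPred_eq, wordWeight_swapWord]
    split_ifs
    · exact (psi_mul_e k hk i).symm
    · rw [zero_mul, mul_zero]
  | hc c => exact (Algebra.commutes c _).symm
  | hadd a b ha hb => rw [mul_add, add_mul, ha, hb]
  | hmul a b ha hb => rw [← mul_assoc, ha, mul_assoc, hb, mul_assoc]

end Alg

variable {V : Type u} [AddCommGroup V] [Module (Alg D n) V]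

variable (D) in
/-- Only words in `S` occur in `x`. -/
def SupportedOn (S : Set (Fin n → I)) (x : V) : Prop := ∀ k ∉ S, Alg.e D k • x = 0

theorem SupportedOn.eSum_smul {S : Set (Fin n → I)} {x : V} (h : SupportedOn D S x) :
    Alg.eSum D S • x = x := by
  classical
  conv_rhs => rw [← one_smul (Alg D n) x, ← Alg.sum_e]
  rw [Alg.eSum, Finset.sum_smul, Finset.sum_smul]
  refine Finset.sum_congr rfl fun k _ => ?_
  split_ifs with hk
  · rfl
  · rw [zero_smul, h k hk]

theorem supportedOn_eSum_smul (S : Set (Fin n → I)) (x : V) :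
    SupportedOn D S (Alg.eSum D S • x) := fun k hk => by
  rw [← mul_smul, Alg.e_mul_eSum_of_notMem hk, zero_smul]

theorem supportedOn_of_hasWord {S : Set (Fin n → I)} (h : ∀ k, HasWord D V k → k ∈ S) (x : V) :
    SupportedOn D S x := fun k hk => by
  by_contra hx
  exact hk (h k ⟨x, hx⟩)

theorem HasWord.of_surjective {W : Type u} [AddCommGroup W] [Module (Alg D n) W]
    {f : V →ₗ[Alg D n] W} (hf : Function.Surjective f) {k : Fin n → I} (hk : HasWord D W k) :
    HasWord D V k := by
  obtain ⟨w, hw⟩ := hk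
  obtain ⟨v, rfl⟩ := hf w
  exact ⟨v, fun h => hw (by rw [← map_smul, h, map_zero])⟩

variable (D V) in
/-- The part of the module spanned by words in `S` is nonzero and each of its nonzero elements
generates the module. -/
structure Headed (S : Set (Fin n → I)) : Prop where
  exists_supportedOn : ∃ x : V, x ≠ 0 ∧ SupportedOn D S x
  cyclic : ∀ x : V, x ≠ 0 → SupportedOn D S x → ∀ z, ∃ r : Alg D n, r • x = z

namespace Headed

variable {S : Set (Fin n → I)} (h : Headed D V S)
include h

theorem nontrivial : Nontrivial V :=
  let ⟨x, hx, _⟩ := h.exists_supportedOn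
  ⟨⟨x, 0, hx⟩⟩

theorem finite : Module.Finite (Alg D n) V := by
  obtain ⟨x, hx, hx'⟩ := h.exists_supportedOn
  exact Module.Finite.of_surjective (LinearMap.toSpanSingleton (Alg D n) V x)
    (h.cyclic x hx hx')

/-- A nonzero element supported on `S` generates the module, so its image generates the quotient and
cannot vanish. -/
theorem exists_hasWord {W : Type u} [AddCommGroup W] [Module (Alg D n) W] [Nontrivial W]
    {f : V →ₗ[Alg D n] W} (hf : Function.Surjective f) : ∃ k ∈ S, HasWord D W k := by
  obtain ⟨x, hx, hx'⟩ := h.exists_supportedOn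
  have hfx : f x ≠ 0 := by
    intro h0
    obtain ⟨w, hw⟩ := exists_ne (0 : W)
    obtain ⟨v, rfl⟩ := hf w
    obtain ⟨r, rfl⟩ := h.cyclic x hx hx' v
    exact hw (by rw [map_smul, h0, smul_zero])
  obtain ⟨k, hk⟩ := KLR.exists_hasWord D n hfx
  refine ⟨k, ?_, f x, hk⟩
  by_contra hkS
  exact hk (by rw [← map_smul, hx' k hkS, map_zero])

/-- A proper submodule contains no nonzero element supported on `S`, as such an element generates
everything. The largest submodule without such elements is `N₀`; it is proper, so it is the only
maximal submodule. -/
theorem existsUnique : ∃! N : Submodule (Alg D n) V, IsSimpleModule (Alg D n) (V ⧸ N) := by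
  let N₀ : Submodule (Alg D n) V :=
    { carrier := {x | ∀ r : Alg D n, Alg.eSum D S • r • x = 0}
      add_mem' := fun hx hy r => by rw [smul_add, smul_add, hx, hy, add_zero]
      zero_mem' := fun r => by rw [smul_zero, smul_zero]
      smul_mem' := fun s x hx r => by rw [← mul_smul r]; exact hx _ }
  have hle : ∀ N : Submodule (Alg D n) V, N ≠ ⊤ → N ≤ N₀ := by
    intro N hN x hx r
    by_contra h0
    refine hN ((Submodule.eq_top_iff').2 fun z => ?_)
    obtain ⟨s, rfl⟩ := h.cyclic _ h0 (supportedOn_eSum_smul S _) z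
    exact N.smul_mem _ (N.smul_mem _ (N.smul_mem _ hx))
  have htop : N₀ ≠ ⊤ := by
    obtain ⟨x, hx, hx'⟩ := h.exists_supportedOn
    intro h0
    have : x ∈ N₀ := h0 ▸ Submodule.mem_top
    apply hx
    rw [← hx'.eSum_smul, ← one_smul (Alg D n) x]
    exact this 1
  refine ⟨N₀, isSimpleModule_iff_isCoatom.2 ⟨htop, fun N hN => ?_⟩, fun N hN => ?_⟩
  · by_contra hN'
    exact not_lt_of_ge (hle N hN') hN
  · have hN' := isSimpleModule_iff_isCoatom.1 hN
    exact (hN'.le_iff.1 (hle N hN'.1)).resolve_left htop |>.symm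

end Headed

theorem Headed.of_isSimpleModule [IsSimpleModule (Alg D n) V] {S : Set (Fin n → I)}
    (hS : ∀ k, HasWord D V k → k ∈ S) : Headed D V S where
  exists_supportedOn := by
    have := IsSimpleModule.nontrivial (Alg D n) V
    obtain ⟨x, hx⟩ := exists_ne (0 : V)
    exact ⟨x, hx, supportedOn_of_hasWord hS x⟩
  cyclic x hx _ z := exists_smul_eq hx z

/-- With no strands the relations hold in `K` when the idempotent of the empty word is sent to `1`,
and a ring with a homomorphism to a field is nonzero. -/
theorem Alg.nontrivial_zero (D : Params I K) : Nontrivial (Alg D 0) := by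
  let f : Alg D 0 →ₐ[K] K := Alg.lift (fun _ => 1) (fun k => k.elim0) (fun k h => by omega) (by
    intro a b h
    cases h with
    | e_mul_self i => exact one_mul 1
    | e_mul_ne i j h => exact absurd (Subsingleton.elim i j) h
    | e_sum => exact Fintype.sum_unique _
    | y_mul_e k _ => exact k.elim0
    | psi_mul_e k h i => omega
    | y_mul_y k _ => exact k.elim0
    | psi_mul_y k h => omega
    | psi_mul_psi k h => omega
    | dot_left_ne k h => omega
    | dot_right_ne k h => omega
    | dot_left_eq k h => omega
    | dot_right_eq k h => omega
    | psi_sq_eq k h => omega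
    | psi_sq_ne k h => omega
    | braid k h => omega
    | braid_ne k h => omega)
  exact f.toRingHom.domain_nontrivial

theorem Headed.unit (D : Params I K) : Headed D (Alg D 0) (Set.univ : Set (Fin 0 → I)) where
  exists_supportedOn := by
    have := Alg.nontrivial_zero D
    exact ⟨1, one_ne_zero, fun k hk => absurd (Set.mem_univ k) hk⟩
  cyclic x hx _ z := by
    obtain ⟨c, rfl⟩ := Alg.exists_eq_algebraMap x
    have hc : c ≠ 0 := fun h => hx (by rw [h, map_zero])
    refine ⟨z * algebraMap K _ c⁻¹, ?_⟩
    rw [smul_eq_mul, mul_assoc, ← map_mul, inv_mul_cancel₀ hc, map_one, mul_one]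

section Weight

variable [DecidableEq I]

theorem wordWeight_eq_of_hasWord [IsSimpleModule (Alg D n) V] {k k' : Fin n → I}
    (hk : HasWord D V k) (hk' : HasWord D V k') : wordWeight k' = wordWeight k := by
  obtain ⟨x, hx⟩ := hk
  obtain ⟨x', hx'⟩ := hk'
  obtain ⟨r, rfl⟩ := exists_smul_eq (A := Alg D n) hx x'
  have h1 : Alg.eSum D {i : Fin n → I | wordWeight i = wordWeight k} • Alg.e D k • x =
      Alg.e D k • x := by
    classical
    rw [← mul_smul, Alg.eSum_mul_e, if_pos (by exact rfl)]
  by_contra h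
  apply hx'
  rw [← h1, ← mul_smul r, ← Alg.commute_eSum_weight, mul_smul, ← mul_smul,
    Alg.e_mul_eSum_of_notMem h, zero_smul]

/-- The weight is read off from any word that occurs; a simple module lies in a single block, so the
choice does not matter. -/
theorem exists_simple_toRep_eq (D : Params I K) (n : ℕ) (V : Type u) [AddCommGroup V] [Module K V]
    [Module (Alg D n) V] [IsScalarTower K (Alg D n) V] [hs : IsSimpleModule (Alg D n) V]
    [hf : FiniteDimensional K V] (hV : DotsNilpotent D n V) :
    ∃ L : Simple D, L.toRep = Rep.mk n V := by
  have := IsSimpleModule.nontrivial (Alg D n) V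
  obtain ⟨x, hx⟩ := exists_ne (0 : V)
  obtain ⟨k, hk⟩ := exists_hasWord D n hx
  refine ⟨⟨Rep.mk n V, wordWeight k, fun i hi x => ?_, hs, hf, fun p i => ?_⟩, rfl⟩
  · by_contra h
    exact hi (wordWeight_eq_of_hasWord ⟨_, hk⟩ ⟨x, h⟩)
  · obtain ⟨N, hN⟩ := hV p
    refine ⟨N, fun x => ?_⟩
    change (Alg.y D p * Alg.e D i) ^ N • (x : V) = 0
    rw [(show Commute (Alg.y D p) (Alg.e D i) from Alg.y_mul_e p i).mul_pow, mul_smul]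
    exact hN _

namespace Simple

variable (L : Simple D)

instance : IsSimpleModule (Alg D L.n) L.V := L.simple

instance : FiniteDimensional K L.V := L.finite

instance : Nontrivial L.V := IsSimpleModule.nontrivial (Alg D L.n) L.V

theorem wordWeight_eq {k : Fin L.n → I} (hk : HasWord D L.V k) : wordWeight k = L.wt := by
  obtain ⟨x, hx⟩ := hk
  by_contra h
  exact hx (L.supported k h x)

theorem n_pos (h : L.wt ≠ 0) : 0 < L.n := by
  obtain ⟨x, hx⟩ := exists_ne (0 : L.V)
  obtain ⟨k, hk⟩ := exists_hasWord D L.n hx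
  rw [Nat.pos_iff_ne_zero]
  intro hn
  exact h ((L.wordWeight_eq ⟨_, hk⟩).symm.trans (wordWeight_of_zero k hn))

theorem dotsNilpotent : DotsNilpotent D L.n L.V := by
  intro p
  refine exists_pow_smul_eq_zero (K := K) fun x => ?_
  rw [← one_smul (Alg D L.n) x, ← Alg.sum_e, Finset.sum_smul]
  refine Submodule.sum_mem _ fun i _ => ?_
  obtain ⟨N, hN⟩ := L.nilpotent p i
  refine ⟨N, ?_⟩
  have := hN (Alg.e D i • x)
  rw [(show Commute (Alg.y D p) (Alg.e D i) from Alg.y_mul_e p i).mul_pow, mul_smul] at this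
  convert this using 2
  clear this hN
  induction N with
  | zero => rw [pow_zero, one_smul]
  | succ N ih => rw [pow_succ, mul_smul, ← mul_smul (Alg.e D i), Alg.e_mul_self, ← ih]

end Simple

end Weight

end

end KLR

/-! ### The distinguished part of an induction product -/

namespace KLR

variable {I K : Type u} [Fintype I] [Field K] {D : Params I K} {m n : ℕ}

/-- The words with a prefix in `S`. -/
def leftWords (n : ℕ) (S : Set (Fin m → I)) : Set (Fin (m + n) → I) :=
  {k | ∃ i ∈ S, ∃ j : Fin n → I, k = Fin.append i j}

/-- The concatenations of words in `S` and in `T`. -/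
def appendWords (S : Set (Fin m → I)) (T : Set (Fin n → I)) : Set (Fin (m + n) → I) :=
  {k | ∃ i ∈ S, ∃ j ∈ T, k = Fin.append i j}

variable {V W : Type u} [AddCommGroup V] [Module K V]
  [Module (Alg D m) V] [IsScalarTower K (Alg D m) V] [AddCommGroup W] [Module K W]
  [Module (Alg D n) W] [IsScalarTower K (Alg D n) W]

variable (D n V W) in
/-- A shuffle of a word of `V` and a word of `W` which begins with a word in `S` is a
concatenation. -/
def ShuffleFree (S : Set (Fin m → I)) : Prop :=
  ∀ l x a (i : Fin m → I) (j : Fin n → I), Alg.Shuf D m (m + n) l x a → HasWord D V i → HasWord D W j →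
    Fin.append i j ∘ a ∈ leftWords n S → x = 1

/-- Every rank one operator on a simple module is the action of an element of the algebra. -/
theorem exists_smul_eq_coord_smul [IsSimpleModule (Alg D m) V] [FiniteDimensional K V]
    (hV : DotsNilpotent D m V) {κ : Type*} (b : Module.Basis κ K V) (k : κ) (v : V) :
    ∃ a : Alg D m, ∀ x, a • x = b.coord k x • v :=
  Alg.exists_smul_eq_linearMap hV ((b.coord k).smulRight v)

namespace Ind

/-- Projecting to the words that begin in `S` removes all terms with a nontrivial shuffle. What
remains are tensors without crossings, expanded in a basis of the left factor. -/
theorem exists_eq_sum_tmul {S : Set (Fin m → I)} (hS : ShuffleFree D n V W S) {κ : Type*} [Fintype κ]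
    (b : Module.Basis κ K V) {z : Ind D m n V W} (hz : SupportedOn D (leftWords n S) z) :
    ∃ w : κ → W, z = ∑ k, tmul D m n (b k) (w k) := by
  classical
  let X : Submodule K (Ind D m n V W) := LinearMap.range
    (∑ k, tmul D m n (b k) ∘ₗ LinearMap.proj k : (κ → W) →ₗ[K] Ind D m n V W)
  have htmul : ∀ v w, tmul D m n v w ∈ X := by
    intro v w
    refine ⟨fun k => b.repr v k • w, ?_⟩
    have h := congrArg (fun v => tmul D m n v w) (b.sum_repr v)
    simp only [map_sum, map_smul, LinearMap.sum_apply, LinearMap.smul_apply] at h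
    rw [← h]
    simp
  suffices h : z ∈ X by
    obtain ⟨w, rfl⟩ := h
    exact ⟨w, by simp⟩
  suffices h : ∀ z : Ind D m n V W, Alg.eSum D (leftWords n S) • z ∈ X by
    rw [← hz.eSum_smul]
    exact h z
  intro z
  rw [Alg.eSum, Finset.sum_smul]
  refine Submodule.sum_mem _ fun k _ => ?_
  split_ifs with hk
  swap
  · rw [zero_smul]; exact zero_mem _
  induction mem_span_shuf D z using Submodule.span_induction with
  | mem z hz =>
    obtain ⟨l, x, a, v, w, hx, rfl⟩ := hz
    obtain ⟨i, j, rfl, he⟩ := e_smul_smul_tmul D hx k v w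
    rw [he]
    by_cases hv : Alg.e D i • v = 0
    · rw [hv, map_zero, LinearMap.zero_apply, smul_zero]; exact zero_mem _
    by_cases hw : Alg.e D j • w = 0
    · rw [hw, map_zero, smul_zero]; exact zero_mem _
    rw [hS l x a i j hx ⟨v, hv⟩ ⟨w, hw⟩ hk, one_smul]
    exact htmul _ _
  | zero => rw [smul_zero]; exact zero_mem _
  | add x y _ _ hx hy => rw [smul_add]; exact add_mem hx hy
  | smul c x _ hx => rw [smul_comm]; exact Submodule.smul_mem _ _ hx

theorem inclRight_eSum_smul {S : Set (Fin m → I)} {T : Set (Fin n → I)} {z : Ind D m n V W}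
    (hz : SupportedOn D (appendWords S T) z) :
    Alg.inclRight D m n (Alg.eSum D T) • z = z := by
  classical
  have h : Alg.inclRight D m n (Alg.eSum D Tᶜ) • z = 0 := by
    rw [Alg.eSum, map_sum, Finset.sum_smul]
    refine Finset.sum_eq_zero fun j _ => ?_
    split_ifs with hj
    · rw [Alg.inclRight_e, Finset.sum_smul]
      refine Finset.sum_eq_zero fun i _ => hz _ ?_
      rintro ⟨i', -, j', hj', h⟩
      exact hj ((append_inj h).2 ▸ hj')
    · rw [map_zero, zero_smul]
  have h1 := congrArg (fun r => Alg.inclRight D m n r • z) (Alg.eSum_add_eSum_compl (D := D) T)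
  simp only [map_add, add_smul, h, add_zero, map_one, one_smul] at h1
  exact h1

theorem supportedOn_tmul {S : Set (Fin m → I)} {T : Set (Fin n → I)} {v : V} {w : W}
    (hv : SupportedOn D S v) (hw : SupportedOn D T w) :
    SupportedOn D (appendWords S T) (tmul D m n v w) := by
  intro k hk
  obtain ⟨i, j, rfl⟩ := Alg.exists_eq_append k
  rw [e_append_smul_tmul]
  by_cases hi : i ∈ S
  · rw [hw j fun hj => hk ⟨i, hi, j, hj, rfl⟩, map_zero]
  · rw [hv i hi, map_zero, LinearMap.zero_apply]

theorem mem_of_forall_tmul_mem {N : Submodule (Alg D (m + n)) (Ind D m n V W)}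
    {w : W} (hw : ∀ w', ∃ r : Alg D n, r • w = w') (h : ∀ v, tmul D m n v w ∈ N)
    (z : Ind D m n V W) : z ∈ N := by
  induction z using induction_smul D with
  | hmul r v w' =>
    obtain ⟨s, rfl⟩ := hw w'
    rw [← inclRight_smul_tmul]
    exact N.smul_mem _ (N.smul_mem _ (h v))
  | h0 => exact zero_mem _
  | hadd x y hx hy => exact add_mem hx hy

/-- An element supported on the concatenations is a sum of tensors `b k ⊗ w' k` with `w' k`
supported on `T`. Rank one operators on the absolutely simple left factor isolate `v ⊗ w' k` for
every `v`. A nonzero `w' k` generates `W`, and the tensors generate the product. -/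
theorem headed [IsSimpleModule (Alg D m) V] [FiniteDimensional K V] (hV : DotsNilpotent D m V)
    {S : Set (Fin m → I)} {T : Set (Fin n → I)} (hVS : ∀ i : Fin m → I, HasWord D V i → i ∈ S)
    (hW : Headed D W T) (hS : ShuffleFree D n V W S) :
    Headed D (Ind D m n V W) (appendWords S T) where
  exists_supportedOn := by
    have := IsSimpleModule.nontrivial (Alg D m) V
    have := hW.nontrivial
    have := nontrivial D (m := m) (n := n) (V := V) (W := W)
    obtain ⟨w, hw, hwT⟩ := hW.exists_supportedOn
    by_contra! h
    obtain ⟨z, hz⟩ := exists_ne (0 : Ind D m n V W)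
    -- If all tensors `v ⊗ w` vanished, the product, which they generate, would be zero.
    refine hz ((Submodule.mem_bot (Alg D (m + n))).1 (mem_of_forall_tmul_mem (hW.cyclic w hw hwT)
      (fun v => ?_) z))
    by_contra hne
    exact h _ (fun h0 => hne ((Submodule.mem_bot _).2 h0))
      (supportedOn_tmul (supportedOn_of_hasWord hVS v) hwT)
  cyclic z hz hzS z' := by
    let b := Module.finBasis K V
    obtain ⟨w, hw⟩ := exists_eq_sum_tmul hS b fun k hk => hzS k fun ⟨i, hi, j, _, h⟩ =>
      hk ⟨i, hi, j, h⟩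
    obtain ⟨w', hw', hwT⟩ : ∃ w' : Fin (Module.finrank K V) → W,
        z = ∑ k, tmul D m n (b k) (w' k) ∧ ∀ k, SupportedOn D T (w' k) := by
      refine ⟨fun k => Alg.eSum D T • w k, ?_, fun k => supportedOn_eSum_smul T _⟩
      rw [← inclRight_eSum_smul hzS, hw, Finset.smul_sum]
      exact Finset.sum_congr rfl fun k _ => inclRight_smul_tmul D _ _ _
    obtain ⟨k, hk⟩ : ∃ k, w' k ≠ 0 := by
      by_contra! h
      exact hz (hw'.trans (Finset.sum_eq_zero fun k _ => by rw [h, map_zero]))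
    have hmem : z' ∈ Submodule.span (Alg D (m + n)) {z} := by
      refine mem_of_forall_tmul_mem (hW.cyclic _ hk (hwT k)) (fun v => ?_) z'
      obtain ⟨a, ha⟩ := exists_smul_eq_coord_smul hV b k v
      have h1 : Alg.inclLeft D m n a • z = tmul D m n v (w' k) := by
        rw [hw', Finset.smul_sum, Finset.sum_eq_single k]
        · rw [inclLeft_smul_tmul, ha, b.coord_apply, b.repr_self, Finsupp.single_eq_same, one_smul]
        · intro k' _ hk'
          rw [inclLeft_smul_tmul, ha, b.coord_apply, b.repr_self,
            Finsupp.single_eq_of_ne hk'.symm, zero_smul, map_zero, LinearMap.zero_apply]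
        · simp
      rw [← h1]
      exact Submodule.smul_mem _ _ (Submodule.mem_span_singleton_self z)
    exact Submodule.mem_span_singleton.1 hmem

end Ind

end KLR

/-! ### Products of semi-cuspidal sequences and their simple quotients -/

namespace KLR

variable {I K : Type u} [Fintype I] [Field K] {D : Params I K}

theorem Rep.hasQuotient_of_surjective (M : Rep D) (A : Type u) [AddCommGroup A] [Module K A]
    [Module (Alg D M.n) A] [IsScalarTower K (Alg D M.n) A] (f : M.V →ₗ[Alg D M.n] A)
    (hf : Function.Surjective f) : M.HasQuotient (Rep.mk M.n A) :=
  ⟨rfl, f.restrictScalars K, fun r x => f.map_smul r x, hf⟩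

variable [DecidableEq I]

theorem Headed.hasUniqueSimpleQuotient_and_exists {M : Rep D} {S : Set (Fin M.n → I)}
    (h : Headed D M.V S) [hf : FiniteDimensional K M.V] (hM : DotsNilpotent D M.n M.V) :
    HasUniqueSimpleQuotient M ∧ ∃ A : Simple D, M.HasQuotient A.toRep := by
  refine ⟨h.existsUnique, ?_⟩
  obtain ⟨N, hN, -⟩ := h.existsUnique
  have : FiniteDimensional K (M.V ⧸ N) :=
    Module.Finite.of_surjective (N.mkQ.restrictScalars K) N.mkQ_surjective
  obtain ⟨A, hA⟩ := exists_simple_toRep_eq D M.n (M.V ⧸ N) fun p => by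
    obtain ⟨s, hs⟩ := hM p
    refine ⟨s, fun x => ?_⟩
    obtain ⟨x, rfl⟩ := N.mkQ_surjective x
    rw [← map_smul, hs, map_zero]
  refine ⟨A, ?_⟩
  rw [hA]
  exact M.hasQuotient_of_surjective _ N.mkQ N.mkQ_surjective

theorem finiteDimensional_alg_zero (D : Params I K) : FiniteDimensional K (Alg D 0) :=
  Module.Finite.of_surjective (Algebra.linearMap K (Alg D 0)) fun r =>
    let ⟨c, hc⟩ := Alg.exists_eq_algebraMap r
    ⟨c, hc.symm⟩

theorem SemiCuspidal.slope_prefixWeight_le {c : Charge I} {L : Simple D} (hL : SemiCuspidal c L)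
    {i : Fin L.n → I} (hi : HasWord D L.V i) (p : ℕ) : c.slope L.wt (prefixWeight i p) ≤ 0 := by
  rcases Nat.eq_zero_or_pos p with rfl | h0
  · rw [prefixWeight_zero, Charge.slope_zero]
  rcases lt_or_ge p L.n with h1 | h1
  · rw [← Charge.arg_le_arg_iff (prefixWeight_ne_zero i (h0.trans h1) h0) hL.1,
      ← L.wordWeight_eq hi]
    exact hL.2 i hi p h0 h1
  · rw [prefixWeight_of_le i h1, L.wordWeight_eq hi, Charge.slope_self]

/-- The properties of the induction product of a semi-cuspidal sequence beginning with `L`. -/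
structure StandardModule (c : Charge I) (L : Simple D) (M : Rep D) : Prop where
  n_pos : 0 < M.n
  finite : FiniteDimensional K M.V
  dotsNilpotent : DotsNilpotent D M.n M.V
  headed : ∃ S : Set (Fin M.n → I), Headed D M.V S ∧ ∀ k ∈ S, L.n ≤ M.n ∧ prefixWeight k L.n = L.wt
  -- Here `β` is the contribution of the factors after `L`. The last clause says that any letter
  -- from them strictly lowers the slope; this is what makes the length and the weight of `L`
  -- recognizable in a quotient.
  prefixWeight_eq : ∀ k : Fin M.n → I, HasWord D M.V k → ∀ p ≤ M.n, ∃ (i : Fin L.n → I) (s : ℕ) (β : I → ℕ),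
    HasWord D L.V i ∧ s ≤ L.n ∧ s ≤ p ∧ prefixWeight k p = prefixWeight i s + β ∧ c.slope L.wt β ≤ 0 ∧ (c.slope L.wt β = 0 → s = p ∧ β = 0)

namespace StandardModule

variable {c : Charge I} {L : Simple D} {M : Rep D}

theorem slope_prefixWeight_le (h : StandardModule c L M) (hL : SemiCuspidal c L) {k : Fin M.n → I}
    (hk : HasWord D M.V k) {p : ℕ} (hp : p ≤ M.n) : c.slope L.wt (prefixWeight k p) ≤ 0 := by
  obtain ⟨i, s, β, hi, -, -, h, hβ, -⟩ := h.prefixWeight_eq k hk p hp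
  rw [h, Charge.slope_add]
  exact add_nonpos (hL.slope_prefixWeight_le hi s) hβ

theorem single (hL : SemiCuspidal c L) : StandardModule c L L.toRep where
  n_pos := L.n_pos hL.1
  finite := L.finite
  dotsNilpotent := L.dotsNilpotent
  headed := ⟨{k | wordWeight k = L.wt}, Headed.of_isSimpleModule fun _ hk => L.wordWeight_eq hk,
    fun k hk => ⟨le_rfl, (prefixWeight_of_le k le_rfl).trans hk⟩⟩
  prefixWeight_eq k hk p hp :=
    ⟨k, p, 0, hk, hp, le_rfl, (add_zero _).symm, (c.slope_zero _).le,
      fun _ => ⟨rfl, rfl⟩⟩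

/-- A prefix of weight `wt L` has slope `0`. It is composed of a prefix of a word of `L`, of slope
at most `0`, and of a prefix of a word of `M`, of negative slope unless it is empty. So it is empty,
the first `L.n` positions hold strands of `L` only, and the shuffle is trivial. -/
theorem shuffleFree (hL : SemiCuspidal c L) (hM : ∀ j : Fin M.n → I, HasWord D M.V j → ∀ t, 0 < t →
      t ≤ M.n → c.slope L.wt (prefixWeight j t) < 0) :
    ShuffleFree D M.n L.V M.V {i : Fin L.n → I | wordWeight i = L.wt} := by
  rintro l x a i j hx hi hj ⟨i', hi', j', h⟩
  obtain ⟨s, t, -, hs, ht, hst, h1⟩ := hx.exists_prefixWeight L.n (Nat.le_add_right _ _)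
  refine (h1 rfl ?_).1
  by_contra ht0
  have h2 := congrArg (c.slope L.wt) (hst i j)
  rw [h, prefixWeight_append_self, Charge.slope_add, show wordWeight i' = L.wt from hi',
    Charge.slope_self] at h2
  have h3 := hM j hj t (Nat.pos_of_ne_zero ht0) ht
  have h4 := hL.slope_prefixWeight_le hi s
  linarith

theorem ind (hL : SemiCuspidal c L) (hM : ∀ j : Fin M.n → I, HasWord D M.V j → ∀ t, 0 < t →
      t ≤ M.n → c.slope L.wt (prefixWeight j t) < 0) [hf : FiniteDimensional K M.V]
    (hnil : DotsNilpotent D M.n M.V) {S : Set (Fin M.n → I)} (hS : Headed D M.V S) :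
    StandardModule c L (Rep.ind L.toRep M) where
  n_pos := Nat.add_pos_left (L.n_pos hL.1) _
  finite := Ind.finiteDimensional D (V := L.V) (W := M.V)
  dotsNilpotent := Ind.dotsNilpotent D (V := L.V) (W := M.V) L.dotsNilpotent hnil
  headed := ⟨appendWords {i : Fin L.n → I | wordWeight i = L.wt} S,
    Ind.headed (V := L.V) (W := M.V) L.dotsNilpotent (fun i hi => L.wordWeight_eq hi) hS
      (shuffleFree hL hM), by
    rintro _ ⟨i, hi, j, -, rfl⟩
    exact ⟨Nat.le_add_right _ _, (prefixWeight_append_self i j).trans hi⟩⟩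
  prefixWeight_eq k hk p hp := by
    obtain ⟨l, x, a, i, j, hx, hi, hj, rfl⟩ :=
      Ind.exists_eq_append_comp_of_hasWord D (V := L.V) (W := M.V) hk
    obtain ⟨s, t, hst, hs, ht, h, -⟩ := hx.exists_prefixWeight p hp
    refine ⟨i, s, prefixWeight j t, hi, hs, by omega, h i j, ?_⟩
    rcases Nat.eq_zero_or_pos t with rfl | h0
    · rw [prefixWeight_zero, Charge.slope_zero]
      exact ⟨le_rfl, fun _ => ⟨hst, rfl⟩⟩
    · have := hM j hj t h0 ht
      exact ⟨this.le, fun h => absurd h this.ne⟩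

end StandardModule

theorem SemiCuspidalSeq.tail {c : Charge I} {L : Simple D} {T : List (Simple D)}
    (h : SemiCuspidalSeq c (L :: T)) : SemiCuspidalSeq c T :=
  ⟨fun L hL => h.1 L (List.mem_cons_of_mem _ hL), (List.pairwise_cons.1 h.2).2⟩

theorem SemiCuspidalSeq.head {c : Charge I} {L : Simple D} {T : List (Simple D)}
    (h : SemiCuspidalSeq c (L :: T)) : SemiCuspidal c L := h.1 L List.mem_cons_self

/-- Prefixes of the words of the tail have smaller slope than the head. -/
theorem StandardModule.slope_neg {c : Charge I} {L L' : Simple D} {M : Rep D}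
    (h : StandardModule c L' M) (hL : SemiCuspidal c L) (hL' : SemiCuspidal c L')
    (hlt : c.arg L'.wt < c.arg L.wt) {j : Fin M.n → I} (hj : HasWord D M.V j) {t : ℕ} (h0 : 0 < t)
    (ht : t ≤ M.n) : c.slope L.wt (prefixWeight j t) < 0 := by
  have hne := prefixWeight_ne_zero j h.n_pos h0
  rw [← Charge.arg_lt_arg_iff hne hL.1]
  exact lt_of_le_of_lt ((Charge.arg_le_arg_iff hne hL'.1).2 (h.slope_prefixWeight_le hL' hj ht)) hlt

/-- The product is built from the right: by `StandardModule.slope_neg` the tail satisfies the strict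
inequality under which a further factor can be put in front. -/
theorem SemiCuspidalSeq.standardModule {c : Charge I} {T : List (Simple D)} {L : Simple D}
    (h : SemiCuspidalSeq c (L :: T)) : StandardModule c L (indSimple (L :: T)) := by
  induction T generalizing L with
  | nil => exact StandardModule.single h.head
  | cons L' T ih =>
    have hT := ih h.tail
    obtain ⟨S, hS, -⟩ := hT.headed
    exact StandardModule.ind (hf := hT.finite) h.head (fun j hj t h0 ht => hT.slope_neg h.head h.tail.head
      ((List.pairwise_cons.1 h.2).1 L' List.mem_cons_self) hj h0 ht) hT.dotsNilpotent hS

theorem SemiCuspidalSeq.hasUniqueSimpleQuotient_and_exists {c : Charge I} {Ls : List (Simple D)}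
    (h : SemiCuspidalSeq c Ls) : HasUniqueSimpleQuotient (indSimple Ls) ∧
      ∃ A : Simple D, (indSimple Ls).HasQuotient A.toRep := by
  cases Ls with
  | nil =>
    exact Headed.hasUniqueSimpleQuotient_and_exists (M := Rep.unit D) (Headed.unit D)
      (hf := finiteDimensional_alg_zero D) fun k => k.elim0
  | cons L T =>
    have hT := h.standardModule
    have := hT.finite
    obtain ⟨S, hS, -⟩ := hT.headed
    exact hS.hasUniqueSimpleQuotient_and_exists hT.dotsNilpotent

end KLR

/-! ### Restriction and the module of homomorphisms from the left factor -/

namespace KLR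

section

variable {I K : Type u} [Fintype I] [Field K]

section Restriction

/-- The restriction of a module to the KLR algebra on the first `m` strands. -/
def ResLeft (_ : Params I K) (_ _ : ℕ) (V : Type u) : Type u := V

variable (D : Params I K) (m n : ℕ) (L V : Type u) [AddCommGroup V] [Module K V]
  [Module (Alg D (m + n)) V] [IsScalarTower K (Alg D (m + n)) V]
  [AddCommGroup L] [Module K L] [Module (Alg D m) L] [IsScalarTower K (Alg D m) L]

noncomputable instance : AddCommGroup (ResLeft D m n V) := inferInstanceAs (AddCommGroup V)

noncomputable instance : Module K (ResLeft D m n V) := inferInstanceAs (Module K V)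

noncomputable instance : Module (Alg D m) (ResLeft D m n V) :=
  Module.compHom V (Alg.inclLeft D m n).toRingHom

noncomputable instance : IsScalarTower K (Alg D m) (ResLeft D m n V) where
  smul_assoc c a x := by
    change (Alg.inclLeft D m n (c • a) • (show V from x) : V) = c • Alg.inclLeft D m n a • (show V from x)
    rw [map_smul, smul_assoc]

instance [h : FiniteDimensional K V] : FiniteDimensional K (ResLeft D m n V) := h

/-- Homomorphisms from a module over the KLR algebra on `m` strands to the restriction of a module
over the KLR algebra on `m + n` strands. -/
def HomLeft : Type u := L →ₗ[Alg D m] ResLeft D m n V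

namespace HomLeft

noncomputable instance : AddCommGroup (HomLeft D m n L V) :=
  inferInstanceAs (AddCommGroup (L →ₗ[Alg D m] ResLeft D m n V))

instance : FunLike (HomLeft D m n L V) L V :=
  inferInstanceAs (FunLike (L →ₗ[Alg D m] ResLeft D m n V) L (ResLeft D m n V))

variable {D m n L V}

theorem add_apply (f g : HomLeft D m n L V) (v : L) : (f + g) v = f v + g v := rfl

theorem zero_apply (v : L) : (0 : HomLeft D m n L V) v = 0 := rfl

protected theorem map_add (f : HomLeft D m n L V) (v w : L) : f (v + w) = f v + f w :=
  LinearMap.map_add (σ := RingHom.id (Alg D m)) f v w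

protected theorem map_smul (f : HomLeft D m n L V) (a : Alg D m) (v : L) :
    f (a • v) = Alg.inclLeft D m n a • f v :=
  LinearMap.map_smul (R := Alg D m) f a v

/-- The right strands commute with the left ones, so they act on the values of a homomorphism
without destroying its linearity. -/
noncomputable instance : Module (Alg D n) (HomLeft D m n L V) where
  smul b f := LinearMap.mk (σ := RingHom.id (Alg D m)) (M := L) (M₂ := ResLeft D m n V)
    ⟨fun v => (Alg.inclRight D m n b • f v : V), fun v w => by rw [HomLeft.map_add, smul_add]; rfl⟩
    fun a v => by
      change Alg.inclRight D m n b • f (a • v) =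
        Alg.inclLeft D m n a • Alg.inclRight D m n b • f v
      rw [HomLeft.map_smul, ← mul_smul, ← mul_smul, (Alg.incl_commute m n a b).eq]
  one_smul f := DFunLike.ext _ _ fun v => by
    change Alg.inclRight D m n 1 • f v = f v
    rw [map_one, one_smul]
  mul_smul a b f := DFunLike.ext _ _ fun v => by
    change Alg.inclRight D m n (a * b) • f v =
      Alg.inclRight D m n a • Alg.inclRight D m n b • f v
    rw [map_mul, mul_smul]
  smul_zero a := DFunLike.ext _ _ fun v => smul_zero (Alg.inclRight D m n a)
  smul_add a f g := DFunLike.ext _ _ fun v => smul_add (Alg.inclRight D m n a) (f v) (g v)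
  add_smul a b f := DFunLike.ext _ _ fun v => by
    change Alg.inclRight D m n (a + b) • f v =
      Alg.inclRight D m n a • f v + Alg.inclRight D m n b • f v
    rw [map_add, add_smul]
  zero_smul f := DFunLike.ext _ _ fun v => by
    change Alg.inclRight D m n 0 • f v = 0
    rw [map_zero, zero_smul]

theorem smul_apply (b : Alg D n) (f : HomLeft D m n L V) (v : L) :
    (b • f) v = Alg.inclRight D m n b • f v := rfl

noncomputable instance : Module K (HomLeft D m n L V) :=
  Module.compHom _ (algebraMap K (Alg D n))

instance : IsScalarTower K (Alg D n) (HomLeft D m n L V) where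
  smul_assoc c a f := by
    change (c • a) • f = algebraMap K (Alg D n) c • a • f
    rw [← mul_smul, ← Algebra.smul_def]

theorem smul_apply' (c : K) (f : HomLeft D m n L V) (v : L) : (c • f) v = c • f v := by
  change Alg.inclRight D m n (algebraMap K (Alg D n) c) • f v = c • f v
  rw [AlgHom.commutes, algebraMap_smul]

theorem map_smul' (f : HomLeft D m n L V) (c : K) (v : L) : f (c • v) = c • f v := by
  rw [← algebraMap_smul (Alg D m) c v, HomLeft.map_smul, AlgHom.commutes, algebraMap_smul]

instance [FiniteDimensional K L] [FiniteDimensional K V] :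
    FiniteDimensional K (HomLeft D m n L V) := by
  let F : HomLeft D m n L V →ₗ[K] (L →ₗ[K] V) :=
    { toFun := fun f => ⟨⟨f, HomLeft.map_add f⟩, map_smul' f⟩
      map_add' := fun f g => rfl
      map_smul' := fun c f => LinearMap.ext fun v => smul_apply' c f v }
  refine Module.Finite.of_injective F fun f g h => DFunLike.ext _ _ fun v => ?_
  exact LinearMap.congr_fun h v

theorem dotsNilpotent (h : DotsNilpotent D (m + n) V) :
    DotsNilpotent D n (HomLeft D m n L V) := fun k => by
  obtain ⟨N, hN⟩ := h (Fin.natAdd m k)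
  refine ⟨N, fun f => DFunLike.ext _ _ fun v => ?_⟩
  rw [smul_apply, map_pow, Alg.inclRight_y, hN, zero_apply]

/-- A vector of `L` is split into its components `e i • v`; the idempotents of `i` on the left and
of `j` on the right multiply to that of the concatenation. -/
theorem exists_hasWord_append {j : Fin n → I} (hj : HasWord D (HomLeft D m n L V) j) :
    ∃ i : Fin m → I, HasWord D L i ∧ HasWord D V (Fin.append i j) := by
  obtain ⟨f, hf⟩ := hj
  obtain ⟨v, hv⟩ := not_forall.1 fun h => hf (DFunLike.ext _ 0 h)
  rw [smul_apply, zero_apply] at hv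
  by_contra! h
  apply hv
  rw [← one_smul (Alg D m) v, ← Alg.sum_e, HomLeft.map_smul, map_sum, Finset.sum_smul, Finset.smul_sum]
  refine Finset.sum_eq_zero fun i _ => ?_
  by_cases hi : Alg.e D i • v = 0
  · rw [← HomLeft.map_smul, hi, ← zero_smul K v, map_smul', zero_smul, smul_zero]
  · rw [← mul_smul, ← (Alg.incl_commute m n _ _).eq, Alg.inclLeft_mul_inclRight_e]
    by_contra h'
    exact h i ⟨v, hi⟩ ⟨_, h'⟩

variable {W : Type u} [AddCommGroup W] [Module K W] [Module (Alg D n) W]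
  [IsScalarTower K (Alg D n) W]

/-- Frobenius reciprocity, with one factor moved to the right. -/
theorem exists_lift (φ : W →ₗ[Alg D n] HomLeft D m n L V) :
    ∃ F : Ind D m n L W →ₗ[Alg D (m + n)] V, ∀ v w, F (Ind.tmul D m n v w) = φ w v := by
  refine Ind.exists_lift D (LinearMap.mk₂ K (fun v w => φ w v) (fun v v' w => HomLeft.map_add _ _ _)
    (fun c v w => map_smul' _ _ _) (fun v w w' => ?_) (fun c v w => ?_)) (fun a b v w => ?_)
  · rw [map_add, add_apply]
  · rw [← algebraMap_smul (Alg D n) c w, map_smul, smul_apply, AlgHom.commutes,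
      algebraMap_smul]
  · change φ (b • w) (a • v) = Alg.inclLeft D m n a • Alg.inclRight D m n b • φ w v
    rw [LinearMap.map_smul φ, smul_apply, HomLeft.map_smul, ← mul_smul, ← mul_smul,
      (Alg.incl_commute m n a b).eq]

/-- The homomorphism corresponding to a homomorphism out of an induction product. -/
noncomputable def ofInd (F : Ind D m n L W →ₗ[Alg D (m + n)] V) :
    W →ₗ[Alg D n] HomLeft D m n L V where
  toFun w := LinearMap.mk (σ := RingHom.id (Alg D m)) (M := L) (M₂ := ResLeft D m n V)
    ⟨fun v => F (Ind.tmul D m n v w), fun v v' => by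
      rw [map_add, LinearMap.add_apply, map_add]; rfl⟩
    fun a v => by
      change F (Ind.tmul D m n (a • v) w) = Alg.inclLeft D m n a • F (Ind.tmul D m n v w)
      rw [← Ind.inclLeft_smul_tmul, map_smul]
  map_add' w w' := DFunLike.ext _ _ fun v => by
    change F (Ind.tmul D m n v (w + w')) = F (Ind.tmul D m n v w) + F (Ind.tmul D m n v w')
    rw [map_add, map_add]
  map_smul' b w := DFunLike.ext _ _ fun v => by
    change F (Ind.tmul D m n v (b • w)) = Alg.inclRight D m n b • F (Ind.tmul D m n v w)
    rw [← Ind.inclRight_smul_tmul, map_smul]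

theorem ofInd_apply (F : Ind D m n L W →ₗ[Alg D (m + n)] V) (v : L) (w : W) :
    ofInd F w v = F (Ind.tmul D m n v w) := rfl

end HomLeft

end Restriction

end

end KLR

/-! ### Existence of the semi-cuspidal sequence -/

namespace KLR

variable {I K : Type u} [Fintype I] [Field K] {D : Params I K}

theorem Rep.HasQuotient.exists_linearMap {M : Rep D} {A : Type u} [AddCommGroup A] [Module K A]
    [Module (Alg D M.n) A] [IsScalarTower K (Alg D M.n) A] (h : M.HasQuotient (Rep.mk M.n A)) :
    ∃ f : M.V →ₗ[Alg D M.n] A, Function.Surjective f := by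
  obtain ⟨_, f, hf, hs⟩ := h
  exact ⟨{ toFun := f, map_add' := map_add f, map_smul' := hf }, hs⟩

theorem Ind.hasQuotient_of_surjective {m n : ℕ} {L W V : Type u} [AddCommGroup V] [Module K V]
    [Module (Alg D (m + n)) V] [IsScalarTower K (Alg D (m + n)) V]
    [AddCommGroup L] [Module K L] [Module (Alg D m) L] [IsScalarTower K (Alg D m) L]
    [AddCommGroup W] [Module K W] [Module (Alg D n) W] [IsScalarTower K (Alg D n) W]
    (F : Ind D m n L W →ₗ[Alg D (m + n)] V) (hF : Function.Surjective F) :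
    (Rep.ind (Rep.mk m L : Rep D) (Rep.mk n W : Rep D)).HasQuotient (Rep.mk (m + n) V) :=
  ⟨rfl, F.restrictScalars K, fun r x => F.map_smul r x, hF⟩

/-- A simple submodule of the restriction to the first `m` strands, on words with given weight. -/
theorem exists_simple_submodule_resLeft [DecidableEq I] {m n : ℕ} {V : Type u} [AddCommGroup V]
    [Module K V] [Module (Alg D (m + n)) V] [IsScalarTower K (Alg D (m + n)) V]
    [FiniteDimensional K V] {i : Fin m → I} {j : Fin n → I} (hk : HasWord D V (Fin.append i j)) :
    ∃ L : Submodule (Alg D m) (ResLeft D m n V), IsSimpleModule (Alg D m) L ∧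
      ∀ i' : Fin m → I, HasWord D L i' →
        wordWeight i' = wordWeight i ∧ ∃ j' : Fin n → I, HasWord D V (Fin.append i' j') := by
  classical
  let S : Set (Fin m → I) := {i' | wordWeight i' = wordWeight i}
  let X : Submodule (Alg D m) (ResLeft D m n V) :=
    { carrier := {x | Alg.eSum D S • x = x}
      add_mem' := fun {x y} (hx : _ = _) (hy : _ = _) => by
        change Alg.eSum D S • (x + y) = x + y
        rw [smul_add, hx, hy]
      zero_mem' := smul_zero _
      smul_mem' := fun r x (hx : _ = _) => by
        change Alg.eSum D S • r • x = r • x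
        rw [← mul_smul, Alg.commute_eSum_weight, mul_smul, hx] }
  have hX : X ≠ ⊥ := by
    obtain ⟨x, hx⟩ := hk
    refine (Submodule.ne_bot_iff _).2 ⟨(Alg.e D (Fin.append i j) • x : V), ?_, hx⟩
    change Alg.inclLeft D m n (Alg.eSum D S) • Alg.e D (Fin.append i j) • x =
      Alg.e D (Fin.append i j) • x
    rw [← Alg.inclLeft_mul_inclRight_e, ← mul_smul, ← mul_assoc, ← map_mul, Alg.eSum_mul_e,
      if_pos (by exact rfl)]
  obtain ⟨L, hLX, hL⟩ := exists_simple_le (K := K) X hX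
  refine ⟨L, hL, fun i' hi' => ?_⟩
  obtain ⟨⟨x, hx⟩, hx'⟩ := hi'
  have hx0 : Alg.inclLeft D m n (Alg.e D i') • (show V from x) ≠ 0 := fun h =>
    hx' (Subtype.ext h)
  constructor
  · by_contra h
    apply hx0
    have h1 : Alg.inclLeft D m n (Alg.eSum D S) • (show V from x) = x := hLX hx
    rw [← h1, ← mul_smul, ← map_mul, Alg.e_mul_eSum_of_notMem h, map_zero, zero_smul]
  · by_contra! h
    apply hx0
    rw [Alg.inclLeft_e, Finset.sum_smul]
    refine Finset.sum_eq_zero fun j' _ => ?_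
    by_contra h'
    exact h j' ⟨_, h'⟩

variable [DecidableEq I]

theorem semiCuspidal_of_toRep_eq {c : Charge I} {L : Simple D} {n : ℕ} {V : Type u}
    [AddCommGroup V] [Module K V] [Module (Alg D n) V] [IsScalarTower K (Alg D n) V]
    (hL : L.toRep = Rep.mk n V) (hn : 0 < n) {μ : I → ℕ}
    (h : ∀ k : Fin n → I, HasWord D V k → wordWeight k = μ ∧ SemiCuspidalWord c k) :
    SemiCuspidal c L ∧ L.wt = μ := by
  obtain ⟨x, hx⟩ := exists_ne (0 : L.V)
  obtain ⟨k, hk⟩ := exists_hasWord D L.n hx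
  have hwt := L.wordWeight_eq ⟨x, hk⟩
  obtain ⟨R, wt, h1, h2, h3, h4⟩ := L
  obtain rfl : R = Rep.mk n V := hL
  have hwt' : wordWeight k = wt := hwt
  refine ⟨⟨?_, fun i hi => (h i hi).2⟩, ?_⟩
  · change wt ≠ 0
    rw [← hwt']
    exact wordWeight_ne_zero k hn
  · exact hwt'.symm.trans (h k ⟨x, hk⟩).1

/-- The longest prefix of maximal slope. -/
theorem exists_max_prefixWeight (c : Charge I) {n : ℕ} {V : Type u} [AddCommGroup V]
    [Module (Alg D n) V] [Nontrivial V] (hn : 0 < n) :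
    ∃ (k : Fin n → I) (p : ℕ), HasWord D V k ∧ 0 < p ∧ p ≤ n ∧
      ∀ (k' : Fin n → I) (p' : ℕ), HasWord D V k' → 0 < p' → p' ≤ n →
        c.arg (prefixWeight k' p') < c.arg (prefixWeight k p) ∨
        c.arg (prefixWeight k' p') = c.arg (prefixWeight k p) ∧ p' ≤ p := by
  let s : Set ((Fin n → I) × Fin (n + 1)) := {q | HasWord D V q.1 ∧ 0 < (q.2 : ℕ)}
  have hs : s.Nonempty := by
    obtain ⟨x, hx⟩ := exists_ne (0 : V)
    obtain ⟨k, hk⟩ := exists_hasWord D n hx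
    exact ⟨(k, Fin.last n), ⟨x, hk⟩, hn⟩
  obtain ⟨⟨k, p⟩, ⟨hk, hp⟩, hmax⟩ := Set.exists_max_image s
    (fun q => toLex (c.arg (prefixWeight q.1 q.2), (q.2 : ℕ))) s.toFinite hs
  refine ⟨k, p, hk, hp, by omega, fun k' p' hk' hp' hpn => ?_⟩
  exact Prod.Lex.toLex_le_toLex.1 (hmax (k', ⟨p', by omega⟩) ⟨hk', hp'⟩)

/-- Harder–Narasimhan argument by induction on the number of strands: the prefix of maximal
argument, taken as long as possible, determines the first factor, and the module of homomorphisms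
from that factor carries the rest of the sequence. -/
theorem exists_semiCuspidalSeq (c : Charge I) (n : ℕ) : ∀ (V : Type u) [AddCommGroup V]
    [Module K V] [Module (Alg D n) V] [IsScalarTower K (Alg D n) V] [IsSimpleModule (Alg D n) V]
    [FiniteDimensional K V], DotsNilpotent D n V →
    ∃ Ls : List (Simple D), SemiCuspidalSeq c Ls ∧ (indSimple Ls).HasQuotient (Rep.mk n V) := by
  induction n using Nat.strong_induction_on with
  | _ n ih =>
  intro V _ _ _ _ _ _ hnil
  have := IsSimpleModule.nontrivial (Alg D n) V
  rcases Nat.eq_zero_or_pos n with rfl | hn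
  · obtain ⟨x, hx⟩ := exists_ne (0 : V)
    exact ⟨[], ⟨by simp, List.Pairwise.nil⟩, Rep.hasQuotient_of_surjective (Rep.mk 0 (Alg D 0)) V
      (LinearMap.toSpanSingleton (Alg D 0) V x)
      (IsSimpleModule.toSpanSingleton_surjective (Alg D 0) hx)⟩
  obtain ⟨k, p, hk, hp, hpn, hmax⟩ := exists_max_prefixWeight c (D := D) (V := V) hn
  -- If the chosen prefix is a whole word, its weight is that of `V`, no prefix has a larger
  -- argument, and `V` itself is semi-cuspidal.
  rcases hpn.eq_or_lt with rfl | hpn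
  · obtain ⟨L, hL⟩ := exists_simple_toRep_eq D p V hnil
    refine ⟨[L], ⟨?_, List.pairwise_singleton _ _⟩, ?_⟩
    · intro L' hL'
      obtain rfl := List.mem_singleton.1 hL'
      refine (semiCuspidal_of_toRep_eq hL hn (μ := wordWeight k) fun k' hk' => ?_).1
      have hw := wordWeight_eq_of_hasWord hk hk'
      refine ⟨hw, fun q hq hq' => ?_⟩
      rw [hw, ← prefixWeight_of_le k le_rfl]
      rcases hmax k' q hk' hq hq'.le with h | h
      · exact h.le
      · exact h.1.le
    · change L.toRep.HasQuotient _
      rw [hL]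
      exact Rep.hasQuotient_of_surjective (Rep.mk p V) V LinearMap.id Function.surjective_id
  obtain ⟨n', rfl⟩ := Nat.exists_eq_add_of_le hpn.le
  have hn' : 0 < n' := by omega
  obtain ⟨i, j, rfl⟩ := Alg.exists_eq_append k
  rw [prefixWeight_append_self] at hmax
  have hi := wordWeight_ne_zero i hp
  -- `N` becomes the first factor. Its words have the weight of `i` and are beginnings of words of
  -- `V`, so maximality of the argument makes it semi-cuspidal.
  obtain ⟨N, hN, hNi⟩ := exists_simple_submodule_resLeft hk
  have hNnt := IsSimpleModule.nontrivial (Alg D p) N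
  have : FiniteDimensional K N := inferInstanceAs (FiniteDimensional K (N.restrictScalars K))
  obtain ⟨L, hL⟩ := exists_simple_toRep_eq D p N fun q => by
    obtain ⟨s, hs⟩ := hnil (Fin.castAdd n' q)
    refine ⟨s, fun x => Subtype.ext ?_⟩
    change Alg.inclLeft D p n' (Alg.y D q ^ s) • (show V from x.1) = 0
    rw [map_pow, Alg.inclLeft_y, hs]
  obtain ⟨hLc, hLwt⟩ := semiCuspidal_of_toRep_eq (c := c) hL hp (μ := wordWeight i)
    fun i' hi' => by
      obtain ⟨hw, j', hj'⟩ := hNi i' hi'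
      refine ⟨hw, fun q hq hq' => ?_⟩
      rw [hw, ← prefixWeight_append_left i' j' hq'.le]
      rcases hmax _ q hj' hq (by omega) with h | h
      · exact h.le
      · exact h.1.le
  -- Maximality of the length is used here: a prefix longer than `p` cannot have the maximal
  -- argument, so the letters added after a word of weight `wordWeight i` have strictly negative
  -- slope.
  have hslope : ∀ j' : Fin n' → I, HasWord D (HomLeft D p n' N V) j' → ∀ t, 0 < t → t ≤ n' →
      c.slope (wordWeight i) (prefixWeight j' t) < 0 := by
    intro j' hj' t ht ht'
    obtain ⟨i', hi', hij⟩ := HomLeft.exists_hasWord_append hj'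
    have hw := (hNi i' hi').1
    have h1 : c.arg (prefixWeight (Fin.append i' j') (p + t)) < c.arg (wordWeight i) :=
      (hmax _ (p + t) hij (by omega) (by omega)).resolve_right fun h => by omega
    rwa [Charge.arg_lt_arg_iff (prefixWeight_ne_zero _ hn (by omega)) hi,
      prefixWeight_append_right, Charge.slope_add, hw, Charge.slope_self, zero_add] at h1
  have hne : (⊤ : Submodule (Alg D n') (HomLeft D p n' N V)) ≠ ⊥ := by
    obtain ⟨x, hx⟩ := exists_ne (0 : N)
    refine (Submodule.ne_bot_iff _).2 ⟨N.subtype, trivial, fun h => hx (Subtype.ext ?_)⟩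
    exact DFunLike.congr_fun h x
  obtain ⟨M, -, hM⟩ := exists_simple_le (K := K) _ hne
  have hMnt := IsSimpleModule.nontrivial (Alg D n') M
  have : FiniteDimensional K M := inferInstanceAs (FiniteDimensional K (M.restrictScalars K))
  obtain ⟨T, hT, hTM⟩ := ih n' (by omega) M fun q => by
    obtain ⟨s, hs⟩ := HomLeft.dotsNilpotent (L := N) hnil q
    exact ⟨s, fun x => Subtype.ext (hs x)⟩
  obtain rfl : (indSimple T).n = n' := hTM.1
  obtain ⟨f, hf⟩ := hTM.exists_linearMap
  cases T with
  | nil => exact absurd hn' (lt_irrefl 0)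
  | cons L' T =>
    have hst := hT.standardModule
    obtain ⟨S, hS, hSw⟩ := hst.headed
    -- The weight of `L'` is a prefix weight of some word of the quotient `M`, which is a word of
    -- the homomorphism module.
    have hlt : c.arg L'.wt < c.arg L.wt := by
      obtain ⟨k, hkS, x, hx⟩ := hS.exists_hasWord hf
      obtain ⟨h1, h2⟩ := hSw k hkS
      rw [hLwt, Charge.arg_lt_arg_iff hT.head.1 hi, ← h2]
      exact hslope k ⟨x, fun h => hx (Subtype.ext h)⟩ _ (L'.n_pos hT.head.1) h1
    refine ⟨L :: L' :: T, ⟨?_, List.pairwise_cons.2 ⟨?_, hT.2⟩⟩, ?_⟩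
    · intro M' hM'
      rcases List.mem_cons.1 hM' with rfl | h
      · exact hLc
      · exact hT.1 _ h
    · intro M' hM'
      rcases List.mem_cons.1 hM' with rfl | h
      · exact hlt
      · exact ((List.pairwise_cons.1 hT.2).1 _ h).trans hlt
    · change (Rep.ind L.toRep (indSimple (L' :: T))).HasQuotient _
      rw [hL]
      obtain ⟨F, hF⟩ := HomLeft.exists_lift (M.subtype ∘ₗ f)
      suffices hF' : Function.Surjective F by
        have h := Ind.hasQuotient_of_surjective F hF'
        exact h
      rw [← LinearMap.range_eq_top]
      -- The range is a submodule of a simple module, and it is nonzero because `F` takes the values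
      -- of the homomorphisms in `M`, not all of which are zero.
      refine (eq_bot_or_eq_top _).resolve_left fun h => ?_
      obtain ⟨φ, hφ⟩ := exists_ne (0 : M)
      obtain ⟨w, rfl⟩ := hf φ
      refine hφ (Subtype.ext (DFunLike.ext _ _ fun v => ?_))
      have h1 : F (Ind.tmul D p _ v w) ∈ LinearMap.range F := ⟨_, rfl⟩
      rw [h, Submodule.mem_bot, hF] at h1
      exact h1

end KLR

/-! ### Recovering the factors of an induction product from a quotient -/

namespace KLR

/-- Both maps are injective, and both images are generated by the common nonzero vector. -/
theorem nonempty_linearEquiv_of_apply_eq {R M M' Z : Type*} [Ring R] [AddCommGroup M] [Module R M]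
    [AddCommGroup M'] [Module R M'] [AddCommGroup Z] [Module R Z] [IsSimpleModule R M]
    [IsSimpleModule R M'] (f : M →ₗ[R] Z) (f' : M' →ₗ[R] Z) {x : M} {x' : M'} (h : f x = f' x')
    (h0 : f x ≠ 0) : Nonempty (M ≃ₗ[R] M') := by
  have hf : Function.Injective f :=
    f.injective_or_eq_zero.resolve_right fun hf => h0 (by rw [hf, LinearMap.zero_apply])
  have hf' : Function.Injective f' :=
    f'.injective_or_eq_zero.resolve_right fun hf => h0 (by rw [h, hf, LinearMap.zero_apply])
  have hx : x ≠ 0 := fun hx => h0 (by rw [hx, map_zero])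
  have hx' : x' ≠ 0 := fun hx => h0 (by rw [h, hx, map_zero])
  have hr : LinearMap.range f = LinearMap.range f' := by
    apply le_antisymm
    · rintro _ ⟨y, rfl⟩
      obtain ⟨r, rfl⟩ := exists_smul_eq (A := R) hx y
      exact ⟨r • x', by rw [map_smul, map_smul, h]⟩
    · rintro _ ⟨y, rfl⟩
      obtain ⟨r, rfl⟩ := exists_smul_eq (A := R) hx' y
      exact ⟨r • x, by rw [map_smul, map_smul, h]⟩
  exact ⟨(LinearEquiv.ofInjective f hf).trans
    ((LinearEquiv.ofEq _ _ hr).trans (LinearEquiv.ofInjective f' hf').symm)⟩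

variable {I K : Type u} [Fintype I] [Field K] {D : Params I K}

section

variable {m n : ℕ} {L L' W W' A : Type u} [AddCommGroup A] [Module K A]
  [Module (Alg D (m + n)) A] [IsScalarTower K (Alg D (m + n)) A]
  [AddCommGroup L] [Module K L] [Module (Alg D m) L] [IsScalarTower K (Alg D m) L]
  [AddCommGroup L'] [Module K L'] [Module (Alg D m) L'] [IsScalarTower K (Alg D m) L']
  [AddCommGroup W] [Module K W] [Module (Alg D n) W] [IsScalarTower K (Alg D n) W]
  [AddCommGroup W'] [Module K W'] [Module (Alg D n) W'] [IsScalarTower K (Alg D n) W']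

protected theorem HomLeft.map_zero (f : HomLeft D m n L A) : f 0 = 0 :=
  LinearMap.map_zero (σ := RingHom.id (Alg D m)) f

theorem HomLeft.supportedOn_apply {S : Set (Fin m → I)} (hS : ∀ i : Fin m → I, HasWord D L i → i ∈ S)
    (f : HomLeft D m n L A) (v : L) : SupportedOn D (leftWords n S) (f v) := by
  intro k hk
  obtain ⟨i, j, rfl⟩ := Alg.exists_eq_append k
  rw [← Alg.inclLeft_mul_inclRight_e, (Alg.incl_commute m n _ _).eq, mul_smul, ← HomLeft.map_smul,
    supportedOn_of_hasWord hS v i fun hi => hk ⟨i, hi, j, rfl⟩, HomLeft.map_zero, smul_zero]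

/-- In a quotient of an induction product, an element whose words begin with words of the left
factor comes from the part of the product not involving crossings. -/
theorem exists_eq_sum_apply_tmul {S : Set (Fin m → I)} (hS : ShuffleFree D n L W S)
    {q : Ind D m n L W →ₗ[Alg D (m + n)] A} (hq : Function.Surjective q) {κ : Type*} [Fintype κ]
    (b : Module.Basis κ K L) {x : A} (hx : SupportedOn D (leftWords n S) x) :
    ∃ w : κ → W, x = ∑ k, q (Ind.tmul D m n (b k) (w k)) := by
  obtain ⟨z, rfl⟩ := hq x
  obtain ⟨w, hw⟩ := Ind.exists_eq_sum_tmul hS b (supportedOn_eSum_smul (leftWords n S) z)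
  refine ⟨w, ?_⟩
  rw [← map_sum, ← hw, map_smul, hx.eSum_smul]

/-- A rank one operator on the left factor extracts one coefficient from the normal form given by
`exists_eq_sum_apply_tmul`. -/
theorem inclLeft_smul_sum_apply_tmul {κ : Type*} [Fintype κ] (b : Module.Basis κ K L) {a : Alg D m}
    {k : κ} {v : L} (ha : ∀ x, a • x = b.coord k x • v) (q : Ind D m n L W →ₗ[Alg D (m + n)] A)
    (w : κ → W) : Alg.inclLeft D m n a • ∑ k, q (Ind.tmul D m n (b k) (w k)) =
      q (Ind.tmul D m n v (w k)) := by
  rw [Finset.smul_sum, Finset.sum_eq_single k]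
  · rw [← map_smul, Ind.inclLeft_smul_tmul, ha, b.coord_apply, b.repr_self,
      Finsupp.single_eq_same, one_smul]
  · intro k' _ hk'
    rw [← map_smul, Ind.inclLeft_smul_tmul, ha, b.coord_apply, b.repr_self,
      Finsupp.single_eq_of_ne hk'.symm, zero_smul, map_zero, LinearMap.zero_apply, map_zero]
  · simp

/-- The value of `φ` at a basis vector `b k` comes from tensors without crossings, and the
coordinate projection to `b k`, which fixes this value, reduces it to the image of a single tensor
`b k ⊗ w k`. As `b k` generates `L`, the homomorphism `φ` belongs to `w k`. -/
theorem HomLeft.ofInd_surjective [IsSimpleModule (Alg D m) L] [FiniteDimensional K L]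
    (hL : DotsNilpotent D m L) {S : Set (Fin m → I)} (hLS : ∀ i : Fin m → I, HasWord D L i → i ∈ S)
    (hS : ShuffleFree D n L W S) {q : Ind D m n L W →ₗ[Alg D (m + n)] A}
    (hq : Function.Surjective q) : Function.Surjective (HomLeft.ofInd q) := by
  intro φ
  have := IsSimpleModule.nontrivial (Alg D m) L
  let b := Module.finBasis K L
  obtain ⟨k⟩ := b.index_nonempty
  obtain ⟨w, hw⟩ := exists_eq_sum_apply_tmul hS hq b (φ.supportedOn_apply hLS (b k))
  obtain ⟨a, ha⟩ := exists_smul_eq_coord_smul hL b k (b k)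
  have h1 : φ (b k) = q (Ind.tmul D m n (b k) (w k)) := by
    rw [← inclLeft_smul_sum_apply_tmul b ha, ← hw, ← HomLeft.map_smul, ha, b.coord_apply,
      b.repr_self, Finsupp.single_eq_same, one_smul]
  refine ⟨w k, DFunLike.ext _ _ fun v => ?_⟩
  obtain ⟨r, rfl⟩ := exists_smul_eq (A := Alg D m) (b.ne_zero k) v
  rw [HomLeft.map_smul, HomLeft.map_smul, h1, HomLeft.ofInd_apply]

/-- A nonzero value of `q'` on a pure tensor has words beginning in `S`, so it also is the image
under `q` of tensors without crossings. A rank one operator on `L` turns this into a common nonzero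
value of a homomorphism from `L` and one from `L'`. -/
theorem nonempty_linearEquiv_of_common_quotient [Nontrivial A] [IsSimpleModule (Alg D m) L]
    [FiniteDimensional K L] (hL : DotsNilpotent D m L) [IsSimpleModule (Alg D m) L']
    {S : Set (Fin m → I)} (hLS : ∀ i : Fin m → I, HasWord D L' i → i ∈ S)
    (hS : ShuffleFree D n L W S) {q : Ind D m n L W →ₗ[Alg D (m + n)] A}
    (hq : Function.Surjective q) {q' : Ind D m n L' W' →ₗ[Alg D (m + n)] A}
    (hq' : Function.Surjective q') : Nonempty (L ≃ₗ[Alg D m] L') := by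
  obtain ⟨v', w', hne⟩ : ∃ v' w', q' (Ind.tmul D m n v' w') ≠ 0 := by
    by_contra! h
    obtain ⟨x, hx⟩ := exists_ne (0 : A)
    obtain ⟨z, rfl⟩ := hq' x
    apply hx
    clear hx
    induction z using Ind.induction_smul D with
    | hmul r v w => rw [map_smul, h, smul_zero]
    | h0 => rw [map_zero]
    | hadd x y hx hy => rw [map_add, hx, hy, add_zero]
  let b := Module.finBasis K L
  obtain ⟨w, hw⟩ := exists_eq_sum_apply_tmul hS hq b
    ((HomLeft.ofInd q' w').supportedOn_apply hLS v')
  rw [HomLeft.ofInd_apply] at hw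
  obtain ⟨k, hk⟩ : ∃ k, q (Ind.tmul D m n (b k) (w k)) ≠ 0 := by
    by_contra! h
    exact hne (hw.trans (Finset.sum_eq_zero fun k _ => h k))
  obtain ⟨a, ha⟩ := exists_smul_eq_coord_smul hL b k (b k)
  have h1 : q (Ind.tmul D m n (b k) (w k)) = q' (Ind.tmul D m n (a • v') w') := by
    rw [← inclLeft_smul_sum_apply_tmul b ha, ← hw, ← map_smul, Ind.inclLeft_smul_tmul]
  exact nonempty_linearEquiv_of_apply_eq (R := Alg D m) (Z := ResLeft D m n A)
    (HomLeft.ofInd q (w k)) (HomLeft.ofInd q' w') h1 hk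

/-- Composition with a homomorphism of the source. -/
noncomputable def HomLeft.comp (θ : L →ₗ[Alg D m] L') :
    HomLeft D m n L' A →ₗ[Alg D n] HomLeft D m n L A where
  toFun f := LinearMap.comp (σ₁₂ := RingHom.id (Alg D m)) (σ₂₃ := RingHom.id (Alg D m))
    (M₃ := ResLeft D m n A) f θ
  map_add' _ _ := rfl
  map_smul' _ _ := rfl

theorem HomLeft.comp_surjective (θ : L ≃ₗ[Alg D m] L') : Function.Surjective
    (HomLeft.comp θ.toLinearMap : HomLeft D m n L' A →ₗ[Alg D n] HomLeft D m n L A) := fun f =>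
  ⟨HomLeft.comp θ.symm.toLinearMap f, DFunLike.ext _ _ fun v => congrArg f (θ.symm_apply_apply v)⟩

/-- The right factors of two induction products with isomorphic left factors and a common
simple quotient have a common simple quotient. -/
theorem exists_common_quotient [Nontrivial A] [IsSimpleModule (Alg D m) L]
    [FiniteDimensional K L] (hL : DotsNilpotent D m L) [IsSimpleModule (Alg D m) L']
    [FiniteDimensional K L'] (hL' : DotsNilpotent D m L')
    {S : Set (Fin m → I)} (hLS : ∀ i : Fin m → I, HasWord D L i → i ∈ S)
    (hLS' : ∀ i : Fin m → I, HasWord D L' i → i ∈ S)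
    (hS : ShuffleFree D n L W S) (hS' : ShuffleFree D n L' W' S)
    {q : Ind D m n L W →ₗ[Alg D (m + n)] A} (hq : Function.Surjective q)
    {q' : Ind D m n L' W' →ₗ[Alg D (m + n)] A} (hq' : Function.Surjective q')
    [Module.Finite (Alg D n) W] :
    Nonempty (L ≃ₗ[Alg D m] L') ∧ ∃ N : Submodule (Alg D n) (HomLeft D m n L A),
      IsSimpleModule (Alg D n) (HomLeft D m n L A ⧸ N) ∧
      (∃ f : W →ₗ[Alg D n] HomLeft D m n L A ⧸ N, Function.Surjective f) ∧
      ∃ f : W' →ₗ[Alg D n] HomLeft D m n L A ⧸ N, Function.Surjective f := by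
  obtain ⟨θ⟩ := nonempty_linearEquiv_of_common_quotient hL hLS' hS hq hq'
  refine ⟨⟨θ⟩, ?_⟩
  have h1 := HomLeft.ofInd_surjective hL hLS hS hq
  have h2 := HomLeft.ofInd_surjective hL' hLS' hS' hq'
  have hfin : Module.Finite (Alg D n) (HomLeft D m n L A) := Module.Finite.of_surjective _ h1
  -- If there were no nonzero homomorphisms, `q` would vanish on all tensors and hence identically.
  have hne : (⊥ : Submodule (Alg D n) (HomLeft D m n L A)) ≠ ⊤ := by
    intro h
    obtain ⟨x, hx⟩ := exists_ne (0 : A)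
    obtain ⟨z, rfl⟩ := hq x
    apply hx
    clear hx
    induction z using Ind.induction_smul D with
    | hmul r v w =>
      have h3 : HomLeft.ofInd q w ∈ (⊥ : Submodule (Alg D n) (HomLeft D m n L A)) := by
        rw [h]; trivial
      rw [Submodule.mem_bot] at h3
      rw [map_smul, ← HomLeft.ofInd_apply, h3, HomLeft.zero_apply, smul_zero]
    | h0 => rw [map_zero]
    | hadd x y hx hy => rw [map_add, hx, hy, add_zero]
  -- A maximal submodule exists since the homomorphism module, as a quotient of `W`, is finitely
  -- generated.
  obtain ⟨N, hN, -⟩ := (eq_top_or_exists_le_coatom _).resolve_left hne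
  refine ⟨N, isSimpleModule_iff_isCoatom.2 hN, ⟨N.mkQ ∘ₗ HomLeft.ofInd q,
    N.mkQ_surjective.comp h1⟩, ⟨N.mkQ ∘ₗ HomLeft.comp θ.toLinearMap ∘ₗ HomLeft.ofInd q',
    N.mkQ_surjective.comp ((HomLeft.comp_surjective θ).comp h2)⟩⟩

end

end KLR

/-! ### Uniqueness of the semi-cuspidal sequence -/

namespace KLR

variable {I K : Type u} [Fintype I] [Field K] {D : Params I K}

theorem Ind.exists_linearMap_of_hasQuotient {m n : ℕ} {L W A : Type u} [AddCommGroup A]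
    [Module K A] [Module (Alg D (m + n)) A] [IsScalarTower K (Alg D (m + n)) A]
    [AddCommGroup L] [Module K L] [Module (Alg D m) L] [IsScalarTower K (Alg D m) L]
    [AddCommGroup W] [Module K W] [Module (Alg D n) W] [IsScalarTower K (Alg D n) W]
    (h : (Rep.ind (Rep.mk m L : Rep D) (Rep.mk n W : Rep D)).HasQuotient (Rep.mk (m + n) A)) :
    ∃ q : Ind D m n L W →ₗ[Alg D (m + n)] A, Function.Surjective q := by
  obtain ⟨_, f, hf, hs⟩ := h
  exact ⟨{ toFun := f, map_add' := map_add f, map_smul' := hf }, hs⟩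

namespace Rep

theorem Iso.symm {M N : Rep D} (h : M.Iso N) : N.Iso M := by
  obtain ⟨n, V⟩ := M
  obtain ⟨n', V'⟩ := N
  obtain ⟨h, f, hf, hb⟩ := h
  obtain rfl : n = n' := h
  let e := LinearEquiv.ofBijective f hb
  refine ⟨rfl, e.symm.toLinearMap, fun r x => e.injective ?_, e.symm.bijective⟩
  refine (e.apply_symm_apply _).trans (Eq.trans ?_ (hf r (e.symm x)).symm)
  exact congrArg (r • ·) (e.apply_symm_apply x).symm

theorem Iso.trans {M N P : Rep D} (h : M.Iso N) (h' : N.Iso P) : M.Iso P := by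
  obtain ⟨n, V⟩ := M
  obtain ⟨n', V'⟩ := N
  obtain ⟨n'', V''⟩ := P
  obtain ⟨h, f, hf, hb⟩ := h
  obtain ⟨h', f', hf', hb'⟩ := h'
  obtain rfl : n = n' := h
  obtain rfl : n = n'' := h'
  exact ⟨rfl, f' ∘ₗ f, fun r x => (congrArg f' (hf r x)).trans (hf' r (f x)), hb'.comp hb⟩

theorem HasQuotient.iso {M : Rep D} (hM : IsSimpleModule (Alg D M.n) M.V) {n : ℕ} {A : Type u}
    [AddCommGroup A] [Module K A] [Module (Alg D n) A] [IsScalarTower K (Alg D n) A] [Nontrivial A]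
    (h : M.HasQuotient (Rep.mk n A)) : M.Iso (Rep.mk n A) := by
  obtain rfl : M.n = n := h.1
  obtain ⟨f, hf⟩ := h.exists_linearMap
  refine ⟨rfl, f.restrictScalars K, fun r x => f.map_smul r x, ?_, hf⟩
  refine f.injective_or_eq_zero.resolve_right fun h0 => ?_
  obtain ⟨x, hx⟩ := exists_ne (0 : A)
  obtain ⟨z, rfl⟩ := hf x
  exact hx (by rw [h0, LinearMap.zero_apply])

/-- Two induction products with a common simple quotient have isomorphic left factors, and their
right factors have a common simple quotient. -/
theorem iso_and_exists_common_quotient {L M L' M' : Rep D} (hn : L.n = L'.n) (hn' : M.n = M'.n)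
    (hL : IsSimpleModule (Alg D L.n) L.V) (hf : FiniteDimensional K L.V)
    (hnil : DotsNilpotent D L.n L.V) (hL' : IsSimpleModule (Alg D L'.n) L'.V)
    (hf' : FiniteDimensional K L'.V) (hnil' : DotsNilpotent D L'.n L'.V)
    {P : ∀ {n : ℕ}, (Fin n → I) → Prop}
    (hP : ∀ i : Fin L.n → I, HasWord D L.V i → P i)
    (hP' : ∀ i : Fin L'.n → I, HasWord D L'.V i → P i)
    (hS : ShuffleFree D M.n L.V M.V {i : Fin L.n → I | P i})
    (hS' : ShuffleFree D M'.n L'.V M'.V {i : Fin L'.n → I | P i})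
    {n : ℕ} {A : Type u} [AddCommGroup A] [Module K A] [Module (Alg D n) A]
    [IsScalarTower K (Alg D n) A] [Nontrivial A]
    (hq : (Rep.ind L M).HasQuotient (Rep.mk n A)) (hq' : (Rep.ind L' M').HasQuotient (Rep.mk n A))
    (hfin : Module.Finite (Alg D M.n) M.V) :
    L.Iso L' ∧ ∃ B : Rep D, IsSimpleModule (Alg D B.n) B.V ∧ M.HasQuotient B ∧
      M'.HasQuotient B := by
  obtain ⟨m, V⟩ := L
  obtain ⟨m', V'⟩ := L'
  obtain ⟨p, W⟩ := M
  obtain ⟨p', W'⟩ := M'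
  -- `P` is a condition on words of any length, so it speaks of both left factors before their
  -- lengths are identified.
  obtain rfl : m = m' := hn
  obtain rfl : p = p' := hn'
  obtain rfl : m + p = n := hq.1
  obtain ⟨q, hq⟩ := Ind.exists_linearMap_of_hasQuotient hq
  obtain ⟨q', hq'⟩ := Ind.exists_linearMap_of_hasQuotient hq'
  obtain ⟨⟨θ⟩, N, hN, ⟨f, hf⟩, f', hf'⟩ := exists_common_quotient (A := A) (L := V) (L' := V')
    (W := W) (W' := W') (m := m) (n := p) hnil hnil' hP hP' hS hS' (q := q) hq (q' := q') hq'
  exact ⟨⟨rfl, θ.toLinearMap.restrictScalars K, fun r x => θ.map_smul r x, θ.bijective⟩,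
    Rep.mk p _, hN, Rep.hasQuotient_of_surjective (Rep.mk p W) _ f hf,
    Rep.hasQuotient_of_surjective (Rep.mk p W') _ f' hf'⟩

end Rep

variable [DecidableEq I] {c : Charge I}

theorem Charge.slope_swap (μ α : I → ℕ) : c.slope α μ = -c.slope μ α := by
  simp only [slope]
  ring

/-- The weight of the first term of a semi-cuspidal sequence occurs as the weight of a prefix in
every quotient. -/
theorem StandardModule.exists_prefixWeight_eq {L : Simple D} {M : Rep D}
    (h : StandardModule c L M) {n : ℕ} {A : Type u} [AddCommGroup A] [Module K A]
    [Module (Alg D n) A] [IsScalarTower K (Alg D n) A] [Nontrivial A]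
    (hq : M.HasQuotient (Rep.mk n A)) :
    ∃ k : Fin n → I, HasWord D A k ∧ L.n ≤ n ∧ prefixWeight k L.n = L.wt := by
  obtain rfl : M.n = n := hq.1
  obtain ⟨q, hq⟩ := hq.exists_linearMap
  obtain ⟨S, hS, hw⟩ := h.headed
  obtain ⟨k, hkS, hk⟩ := hS.exists_hasWord hq
  exact ⟨k, hk, hw k hkS⟩

/-- If the slope is `0`, then the later factors contribute nothing, and the prefix is a prefix of a
word of `L`. -/
theorem StandardModule.slope_prefixWeight {L : Simple D} {M : Rep D}
    (h : StandardModule c L M) (hL : SemiCuspidal c L) {n : ℕ} {A : Type u} [AddCommGroup A]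
    [Module K A] [Module (Alg D n) A] [IsScalarTower K (Alg D n) A]
    (hq : M.HasQuotient (Rep.mk n A)) {k : Fin n → I} (hk : HasWord D A k) {p : ℕ} (hp : p ≤ n) :
    c.slope L.wt (prefixWeight k p) ≤ 0 ∧ (c.slope L.wt (prefixWeight k p) = 0 →
      p ≤ L.n ∧ (p = L.n → prefixWeight k p = L.wt)) := by
  obtain rfl : M.n = n := hq.1
  obtain ⟨q, hq⟩ := hq.exists_linearMap
  obtain ⟨i, s, β, hi, hs, -, hk, hβ, hβ'⟩ := h.prefixWeight_eq k (hk.of_surjective hq) p hp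
  have h1 := hL.slope_prefixWeight_le hi s
  rw [hk, Charge.slope_add]
  refine ⟨add_nonpos h1 hβ, fun h0 => ?_⟩
  obtain ⟨rfl, rfl⟩ := hβ' (by linarith)
  refine ⟨hs, ?_⟩
  rintro rfl
  rw [add_zero, prefixWeight_of_le i le_rfl, L.wordWeight_eq hi]

/-- Each of the two weights occurs in `A` as a prefix weight, so neither argument exceeds the other.
The equality clause of `StandardModule.slope_prefixWeight` then bounds the length, and for equal
lengths it identifies the weights. -/
theorem StandardModule.le_of_common_quotient {L L' : Simple D} {M M' : Rep D}
    (h : StandardModule c L M) (h' : StandardModule c L' M') (hL : SemiCuspidal c L)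
    (hL' : SemiCuspidal c L') {n : ℕ} {A : Type u} [AddCommGroup A]
    [Module K A] [Module (Alg D n) A] [IsScalarTower K (Alg D n) A] [Nontrivial A]
    (hq : M.HasQuotient (Rep.mk n A)) (hq' : M'.HasQuotient (Rep.mk n A)) :
    L.n ≤ L'.n ∧ (L.n = L'.n → L.wt = L'.wt) := by
  obtain ⟨k, hk, hn, hw⟩ := h.exists_prefixWeight_eq hq
  obtain ⟨k', hk', hn', hw'⟩ := h'.exists_prefixWeight_eq hq'
  have h1 := h'.slope_prefixWeight hL' hq' hk hn
  have h2 := (h.slope_prefixWeight hL hq hk' hn').1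
  rw [hw'] at h2
  rw [hw] at h1
  rw [Charge.slope_swap] at h2
  exact h1.2 (by linarith)

theorem SemiCuspidalSeq.shuffleFree {L L' : Simple D} {T : List (Simple D)}
    (h : SemiCuspidalSeq c (L :: L' :: T)) : ShuffleFree D (indSimple (L' :: T)).n L.V
      (indSimple (L' :: T)).V {i : Fin L.n → I | wordWeight i = L.wt} :=
  StandardModule.shuffleFree h.head fun _ hj _ h0 ht =>
    h.tail.standardModule.slope_neg h.head h.tail.head
      ((List.pairwise_cons.1 h.2).1 L' List.mem_cons_self) hj h0 ht

/-- The comparison in both directions gives first terms of equal length and weight; then they are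
isomorphic and the tails have a common simple quotient. This quotient is not `A`, so the induction
has to allow an arbitrary simple module. -/
theorem SemiCuspidalSeq.forall₂_iso {Ls : List (Simple D)} : ∀ {Ls' : List (Simple D)} {n : ℕ}
    {A : Type u} [AddCommGroup A] [Module K A] [Module (Alg D n) A] [IsScalarTower K (Alg D n) A]
    [IsSimpleModule (Alg D n) A], SemiCuspidalSeq c Ls → SemiCuspidalSeq c Ls' →
    (indSimple Ls).HasQuotient (Rep.mk n A) → (indSimple Ls').HasQuotient (Rep.mk n A) →
    List.Forall₂ (fun M M' => M.toRep.Iso M'.toRep) Ls Ls' := by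
  induction Ls with
  | nil =>
    intro Ls' n A _ _ _ _ _ h h' hq hq'
    cases Ls' with
    | nil => exact List.Forall₂.nil
    | cons L' T' =>
      have h1 : 0 = n := hq.1
      have h2 : (indSimple (L' :: T')).n = n := hq'.1
      have := h'.standardModule.n_pos
      omega
  | cons L T ih =>
    intro Ls' n A _ _ _ _ hA h h' hq hq'
    have := IsSimpleModule.nontrivial (Alg D n) A
    cases Ls' with
    | nil =>
      have h1 : 0 = n := hq'.1
      have h2 : (indSimple (L :: T)).n = n := hq.1
      have := h.standardModule.n_pos
      omega
    | cons L' T' =>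
      have hle := h.standardModule.le_of_common_quotient h'.standardModule h.head h'.head hq hq'
      have hge := h'.standardModule.le_of_common_quotient h.standardModule h'.head h.head hq' hq
      have hn : L.n = L'.n := le_antisymm hle.1 hge.1
      have hwt := hle.2 hn
      have h1 : (indSimple (L :: T)).n = n := hq.1
      have h2 : (indSimple (L' :: T')).n = n := hq'.1
      cases T with
      | nil =>
        cases T' with
        | nil =>
          exact List.Forall₂.cons ((Rep.HasQuotient.iso L.simple hq).trans
            (Rep.HasQuotient.iso L'.simple hq').symm) List.Forall₂.nil
        | cons M' T' =>
          have h3 := h'.tail.standardModule.n_pos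
          change L.n = n at h1
          change L'.n + (indSimple (M' :: T')).n = n at h2
          omega
      | cons M T =>
        have h3 := h.tail.standardModule.n_pos
        change L.n + (indSimple (M :: T)).n = n at h1
        cases T' with
        | nil =>
          change L'.n = n at h2
          omega
        | cons M' T' =>
          change L'.n + (indSimple (M' :: T')).n = n at h2
          obtain ⟨S, hS, -⟩ := h.tail.standardModule.headed
          obtain ⟨hiso, B, hB, hMB, hMB'⟩ := Rep.iso_and_exists_common_quotient
            (L := L.toRep) (L' := L'.toRep) (M := indSimple (M :: T)) (M' := indSimple (M' :: T'))
            hn (by omega) L.simple L.finite L.dotsNilpotent L'.simple L'.finite L'.dotsNilpotent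
            (P := fun i => wordWeight i = L.wt) (fun i hi => L.wordWeight_eq hi)
            (fun i hi => (L'.wordWeight_eq hi).trans hwt.symm) h.shuffleFree
            (by rw [hwt]; exact h'.shuffleFree) hq hq' hS.finite
          exact List.Forall₂.cons hiso (ih h.tail h'.tail hMB hMB')

end KLR

open KLR in
theorem theorem2p4 {I K : Type u} [Fintype I] [DecidableEq I] [Field K] (D : Params I K)
    (c : Charge I) :
    (∀ Ls : List (Simple D), SemiCuspidalSeq c Ls →
      HasUniqueSimpleQuotient (indSimple Ls) ∧
        ∃ A : Simple D, (indSimple Ls).HasQuotient A.toRep) ∧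
    (∀ L : Simple D, ∃ Ls : List (Simple D),
      (SemiCuspidalSeq c Ls ∧ (indSimple Ls).HasQuotient L.toRep) ∧
        ∀ Ls' : List (Simple D), SemiCuspidalSeq c Ls' → (indSimple Ls').HasQuotient L.toRep →
          List.Forall₂ (fun M M' => M.toRep.Iso M'.toRep) Ls Ls') := by
  refine ⟨fun Ls h => h.hasUniqueSimpleQuotient_and_exists, fun L => ?_⟩
  obtain ⟨Ls, hLs, hq⟩ := exists_semiCuspidalSeq c L.n L.V L.dotsNilpotent
  exact ⟨Ls, ⟨hLs, hq⟩, fun Ls' hLs' hq' => hLs.forall₂_iso hLs' hq hq'⟩
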